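/- Let $A$ be a ring with unit, $\mathfrak{C}$ an $A$-coring with comultiplication $\Delta$ and counit $\epsilon$, and $\mathcal{A}$ a set of right $\mathfrak{C}$-comodules. Write $P^*=\mathrm{Hom}_A(P,A)$, $\Sigma=\bigoplus_{P\in\mathcal{A}}P$ (a right $\mathfrak{C}$-comodule with coaction $\rho_\Sigma$), $\Sigma^\dagger=\bigoplus_{P\in\mathcal{A}}P^*$, and consider the extension of rings (not necessarily with unit, the product being composition) $$R=\bigoplus_{P,Q\in\mathcal{A}}\mathrm{Hom}_{\mathfrak{C}}(P,Q)\ \subseteq\ S=\bigoplus_{P,Q\in\mathcal{A}}\mathrm{Hom}_A(P,Q),$$ so that $\Sigma$ is an $R$-$A$-bimodule and $\Sigma^\dagger$ an $A$-$R$-bimodule. Let $\mathrm{Mod}\text{-}R$ be the category of unital right $R$-modules ($M=MR$), and call a left $R$-module $N$ faithfully flat if the functor $-\otimes_R N$ on $\mathrm{Mod}\text{-}R$ is exact and faithful. Let $\mathsf{can}:\Sigma^\dagger\otimes_R\Sigma\to\mathfrak{C}$ be the map $\varphi\otimes_R u\mapsto(\varphi\otimes_A\mathfrak{C})\rho_\Sigma(u)$.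 If every $P\in\mathcal{A}$ is finitely generated and projective as a right $A$-module, then $\Sigma^\dagger\otimes_R\Sigma$ is an $A$-coring with counit $\varphi\otimes u\mapsto\varphi(u)$ and comultiplication $\varphi\otimes p\mapsto\sum_k(\varphi\otimes e_k)\otimes_A(e_k^*\otimes p)$ for $p\in P$, where $\{e_k^*,e_k\}$ is a finite dual basis of $P$, and $\Sigma$ is a right comodule over it with coaction $p\mapsto\sum_k e_k\otimes_A(e_k^*\otimes p)$. A set $\mathcal{A}$ of comodules is a generating set of small projectives if $\mathrm{Hom}_{\mathfrak{C}}(P,-)$ preserves coproducts for every $P\in\mathcal{A}$ and $\bigoplus_{P\in\mathcal{A}}P$ is a projective generator of the category $\mathrm{Comod}\text{-}\mathfrak{C}$ of right $\mathfrak{C}$-comodules. The following statements are equivalent: (i) ${}_A\mathfrak{C}$ is flat and $\mathcal{A}$ is a generating set of small projectives for $\mathrm{Comod}\text{-}\mathfrak{C}$; (ii) ${}_A\mathfrak{C}$ is flat, every comodule in $\mathcal{A}$ is finitely generated and projective as a right $A$-module, $\mathsf{can}:\Sigma^\dagger\otimes_R\Sigma\to\mathfrak{C}$ is an isomorphism of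 $A$-corings, and $-\otimes_R\Sigma:\mathrm{Mod}\text{-}R\to\mathrm{Comod}\text{-}(\Sigma^\dagger\otimes_R\Sigma)$ is an equivalence of categories; (iii) every comodule in $\mathcal{A}$ is finitely generated and projective as a right $A$-module, $\mathsf{can}$ is an isomorphism of $A$-corings, and ${}_R\Sigma$ is faithfully flat; (iv) ${}_A\mathfrak{C}$ is flat, every comodule in $\mathcal{A}$ is finitely generated and projective as a right $A$-module, $\mathsf{can}$ is an isomorphism of $A$-corings, and ${}_RS$ is faithfully flat; (v) ${}_A\mathfrak{C}$ is flat and $-\otimes_R\Sigma:\mathrm{Mod}\text{-}R\to\mathrm{Comod}\text{-}\mathfrak{C}$ is an equivalence of categories. -/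

import Mathlib

universe u v w

noncomputable section

namespace Corings

open CategoryTheory MulOpposite

/-! ## Modules over rings that need not have a unit

Right modules over `R` are left modules over `Rᵐᵒᵖ`: `op r • m` is the product `m r`. -/

/-- A left module over a ring which need not have a unit. -/
class NUModule (R : Type u) (M : Type v) [NonUnitalRing R] [AddCommGroup M]
    extends SMul R M where
  smul_add : ∀ (r : R) (m n : M), r • (m + n) = r • m + r • n
  add_smul : ∀ (r s : R) (m : M), (r + s) • m = r • m + s • m
  mul_smul : ∀ (r s : R) (m : M), (r * s) • m = r • (s • m)

/-- Multiplication by `r` as an additive map. -/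
def NUModule.smulHom {R : Type u} {M : Type v} [NonUnitalRing R] [AddCommGroup M]
    [NUModule R M] (r : R) : M →+ M :=
  AddMonoidHom.mk' (fun m => r • m) (NUModule.smul_add r)

@[simp] theorem NUModule.smulHom_apply {R : Type u} {M : Type v} [NonUnitalRing R]
    [AddCommGroup M] [NUModule R M] (r : R) (m : M) : NUModule.smulHom r m = r • m := rfl

/-- A unital right module over a ring `R` which need not have a unit: every element is a
sum of products `m r`, that is, `M = M R`. -/
structure UnitalRightMod (R : Type u) [NonUnitalRing R] where
  carrier : Type u
  [addCommGroup : AddCommGroup carrier]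
  [module : NUModule Rᵐᵒᵖ carrier]
  unital : AddSubgroup.closure {x : carrier | ∃ (m : carrier) (r : R), x = op r • m} = ⊤

attribute [instance] UnitalRightMod.addCommGroup UnitalRightMod.module

namespace UnitalRightMod

variable {R : Type u} [NonUnitalRing R]

/-- Morphisms of right `R`-modules. -/
@[ext] structure Hom (X Y : UnitalRightMod R) where
  toAddHom : X.carrier →+ Y.carrier
  map_smul : ∀ (m : X.carrier) (r : R), toAddHom (op r • m) = op r • toAddHom m

/-- The category of unital right `R`-modules. -/
instance : Category (UnitalRightMod R) where
  Hom := Hom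
  id X := ⟨AddMonoidHom.id _, fun _ _ => rfl⟩
  comp f g := ⟨g.toAddHom.comp f.toAddHom, fun m r => by
    simp [f.map_smul, g.map_smul]⟩

@[ext] theorem hom_ext {X Y : UnitalRightMod R} {f g : X ⟶ Y}
    (h : f.toAddHom = g.toAddHom) : f = g := Hom.ext h

@[simp] theorem id_toAddHom (X : UnitalRightMod R) :
    (𝟙 X : X ⟶ X).toAddHom = AddMonoidHom.id _ := rfl

@[simp] theorem comp_toAddHom {X Y Z : UnitalRightMod R} (f : X ⟶ Y) (g : Y ⟶ Z) :
    (f ≫ g).toAddHom = g.toAddHom.comp f.toAddHom := rfl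

end UnitalRightMod

/-! ## The tensor product over a noncommutative ring -/

section Tensor

/-- The relations `m r ⊗ n = m ⊗ r n`. -/
def BalTensor.rel (R : Type u) (M : Type v) (N : Type w) [AddCommGroup M] [AddCommGroup N]
    [SMul Rᵐᵒᵖ M] [SMul R N] : AddSubgroup (TensorProduct ℤ M N) :=
  AddSubgroup.closure {x | ∃ (m : M) (r : R) (n : N),
    x = TensorProduct.tmul ℤ (op r • m) n - TensorProduct.tmul ℤ m (r • n)}

/-- The tensor product `M ⊗_R N` of a right module and a left module over `R`, where `R` need
be neither commutative nor unital. -/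
def BalTensor (R : Type u) (M : Type v) (N : Type w) [AddCommGroup M] [AddCommGroup N]
    [SMul Rᵐᵒᵖ M] [SMul R N] : Type (max v w) :=
  TensorProduct ℤ M N ⧸ BalTensor.rel R M N

namespace BalTensor

instance (R : Type u) (M : Type v) (N : Type w) [AddCommGroup M] [AddCommGroup N]
    [SMul Rᵐᵒᵖ M] [SMul R N] : AddCommGroup (BalTensor R M N) :=
  inferInstanceAs (AddCommGroup (TensorProduct ℤ M N ⧸ BalTensor.rel R M N))

section Basic

variable {R : Type*} {M M' M'' : Type*} {N N' N'' : Type*}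
  [AddCommGroup M] [AddCommGroup N] [SMul Rᵐᵒᵖ M] [SMul R N]
  [AddCommGroup M'] [AddCommGroup N'] [SMul Rᵐᵒᵖ M'] [SMul R N']
  [AddCommGroup M''] [AddCommGroup N''] [SMul Rᵐᵒᵖ M''] [SMul R N'']

variable (R) in
/-- The elementary tensor `m ⊗ n`. -/
def tmul (m : M) (n : N) : BalTensor R M N :=
  QuotientAddGroup.mk' (rel R M N) (TensorProduct.tmul ℤ m n)

theorem add_tmul (m m' : M) (n : N) : tmul R (m + m') n = tmul R m n + tmul R m' n := by
  rw [tmul, TensorProduct.add_tmul, map_add]; rfl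

theorem tmul_add (m : M) (n n' : N) : tmul R m (n + n') = tmul R m n + tmul R m n' := by
  rw [tmul, TensorProduct.tmul_add, map_add]; rfl

theorem smul_tmul (r : R) (m : M) (n : N) : tmul R (op r • m) n = tmul R m (r • n) := by
  have h : TensorProduct.tmul ℤ (op r • m) n - TensorProduct.tmul ℤ m (r • n) ∈ rel R M N :=
    AddSubgroup.subset_closure ⟨m, r, n, rfl⟩
  have h2 := (QuotientAddGroup.eq_zero_iff _).2 h
  exact sub_eq_zero.1 h2

variable (R) in
/-- `m ⊗ n` as a biadditive map. -/
def tmulHom (M : Type*) (N : Type*) [AddCommGroup M] [AddCommGroup N] [SMul Rᵐᵒᵖ M]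
    [SMul R N] : M →+ N →+ BalTensor R M N :=
  AddMonoidHom.mk' (fun m => AddMonoidHom.mk' (fun n => tmul R m n) (tmul_add m))
    (fun m m' => by ext n; exact add_tmul m m' n)

@[simp] theorem tmulHom_apply (m : M) (n : N) : tmulHom R M N m n = tmul R m n := rfl

@[simp] theorem zero_tmul (n : N) : tmul R (0 : M) n = 0 := by
  rw [← tmulHom_apply, map_zero]; rfl

@[simp] theorem tmul_zero (m : M) : tmul R m (0 : N) = 0 := by
  rw [← tmulHom_apply, map_zero]

theorem sum_tmul {κ : Type*} (s : Finset κ) (m : κ → M) (n : N) :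
    tmul R (∑ i ∈ s, m i) n = ∑ i ∈ s, tmul R (m i) n := by
  rw [← tmulHom_apply, map_sum]; simp

theorem tmul_sum {κ : Type*} (s : Finset κ) (m : M) (n : κ → N) :
    tmul R m (∑ i ∈ s, n i) = ∑ i ∈ s, tmul R m (n i) := by
  rw [← tmulHom_apply, map_sum]; simp

/-- The universal property: balanced biadditive maps factor through the tensor product. -/
def lift {Q : Type*} [AddCommGroup Q] (f : M →+ N →+ Q)
    (hf : ∀ (m : M) (r : R) (n : N), f (op r • m) n = f m (r • n)) : BalTensor R M N →+ Q :=
  QuotientAddGroup.lift (rel R M N)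
    (TensorProduct.liftAddHom (R := ℤ) f (fun z m n => by simp))
    ((AddSubgroup.closure_le _).2 (by
      rintro _ ⟨m, r, n, rfl⟩
      simp [AddMonoidHom.mem_ker, hf]))

@[simp] theorem lift_tmul {Q : Type*} [AddCommGroup Q] (f : M →+ N →+ Q)
    (hf : ∀ (m : M) (r : R) (n : N), f (op r • m) n = f m (r • n)) (m : M) (n : N) :
    lift f hf (tmul R m n) = f m n := rfl

@[elab_as_elim]
theorem induction_on {p : BalTensor R M N → Prop} (x : BalTensor R M N)
    (zero : p 0) (tmul : ∀ m n, p (tmul R m n)) (add : ∀ x y, p x → p y → p (x + y)) :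
    p x := by
  obtain ⟨x, rfl⟩ := QuotientAddGroup.mk'_surjective _ x
  induction x using TensorProduct.induction_on with
  | zero => exact zero
  | tmul m n => exact tmul m n
  | add x y hx hy => rw [map_add]; exact add _ _ hx hy

/-- Two additive maps that agree on elementary tensors are equal. -/
theorem hom_ext {Q : Type*} [AddCommGroup Q] {f g : BalTensor R M N →+ Q}
    (h : ∀ m n, f (tmul R m n) = g (tmul R m n)) : f = g := by
  ext x
  induction x using induction_on with
  | zero => simp
  | tmul m n => exact h m n
  | add x y hx hy => simp [hx, hy]

/-- `f ⊗ g` for morphisms `f` of right modules and `g` of left modules. -/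
def map (f : M →+ M') (g : N →+ N') (hf : ∀ (m : M) (r : R), f (op r • m) = op r • f m)
    (hg : ∀ (r : R) (n : N), g (r • n) = r • g n) : BalTensor R M N →+ BalTensor R M' N' :=
  lift (AddMonoidHom.mk' (fun m => (tmulHom R M' N' (f m)).comp g)
      (fun m m' => by ext n; simp))
    (fun m r n => by simp [hf, hg, smul_tmul])

@[simp] theorem map_tmul (f : M →+ M') (g : N →+ N')
    (hf : ∀ (m : M) (r : R), f (op r • m) = op r • f m)
    (hg : ∀ (r : R) (n : N), g (r • n) = r • g n) (m : M) (n : N) :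
    map f g hf hg (tmul R m n) = tmul R (f m) (g n) := rfl

/-- `f ⊗ N` for a morphism `f` of right modules. -/
def mapLeft (N : Type*) [AddCommGroup N] [SMul R N] (f : M →+ M')
    (hf : ∀ (m : M) (r : R), f (op r • m) = op r • f m) : BalTensor R M N →+ BalTensor R M' N :=
  lift (AddMonoidHom.mk' (fun m => tmulHom R M' N (f m)) (fun m m' => by ext n; simp))
    (fun m r n => by simp [hf, smul_tmul])

@[simp] theorem mapLeft_tmul (f : M →+ M')
    (hf : ∀ (m : M) (r : R), f (op r • m) = op r • f m) (m : M) (n : N) :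
    mapLeft N f hf (tmul R m n) = tmul R (f m) n := rfl

/-- `M ⊗ g` for a morphism `g` of left modules. -/
def mapRight (M : Type*) [AddCommGroup M] [SMul Rᵐᵒᵖ M] (g : N →+ N')
    (hg : ∀ (r : R) (n : N), g (r • n) = r • g n) : BalTensor R M N →+ BalTensor R M N' :=
  lift (AddMonoidHom.mk' (fun m => (tmulHom R M N' m).comp g)
      (fun m m' => by ext n; simp))
    (fun m r n => by simp [hg, smul_tmul])

@[simp] theorem mapRight_tmul (g : N →+ N')
    (hg : ∀ (r : R) (n : N), g (r • n) = r • g n) (m : M) (n : N) :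
    mapRight M g hg (tmul R m n) = tmul R m (g n) := rfl

end Basic

/-! ### Module structures on tensor products -/

section ModuleStructure

variable {R : Type*} {B D : Type*} [Ring B] [Ring D] {M N : Type*}
  [AddCommGroup M] [AddCommGroup N] [SMul Rᵐᵒᵖ M] [SMul R N]

/-- The left module structure `b (m ⊗ n) = b m ⊗ n`. -/
instance leftModule [Module B M] [SMulCommClass B Rᵐᵒᵖ M] : Module B (BalTensor R M N) where
  smul b := mapLeft N (DistribSMul.toAddMonoidHom M b) (fun m r => by simp [smul_comm b (op r) m])
  one_smul x := by
    change mapLeft _ _ _ x = x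
    induction x using induction_on with
    | zero => simp
    | tmul m n => simp
    | add x y hx hy => rw [map_add, hx, hy]
  mul_smul a b x := by
    change mapLeft _ _ _ x = mapLeft _ _ _ (mapLeft _ _ _ x)
    induction x using induction_on with
    | zero => simp
    | tmul m n => simp [mul_smul]
    | add x y hx hy => simp only [map_add, hx, hy]
  smul_zero b := map_zero _
  smul_add b := map_add _
  add_smul a b x := by
    change mapLeft _ _ _ x = mapLeft _ _ _ x + mapLeft _ _ _ x
    induction x using induction_on with
    | zero => simp
    | tmul m n => simp [add_smul, add_tmul]
    | add x y hx hy => simp only [map_add, hx, hy]; abel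
  zero_smul x := by
    change mapLeft _ _ _ x = 0
    induction x using induction_on with
    | zero => simp
    | tmul m n => simp
    | add x y hx hy => simp [hx, hy]

@[simp] theorem smul_tmul_left [Module B M] [SMulCommClass B Rᵐᵒᵖ M] (b : B) (m : M) (n : N) :
    b • tmul R m n = tmul R (b • m) n := rfl

/-- The right module structure `(m ⊗ n) d = m ⊗ n d`. -/
instance (priority := high) rightModule [Module Dᵐᵒᵖ N] [SMulCommClass R Dᵐᵒᵖ N] :
    Module Dᵐᵒᵖ (BalTensor R M N) where
  smul d := mapRight M (DistribSMul.toAddMonoidHom N d) (fun r n => by simp [smul_comm r d n])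
  one_smul x := by
    change mapRight _ _ _ x = x
    induction x using induction_on with
    | zero => simp
    | tmul m n => simp
    | add x y hx hy => rw [map_add, hx, hy]
  mul_smul a b x := by
    change mapRight _ _ _ x = mapRight _ _ _ (mapRight _ _ _ x)
    induction x using induction_on with
    | zero => simp
    | tmul m n => simp [mul_smul]
    | add x y hx hy => simp only [map_add, hx, hy]
  smul_zero b := map_zero _
  smul_add b := map_add _
  add_smul a b x := by
    change mapRight _ _ _ x = mapRight _ _ _ x + mapRight _ _ _ x
    induction x using induction_on with
    | zero => simp
    | tmul m n => simp [add_smul, tmul_add]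
    | add x y hx hy => simp only [map_add, hx, hy]; abel
  zero_smul x := by
    change mapRight _ _ _ x = 0
    induction x using induction_on with
    | zero => simp
    | tmul m n => simp
    | add x y hx hy => simp [hx, hy]

@[simp] theorem op_smul_tmul_right [Module Dᵐᵒᵖ N] [SMulCommClass R Dᵐᵒᵖ N] (d : Dᵐᵒᵖ)
    (m : M) (n : N) : d • tmul R m n = tmul R m (d • n) := rfl

instance bimodule [Module B M] [SMulCommClass B Rᵐᵒᵖ M] [Module Dᵐᵒᵖ N]
    [SMulCommClass R Dᵐᵒᵖ N] : SMulCommClass B Dᵐᵒᵖ (BalTensor R M N) where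
  smul_comm b d x := by
    induction x using induction_on with
    | zero => simp
    | tmul m n => simp
    | add x y hx hy => simp [hx, hy]

end ModuleStructure

/-! ### Associativity and units over a ring with unit -/

section Unitors

variable {A : Type*} [Ring A] {M N L : Type*} [AddCommGroup M] [AddCommGroup N]
  [AddCommGroup L]

/-- The map `(m, n) ↦ (m ⊗ n) ⊗ l ↦ m ⊗ (n ⊗ l)` for fixed `l`, as a map on `M ⊗_A N`. -/
def assocAux [Module Aᵐᵒᵖ M] [Module A N] [Module Aᵐᵒᵖ N] [SMulCommClass A Aᵐᵒᵖ N] [Module A L]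
    (l : L) : BalTensor A M N →+ BalTensor A M (BalTensor A N L) :=
  mapRight M ((tmulHom A N L).flip l) (fun r n => by simp)

@[simp] theorem assocAux_tmul [Module Aᵐᵒᵖ M] [Module A N] [Module Aᵐᵒᵖ N]
    [SMulCommClass A Aᵐᵒᵖ N] [Module A L] (l : L) (m : M) (n : N) :
    assocAux l (tmul A m n) = tmul A m (tmul A n l) := rfl

/-- The canonical isomorphism `(M ⊗_A N) ⊗_A L → M ⊗_A (N ⊗_A L)`. -/
def assoc [Module Aᵐᵒᵖ M] [Module A N] [Module Aᵐᵒᵖ N] [SMulCommClass A Aᵐᵒᵖ N] [Module A L] :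
    BalTensor A (BalTensor A M N) L →+ BalTensor A M (BalTensor A N L) :=
  lift (AddMonoidHom.mk' assocAux (fun l l' => BalTensor.hom_ext fun m n => by
      simp [tmul_add])).flip
    (fun x a l => by
      induction x using induction_on with
      | zero => simp
      | tmul m n => simp [smul_tmul]
      | add x y hx hy => simp only [smul_add, map_add, AddMonoidHom.add_apply, hx, hy])

@[simp] theorem assoc_tmul [Module Aᵐᵒᵖ M] [Module A N] [Module Aᵐᵒᵖ N]
    [SMulCommClass A Aᵐᵒᵖ N] [Module A L] (m : M) (n : N) (l : L) :
    assoc (tmul A (tmul A m n) l) = tmul A m (tmul A n l) := rfl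

/-- The canonical isomorphism `A ⊗_A N → N`, `a ⊗ n ↦ a n`. -/
def leftUnit [Module A N] : BalTensor A A N →+ N :=
  lift (AddMonoidHom.mk' (fun a => AddMonoidHom.mk' (fun n => a • n) (smul_add a))
    (fun a b => by ext n; simp [add_smul])) (fun a b n => by simp [mul_smul])

@[simp] theorem leftUnit_tmul [Module A N] (a : A) (n : N) : leftUnit (tmul A a n) = a • n :=
  rfl

/-- The canonical isomorphism `M ⊗_A A → M`, `m ⊗ a ↦ m a`. -/
def rightUnit [Module Aᵐᵒᵖ M] : BalTensor A M A →+ M :=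
  lift (AddMonoidHom.mk' (fun m => AddMonoidHom.mk' (fun a => op a • m)
      (fun a b => by simp [add_smul])) (fun m m' => by ext n; simp))
    (fun m a b => by simp [mul_smul])

@[simp] theorem rightUnit_tmul [Module Aᵐᵒᵖ M] (m : M) (a : A) :
    rightUnit (tmul A m a) = op a • m := rfl

end Unitors

section RTensor

variable {A : Type*} [Ring A] {M M' M'' N L : Type*} [AddCommGroup M] [AddCommGroup M']
  [AddCommGroup M''] [AddCommGroup N] [AddCommGroup L] [Module Aᵐᵒᵖ M] [Module Aᵐᵒᵖ M']
  [Module Aᵐᵒᵖ M''] [Module A N] [Module A L]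

/-- `f ⊗ N` for a homomorphism `f` of right `A`-modules. -/
def rTensor (N : Type*) [AddCommGroup N] [Module A N] (f : M →ₗ[Aᵐᵒᵖ] M') :
    BalTensor A M N →+ BalTensor A M' N :=
  mapLeft N f.toAddMonoidHom (fun m a => by simp)

@[simp] theorem rTensor_tmul (f : M →ₗ[Aᵐᵒᵖ] M') (m : M) (n : N) :
    rTensor N f (tmul A m n) = tmul A (f m) n := rfl

theorem rTensor_id : rTensor N (LinearMap.id : M →ₗ[Aᵐᵒᵖ] M) = AddMonoidHom.id _ :=
  BalTensor.hom_ext fun _ _ => rfl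

theorem rTensor_comp (f : M →ₗ[Aᵐᵒᵖ] M') (g : M' →ₗ[Aᵐᵒᵖ] M'') :
    rTensor N (g ∘ₗ f) = (rTensor N g).comp (rTensor N f) :=
  BalTensor.hom_ext fun _ _ => rfl

theorem rTensor_comp_apply (f : M →ₗ[Aᵐᵒᵖ] M') (g : M' →ₗ[Aᵐᵒᵖ] M'') (x : BalTensor A M N) :
    rTensor N (g ∘ₗ f) x = rTensor N g (rTensor N f x) := by rw [rTensor_comp]; rfl

theorem rTensor_zero : rTensor N (0 : M →ₗ[Aᵐᵒᵖ] M') = 0 :=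
  BalTensor.hom_ext fun _ _ => by simp

theorem rTensor_add (f g : M →ₗ[Aᵐᵒᵖ] M') : rTensor N (f + g) = rTensor N f + rTensor N g :=
  BalTensor.hom_ext fun _ _ => by simp [add_tmul]

theorem rTensor_neg (f : M →ₗ[Aᵐᵒᵖ] M') : rTensor N (-f) = -rTensor N f :=
  eq_neg_of_add_eq_zero_left (by rw [← rTensor_add, neg_add_cancel, rTensor_zero])

/-- `f ⊗ N` is right linear if `N` is a bimodule. -/
def rTensorLin (N : Type*) [AddCommGroup N] [Module A N] [Module Aᵐᵒᵖ N]
    [SMulCommClass A Aᵐᵒᵖ N] (f : M →ₗ[Aᵐᵒᵖ] M') :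
    BalTensor A M N →ₗ[Aᵐᵒᵖ] BalTensor A M' N where
  toFun := rTensor N f
  map_add' := map_add _
  map_smul' a x := by
    induction x using induction_on with
    | zero => simp
    | tmul m n => simp
    | add x y hx hy => simpa [smul_add] using congrArg₂ (· + ·) hx hy

@[simp] theorem rTensorLin_apply [Module Aᵐᵒᵖ N] [SMulCommClass A Aᵐᵒᵖ N]
    (f : M →ₗ[Aᵐᵒᵖ] M') (x : BalTensor A M N) : rTensorLin N f x = rTensor N f x := rfl

theorem assoc_rTensor_rTensorLin [Module Aᵐᵒᵖ N] [SMulCommClass A Aᵐᵒᵖ N]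
    (f : M →ₗ[Aᵐᵒᵖ] M') (x : BalTensor A (BalTensor A M N) L) :
    assoc (rTensor L (rTensorLin N f) x) = rTensor (BalTensor A N L) f (assoc x) := by
  induction x using induction_on with
  | zero => simp
  | tmul y l =>
    induction y using induction_on with
    | zero => simp
    | tmul m n => simp
    | add x y hx hy =>
      simp only [rTensor_tmul, map_add, add_tmul] at hx hy ⊢
      rw [hx, hy]
  | add x y hx hy => simp [hx, hy]

theorem mapRight_rTensor (f : M →ₗ[Aᵐᵒᵖ] M') (g : N →+ L)
    (hg : ∀ (a : A) (n : N), g (a • n) = a • g n) (x : BalTensor A M N) :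
    mapRight M' g hg (rTensor N f x) = rTensor L f (mapRight M g hg x) := by
  induction x using induction_on with
  | zero => simp
  | tmul m n => simp
  | add x y hx hy => simp [hx, hy]

theorem rightUnit_rTensor (f : M →ₗ[Aᵐᵒᵖ] M') (x : BalTensor A M A) :
    rightUnit (rTensor A f x) = f (rightUnit x) := by
  induction x using induction_on with
  | zero => simp
  | tmul m n => simp
  | add x y hx hy => simp [hx, hy]

end RTensor

end BalTensor
end Tensor

open BalTensor

/-! ## Flatness and faithful flatness -/

/-- A left module `N` over a ring `A` with unit is flat if `- ⊗_A N` preserves injections of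
right `A`-modules. -/
def IsFlat (A : Type u) (N : Type u) [Ring A] [AddCommGroup N] [Module A N] : Prop :=
  ∀ (X Y : Type u) [AddCommGroup X] [AddCommGroup Y] [Module Aᵐᵒᵖ X] [Module Aᵐᵒᵖ Y]
    (f : X →ₗ[Aᵐᵒᵖ] Y), Function.Injective f →
    Function.Injective (rTensor N f)

/-- The map `f ⊗ N` induced by a morphism of unital right `R`-modules. -/
def UnitalRightMod.Hom.tensor {R : Type u} [NonUnitalRing R] {X Y : UnitalRightMod R}
    (f : X ⟶ Y) (N : Type u) [AddCommGroup N] [NUModule R N] :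
    BalTensor R X.carrier N →+ BalTensor R Y.carrier N :=
  mapLeft N f.toAddHom f.map_smul

/-- A left module `N` over a ring `R` which need not have a unit is faithfully flat if the
functor `- ⊗_R N` on unital right `R`-modules is exact and faithful. As the tensor product is
always right exact, exactness means that injections are preserved. -/
structure IsFaithfullyFlat (R : Type u) (N : Type u) [NonUnitalRing R] [AddCommGroup N]
    [NUModule R N] : Prop where
  flat : ∀ (X Y : UnitalRightMod R) (f : X ⟶ Y), Function.Injective f.toAddHom →
    Function.Injective (UnitalRightMod.Hom.tensor f N)
  faithful : ∀ (X Y : UnitalRightMod R) (f g : X ⟶ Y),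
    UnitalRightMod.Hom.tensor f N = UnitalRightMod.Hom.tensor g N → f = g

/-! ## Corings and comodules -/

/-- A coring over a ring `A`. -/
structure Coring (A : Type u) [Ring A] where
  carrier : Type u
  [addCommGroup : AddCommGroup carrier]
  [leftModule : Module A carrier]
  [rightModule : Module Aᵐᵒᵖ carrier]
  [bimodule : SMulCommClass A Aᵐᵒᵖ carrier]
  /-- The comultiplication. -/
  comul : carrier →+ BalTensor A carrier carrier
  comul_smul : ∀ (a : A) (c : carrier), comul (a • c) = a • comul c
  comul_op_smul : ∀ (a : Aᵐᵒᵖ) (c : carrier), comul (a • c) = a • comul c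
  /-- The counit. -/
  counit : carrier →+ A
  counit_smul : ∀ (a : A) (c : carrier), counit (a • c) = a • counit c
  counit_op_smul : ∀ (a : Aᵐᵒᵖ) (c : carrier), counit (a • c) = a • counit c
  /-- `(C ⊗ Δ) ∘ Δ = (Δ ⊗ C) ∘ Δ` -/
  coassoc : ∀ c : carrier,
    assoc (mapLeft carrier comul (fun c a => comul_op_smul (op a) c) (comul c)) =
      mapRight carrier comul comul_smul (comul c)
  /-- `(ε ⊗ C) ∘ Δ = 1` -/
  counit_comul : ∀ c : carrier,
    leftUnit (mapLeft carrier counit (fun c a => counit_op_smul (op a) c) (comul c)) = c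
  /-- `(C ⊗ ε) ∘ Δ = 1` -/
  comul_counit : ∀ c : carrier,
    rightUnit (mapRight carrier counit counit_smul (comul c)) = c

attribute [instance] Coring.addCommGroup Coring.leftModule Coring.rightModule Coring.bimodule

variable {A : Type u} [Ring A]

/-- An additive map `f` between corings over `A` is an isomorphism of `A`-corings: it is a
bijective homomorphism of bimodules with `Δ ∘ f = (f ⊗ f) ∘ Δ` and `ε ∘ f = ε`. -/
structure IsCoringIso {D C : Coring A} (f : D.carrier →+ C.carrier) : Prop where
  bijective : Function.Bijective f
  map_smul : ∀ (a : A) (d : D.carrier), f (a • d) = a • f d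
  map_op_smul : ∀ (d : D.carrier) (a : A), f (op a • d) = op a • f d
  map_comul : ∀ d : D.carrier, C.comul (f d) = map f f map_op_smul map_smul (D.comul d)
  map_counit : ∀ d : D.carrier, C.counit (f d) = D.counit d

/-- A right comodule over a coring `C`. -/
structure Comod (C : Coring A) where
  carrier : Type u
  [addCommGroup : AddCommGroup carrier]
  [module : Module Aᵐᵒᵖ carrier]
  /-- The coaction. -/
  coact : carrier →ₗ[Aᵐᵒᵖ] BalTensor A carrier C.carrier
  /-- `(M ⊗ Δ) ∘ ρ = (ρ ⊗ C) ∘ ρ` -/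
  coassoc : ∀ m : carrier,
    assoc (rTensor C.carrier coact (coact m)) =
      mapRight carrier C.comul C.comul_smul (coact m)
  /-- `(M ⊗ ε) ∘ ρ = 1` -/
  counit : ∀ m : carrier,
    rightUnit (mapRight carrier C.counit C.counit_smul (coact m)) = m

attribute [instance] Comod.addCommGroup Comod.module

namespace Comod

variable {C : Coring A}

/-- Morphisms of comodules: linear maps `f` with `(f ⊗ C) ∘ ρ = ρ ∘ f`. -/
@[ext] structure Hom (M N : Comod C) where
  toLin : M.carrier →ₗ[Aᵐᵒᵖ] N.carrier
  coact_comm : ∀ m : M.carrier, rTensor C.carrier toLin (M.coact m) = N.coact (toLin m)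

/-- The category of right `C`-comodules. -/
instance : Category (Comod C) where
  Hom := Hom
  id M := ⟨LinearMap.id, fun m => by simp [rTensor_id]⟩
  comp f g := ⟨g.toLin ∘ₗ f.toLin, fun m => by
    simp [rTensor_comp, f.coact_comm, g.coact_comm]⟩

@[ext] theorem hom_ext {M N : Comod C} {f g : M ⟶ N} (h : f.toLin = g.toLin) : f = g :=
  Hom.ext h

@[simp] theorem id_toLin (M : Comod C) : (𝟙 M : M ⟶ M).toLin = LinearMap.id := rfl

@[simp] theorem comp_toLin {M N L : Comod C} (f : M ⟶ N) (g : N ⟶ L) :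
    (f ≫ g).toLin = g.toLin ∘ₗ f.toLin := rfl

section Group

variable {M N : Comod C}

instance : Zero (M ⟶ N) := ⟨⟨0, fun m => by
  have h : rTensor C.carrier (0 : M.carrier →ₗ[Aᵐᵒᵖ] N.carrier) = 0 :=
    BalTensor.hom_ext fun _ _ => by simp
  simp [h]⟩⟩
instance : Add (M ⟶ N) := ⟨fun f g => ⟨f.toLin + g.toLin, fun m => by
  simp [rTensor_add, f.coact_comm, g.coact_comm]⟩⟩
instance : Neg (M ⟶ N) := ⟨fun f => ⟨-f.toLin, fun m => by
  simp [rTensor_neg, f.coact_comm]⟩⟩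

@[simp] theorem zero_toLin : (0 : M ⟶ N).toLin = 0 := rfl
@[simp] theorem add_toLin (f g : M ⟶ N) : (f + g).toLin = f.toLin + g.toLin := rfl
@[simp] theorem neg_toLin (f : M ⟶ N) : (-f).toLin = -f.toLin := rfl

instance : AddCommGroup (M ⟶ N) where
  add_assoc _ _ _ := hom_ext (add_assoc _ _ _)
  zero_add _ := hom_ext (zero_add _)
  add_zero _ := hom_ext (add_zero _)
  add_comm _ _ := hom_ext (add_comm _ _)
  neg_add_cancel _ := hom_ext (neg_add_cancel _)
  nsmul := nsmulRec
  zsmul := zsmulRec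

end Group

/-- Morphisms of comodules are added pointwise. -/
instance : Preadditive (Comod C) where
  add_comp _ _ _ _ _ _ := hom_ext (LinearMap.comp_add _ _ _)
  comp_add _ _ _ _ _ _ := hom_ext (LinearMap.add_comp _ _ _)

end Comod

/-! ## Tensoring a comodule with a module over a ring that acts on it -/

section TensorCoact

variable {R : Type*} [NonUnitalRing R] {M : Type*} [AddCommGroup M] [Module Aᵐᵒᵖ M]
  [NUModule R M] [SMulCommClass R Aᵐᵒᵖ M] {C : Type*} [AddCommGroup C] [Module A C]
  [Module Aᵐᵒᵖ C] [SMulCommClass A Aᵐᵒᵖ C]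
  {Y Y' : Type*} [AddCommGroup Y] [NUModule Rᵐᵒᵖ Y] [AddCommGroup Y'] [NUModule Rᵐᵒᵖ Y']

/-- The action of `r` on an `R`-`A`-bimodule `M`. -/
def smulLin (M : Type*) [AddCommGroup M] [Module Aᵐᵒᵖ M] [NUModule R M]
    [SMulCommClass R Aᵐᵒᵖ M] (r : R) : M →ₗ[Aᵐᵒᵖ] M where
  toFun m := r • m
  map_add' := NUModule.smul_add r
  map_smul' a m := smul_comm r a m

@[simp] theorem smulLin_apply (r : R) (m : M) : smulLin (A := A) M r m = r • m := rfl

/-- The map `M → Y ⊗_R M`, `m ↦ y ⊗ m`. -/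
def tmulLin (R : Type*) [NonUnitalRing R] (M : Type*) [AddCommGroup M] [Module Aᵐᵒᵖ M]
    [NUModule R M] [SMulCommClass R Aᵐᵒᵖ M] {Y : Type*} [AddCommGroup Y] [NUModule Rᵐᵒᵖ Y]
    (y : Y) : M →ₗ[Aᵐᵒᵖ] BalTensor R Y M where
  toFun m := tmul R y m
  map_add' := tmul_add y
  map_smul' _ _ := rfl

@[simp] theorem tmulLin_apply (y : Y) (m : M) : tmulLin (A := A) R M y m = tmul R y m := rfl

/-- For an `R`-linear coaction `ρ : M → M ⊗_A C`, the coaction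
`Y ⊗ ρ : Y ⊗_R M → Y ⊗_R M ⊗_A C`. -/
def tensorCoact (Y : Type*) [AddCommGroup Y] [NUModule Rᵐᵒᵖ Y]
    (ρ : M →ₗ[Aᵐᵒᵖ] BalTensor A M C)
    (hρ : ∀ (r : R) (m : M), ρ (r • m) = rTensor C (smulLin M r) (ρ m)) :
    BalTensor R Y M →ₗ[Aᵐᵒᵖ] BalTensor A (BalTensor R Y M) C where
  toFun := lift
    (AddMonoidHom.mk' (fun y => (rTensor C (tmulLin R M y)).comp ρ.toAddMonoidHom)
      (fun y y' => by
        have h : tmulLin (A := A) R M (y + y') = tmulLin R M y + tmulLin R M y' := by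
          ext m; simp [add_tmul]
        ext m; simp [h, rTensor_add]))
    (fun y r m => by
      have h : tmulLin (A := A) R M (op r • y) = tmulLin R M y ∘ₗ smulLin M r := by
        ext m; simp [smul_tmul]
      simp [hρ, h, rTensor_comp])
  map_add' := map_add _
  map_smul' a x := by
    induction x using induction_on with
    | zero => simp
    | tmul y m =>
      simp only [op_smul_tmul_right, lift_tmul, AddMonoidHom.mk'_apply, AddMonoidHom.comp_apply,
        LinearMap.toAddMonoidHom_coe, map_smul, RingHom.id_apply]
      exact (rTensorLin C (tmulLin (A := A) R M y)).map_smul a (ρ m)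
    | add x y hx hy => simpa [smul_add] using congrArg₂ (· + ·) hx hy

variable (ρ : M →ₗ[Aᵐᵒᵖ] BalTensor A M C)
  (hρ : ∀ (r : R) (m : M), ρ (r • m) = rTensor C (smulLin M r) (ρ m))

@[simp] theorem tensorCoact_tmul (y : Y) (m : M) :
    tensorCoact Y ρ hρ (tmul R y m) = rTensor C (tmulLin R M y) (ρ m) := rfl

theorem tensorCoact_coassoc (Δ : C →+ BalTensor A C C)
    (hΔ : ∀ (a : A) (c : C), Δ (a • c) = a • Δ c)
    (h : ∀ m, assoc (rTensor C ρ (ρ m)) = mapRight M Δ hΔ (ρ m)) (x : BalTensor R Y M) :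
    assoc (rTensor C (tensorCoact Y ρ hρ) (tensorCoact Y ρ hρ x)) =
      mapRight (BalTensor R Y M) Δ hΔ (tensorCoact Y ρ hρ x) := by
  induction x using induction_on with
  | zero => simp
  | tmul y m =>
    have h1 : tensorCoact Y ρ hρ ∘ₗ tmulLin R M y = rTensorLin C (tmulLin R M y) ∘ₗ ρ := by
      ext m; simp
    rw [tensorCoact_tmul, ← rTensor_comp_apply, h1, rTensor_comp_apply,
      assoc_rTensor_rTensorLin, h, mapRight_rTensor]
  | add x y hx hy => simp [hx, hy]

theorem tensorCoact_counit (ε : C →+ A) (hε : ∀ (a : A) (c : C), ε (a • c) = a • ε c)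
    (h : ∀ m, rightUnit (mapRight M ε hε (ρ m)) = m) (x : BalTensor R Y M) :
    rightUnit (mapRight (BalTensor R Y M) ε hε (tensorCoact Y ρ hρ x)) = x := by
  induction x using induction_on with
  | zero => simp
  | tmul y m => rw [tensorCoact_tmul, mapRight_rTensor, rightUnit_rTensor, h, tmulLin_apply]
  | add x y hx hy => simp [hx, hy]

/-- `f ⊗ M : Y ⊗_R M → Y' ⊗_R M`, as a right `A`-linear map. -/
def mapLeftLin (M : Type*) [AddCommGroup M] [Module Aᵐᵒᵖ M] [NUModule R M]
    [SMulCommClass R Aᵐᵒᵖ M] (f : Y →+ Y') (hf : ∀ (y : Y) (r : R), f (op r • y) = op r • f y) :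
    BalTensor R Y M →ₗ[Aᵐᵒᵖ] BalTensor R Y' M where
  toFun := mapLeft M f hf
  map_add' := map_add _
  map_smul' a x := by
    induction x using induction_on with
    | zero => simp
    | tmul m n => simp
    | add x y hx hy => simpa [smul_add] using congrArg₂ (· + ·) hx hy

@[simp] theorem mapLeftLin_apply (f : Y →+ Y') (hf : ∀ (y : Y) (r : R), f (op r • y) = op r • f y)
    (x : BalTensor R Y M) : mapLeftLin (A := A) M f hf x = mapLeft M f hf x := rfl

theorem rTensor_mapLeftLin_tensorCoact (f : Y →+ Y')
    (hf : ∀ (y : Y) (r : R), f (op r • y) = op r • f y) (x : BalTensor R Y M) :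
    rTensor C (mapLeftLin M f hf) (tensorCoact Y ρ hρ x) =
      tensorCoact Y' ρ hρ (mapLeft M f hf x) := by
  induction x using induction_on with
  | zero => simp
  | tmul y m =>
    have h1 : mapLeftLin (A := A) M f hf ∘ₗ tmulLin R M y = tmulLin R M (f y) := by
      ext m; simp
    rw [tensorCoact_tmul, ← rTensor_comp_apply, h1]; simp
  | add x y hx hy => simp [hx, hy]

end TensorCoact

/-- If a ring `R` acts on the comodule `M` by comodule endomorphisms, the functor
`- ⊗_R M` from unital right `R`-modules to right comodules. -/
@[simps] def tensorFunctor {R : Type u} [NonUnitalRing R] {C : Coring A} (M : Comod C)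
    [NUModule R M.carrier] [SMulCommClass R Aᵐᵒᵖ M.carrier]
    (hM : ∀ (r : R) (m : M.carrier),
      M.coact (r • m) = rTensor C.carrier (smulLin M.carrier r) (M.coact m)) :
    UnitalRightMod R ⥤ Comod C where
  obj Y :=
    { carrier := BalTensor R Y.carrier M.carrier
      coact := tensorCoact Y.carrier M.coact hM
      coassoc := tensorCoact_coassoc M.coact hM C.comul C.comul_smul M.coassoc
      counit := tensorCoact_counit M.coact hM C.counit C.counit_smul M.counit }
  map {Y Y'} f :=
    { toLin := mapLeftLin M.carrier f.toAddHom f.map_smul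
      coact_comm := rTensor_mapLeftLin_tensorCoact M.coact hM f.toAddHom f.map_smul }
  map_id Y := by
    apply Comod.hom_ext; apply LinearMap.ext; intro x
    exact DFunLike.congr_fun (BalTensor.hom_ext (f := mapLeft M.carrier (𝟙 Y : Y ⟶ Y).toAddHom
      (𝟙 Y : Y ⟶ Y).map_smul) (g := AddMonoidHom.id _) fun _ _ => rfl) x
  map_comp {X Y Z} f g := by
    apply Comod.hom_ext; apply LinearMap.ext; intro x
    exact DFunLike.congr_fun (BalTensor.hom_ext
      (f := mapLeft M.carrier (f ≫ g).toAddHom (f ≫ g).map_smul)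
      (g := (mapLeft M.carrier g.toAddHom g.map_smul).comp
        (mapLeft M.carrier f.toAddHom f.map_smul)) fun _ _ => rfl) x

/-! ## The data attached to a family of comodules -/

theorem mul_mem_closure {E : Type*} [Ring E] {U : Set E} (hU : ∀ x ∈ U, ∀ y ∈ U, x * y ∈ U)
    {x y : E} (hx : x ∈ AddSubgroup.closure U) (hy : y ∈ AddSubgroup.closure U) :
    x * y ∈ AddSubgroup.closure U := by
  induction hx using AddSubgroup.closure_induction with
  | mem x hx =>
    induction hy using AddSubgroup.closure_induction with
    | mem y hy => exact AddSubgroup.subset_closure (hU x hx y hy)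
    | zero => simp
    | add y z _ _ h1 h2 => rw [mul_add]; exact add_mem h1 h2
    | neg y _ h => rw [mul_neg]; exact neg_mem h
  | zero => simp
  | add x z _ _ h1 h2 => rw [add_mul]; exact add_mem h1 h2
  | neg x _ h => rw [neg_mul]; exact neg_mem h

section Family

variable {C : Coring A} {ι : Type u} (P : ι → Comod C)

/-- The right `A`-module `Σ = ⨁ P`. -/
def Sig : Type u := DirectSum ι fun i => (P i).carrier

instance : AddCommGroup (Sig P) :=
  inferInstanceAs (AddCommGroup (DirectSum ι fun i => (P i).carrier))

instance : Module Aᵐᵒᵖ (Sig P) :=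
  inferInstanceAs (Module Aᵐᵒᵖ (DirectSum ι fun i => (P i).carrier))

/-- The projection `Σ → P i`. -/
def proj (i : ι) : Sig P →ₗ[Aᵐᵒᵖ] (P i).carrier :=
  DirectSum.component Aᵐᵒᵖ ι (fun i => (P i).carrier) i

/-- `Σ† = ⨁ P*`, where `P* = Hom_A(P, A)`, realized inside `Σ*` as the sum of the images of the
injections `P* → Σ*` given by composition with the projections; this sum is direct. -/
def SigDag : Submodule A (Sig P →ₗ[Aᵐᵒᵖ] A) :=
  Submodule.span A {f | ∃ (i : ι) (φ : (P i).carrier →ₗ[Aᵐᵒᵖ] A), f = φ ∘ₗ proj P i}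

theorem comp_proj_mem (i : ι) (φ : (P i).carrier →ₗ[Aᵐᵒᵖ] A) : φ ∘ₗ proj P i ∈ SigDag P :=
  Submodule.subset_span ⟨i, φ, rfl⟩

/-- The element of `Σ†` given by an element of `P*`. -/
def incDag (i : ι) (φ : (P i).carrier →ₗ[Aᵐᵒᵖ] A) : SigDag P := ⟨φ ∘ₗ proj P i, comp_proj_mem P i φ⟩

variable [DecidableEq ι]

/-- The inclusion `P i → Σ`. -/
def inc (i : ι) : (P i).carrier →ₗ[Aᵐᵒᵖ] Sig P :=
  DirectSum.lof Aᵐᵒᵖ ι (fun i => (P i).carrier) i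

/-- The universal property of the direct sum. -/
def sigLift {N : Type*} [AddCommGroup N] [Module Aᵐᵒᵖ N]
    (f : ∀ i, (P i).carrier →ₗ[Aᵐᵒᵖ] N) : Sig P →ₗ[Aᵐᵒᵖ] N :=
  DirectSum.toModule Aᵐᵒᵖ ι N f

theorem sigLift_inc {N : Type*} [AddCommGroup N] [Module Aᵐᵒᵖ N]
    (f : ∀ i, (P i).carrier →ₗ[Aᵐᵒᵖ] N) (i : ι) (p : (P i).carrier) :
    sigLift P f (inc P i p) = f i p :=
  DirectSum.toModule_lof (M := fun i => (P i).carrier) (φ := f) Aᵐᵒᵖ i p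

theorem sig_induction {p : Sig P → Prop} (x : Sig P) (zero : p 0)
    (inc : ∀ i y, p (inc P i y)) (add : ∀ x y, p x → p y → p (x + y)) : p x :=
  DirectSum.induction_on x zero inc add

theorem proj_inc_self (i : ι) : proj P i ∘ₗ inc P i = LinearMap.id := by
  exact LinearMap.ext fun p =>
    DirectSum.component.lof_self Aᵐᵒᵖ (M := fun i => (P i).carrier) i p

theorem proj_inc_ne {i j : ι} (h : i ≠ j) : proj P j ∘ₗ inc P i = 0 := by
  exact LinearMap.ext fun p => (DirectSum.component.of Aᵐᵒᵖ
    (M := fun i => (P i).carrier) j i p).trans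
    (dif_neg h)

/-- The endomorphism of `Σ` that is `h : P i → P j` on `P i` and zero on the other summands. -/
def single {i j : ι} (h : (P i).carrier →ₗ[Aᵐᵒᵖ] (P j).carrier) : Module.End Aᵐᵒᵖ (Sig P) :=
  inc P j ∘ₗ h ∘ₗ proj P i

theorem single_mul_single {i j k : ι} (g : (P j).carrier →ₗ[Aᵐᵒᵖ] (P k).carrier)
    (h : (P i).carrier →ₗ[Aᵐᵒᵖ] (P j).carrier) :
    single P g * single P h = single P (g ∘ₗ h) := by
  have := proj_inc_self P j
  exact LinearMap.ext fun x => congrArg (fun f => inc P k (g (f (h (proj P i x))))) this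

theorem single_mul_single_ne {i j j' k : ι} (hj : j ≠ j')
    (g : (P j').carrier →ₗ[Aᵐᵒᵖ] (P k).carrier)
    (h : (P i).carrier →ₗ[Aᵐᵒᵖ] (P j).carrier) :
    single P g * single P h = single P (0 : (P i).carrier →ₗ[Aᵐᵒᵖ] (P k).carrier) := by
  have := proj_inc_ne P hj
  exact LinearMap.ext fun x =>
    (congrArg (fun f => inc P k (g (f (h (proj P i x))))) this).trans (by simp [single])

/-- The ring `S = ⨁ Hom_A(P, Q)` (in general without unit), realized inside the endomorphism
ring of `Σ` as the sum of the images of the injections `Hom_A(P, Q) → End_A(Σ)`; this sum is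
direct. The product is composition. -/
def ringS : NonUnitalSubring (Module.End Aᵐᵒᵖ (Sig P)) where
  __ := AddSubgroup.closure {f : Module.End Aᵐᵒᵖ (Sig P) |
    ∃ (i j : ι) (h : (P i).carrier →ₗ[Aᵐᵒᵖ] (P j).carrier), f = single P h}
  mul_mem' := mul_mem_closure (by
    rintro _ ⟨i, j, g, rfl⟩ _ ⟨i', j', h, rfl⟩
    by_cases hj : j' = i
    · subst hj
      exact ⟨i', j, g ∘ₗ h, single_mul_single P g h⟩
    · exact ⟨i', j, 0, single_mul_single_ne P hj g h⟩)

/-- The ring `R = ⨁ Hom_C(P, Q)` (in general without unit) as a subring of `S`: the sum of the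
images of the `Hom_C(P, Q)`. -/
def ringR : NonUnitalSubring (Module.End Aᵐᵒᵖ (Sig P)) where
  __ := AddSubgroup.closure {f : Module.End Aᵐᵒᵖ (Sig P) |
    ∃ (i j : ι) (h : P i ⟶ P j), f = single P h.toLin}
  mul_mem' := mul_mem_closure (by
    rintro _ ⟨i, j, g, rfl⟩ _ ⟨i', j', h, rfl⟩
    by_cases hj : j' = i
    · subst hj
      exact ⟨i', j, h ≫ g, single_mul_single P g.toLin h.toLin⟩
    · exact ⟨i', j, 0, single_mul_single_ne P hj g.toLin h.toLin⟩)

theorem ringR_le_ringS : ringR P ≤ ringS P := by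
  intro f hf
  refine AddSubgroup.closure_mono ?_ hf
  rintro _ ⟨i, j, h, rfl⟩
  exact ⟨i, j, h.toLin, rfl⟩

/-- Induction on an element of `R`. -/
theorem ringR_induction {p : Module.End Aᵐᵒᵖ (Sig P) → Prop} (r : ringR P)
    (mem : ∀ (i j : ι) (h : P i ⟶ P j), p (single P h.toLin)) (zero : p 0)
    (add : ∀ x y, p x → p y → p (x + y)) (neg : ∀ x, p x → p (-x)) : p r.1 := by
  obtain ⟨r, hr⟩ := r
  change r ∈ AddSubgroup.closure {f : Module.End Aᵐᵒᵖ (Sig P) |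
    ∃ (i j : ι) (h : P i ⟶ P j), f = single P h.toLin} at hr
  change p r
  induction hr using AddSubgroup.closure_induction with
  | mem x hx => obtain ⟨i, j, h, rfl⟩ := hx; exact mem i j h
  | zero => exact zero
  | add x y _ _ h1 h2 => exact add x y h1 h2
  | neg x _ h => exact neg x h

/-- `Σ` as a left `R`-module. -/
instance : NUModule (ringR P) (Sig P) where
  smul r x := r.1 x
  smul_add r := map_add r.1
  add_smul _ _ _ := rfl
  mul_smul _ _ _ := rfl

theorem smul_sig (r : ringR P) (x : Sig P) : r • x = r.1 x := rfl

instance : SMulCommClass (ringR P) Aᵐᵒᵖ (Sig P) where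
  smul_comm r a x := map_smul r.1 a x

/-- `S` as a left `R`-module. -/
instance : NUModule (ringR P) (ringS P) where
  smul r s := ⟨r.1 * s.1, mul_mem (ringR_le_ringS P r.2) s.2⟩
  smul_add r s t := Subtype.ext (mul_add r.1 s.1 t.1)
  add_smul r r' s := Subtype.ext (add_mul r.1 r'.1 s.1)
  mul_smul r r' s := Subtype.ext (mul_assoc r.1 r'.1 s.1)

theorem comp_mem_sigDag (φ : SigDag P) (r : ringR P) : φ.1 ∘ₗ r.1 ∈ SigDag P := by
  refine ringR_induction P (p := fun f => φ.1 ∘ₗ f ∈ SigDag P) r (fun i j h => ?_) ?_ ?_ ?_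
  · rw [single, ← LinearMap.comp_assoc, ← LinearMap.comp_assoc]
    exact comp_proj_mem P i _
  · simp
  · intro x y hx hy; rw [LinearMap.comp_add]; exact add_mem hx hy
  · intro x hx; rw [LinearMap.comp_neg]; exact neg_mem hx

/-- `Σ†` as a right `R`-module: `φ r = φ ∘ r`. -/
instance : NUModule (ringR P)ᵐᵒᵖ (SigDag P) where
  smul r φ := ⟨φ.1 ∘ₗ r.unop.1, comp_mem_sigDag P φ r.unop⟩
  smul_add _ _ _ := Subtype.ext (LinearMap.add_comp _ _ _)
  add_smul _ _ _ := Subtype.ext (LinearMap.comp_add _ _ _)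
  mul_smul _ _ _ := rfl

theorem op_smul_sigDag (r : ringR P) (φ : SigDag P) : (op r • φ).1 = φ.1 ∘ₗ r.1 := rfl

instance : SMulCommClass A (ringR P)ᵐᵒᵖ (SigDag P) where
  smul_comm _ _ _ := rfl

/-- The coaction of `Σ`. -/
def sigCoact : Sig P →ₗ[Aᵐᵒᵖ] BalTensor A (Sig P) C.carrier :=
  sigLift P fun i => rTensorLin C.carrier (inc P i) ∘ₗ (P i).coact

theorem sigCoact_inc (i : ι) (p : (P i).carrier) :
    sigCoact P (inc P i p) = rTensor C.carrier (inc P i) ((P i).coact p) := by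
  rw [sigCoact, sigLift_inc]; rfl

theorem single_inc_self {i j : ι} (h : (P i).carrier →ₗ[Aᵐᵒᵖ] (P j).carrier)
    (p : (P i).carrier) : single P h (inc P i p) = inc P j (h p) :=
  congrArg (fun f => inc P j (h (f p))) (proj_inc_self P i)

theorem single_comp_inc_self {i j : ι} (h : (P i).carrier →ₗ[Aᵐᵒᵖ] (P j).carrier) :
    single P h ∘ₗ inc P i = inc P j ∘ₗ h := LinearMap.ext (single_inc_self P h)

theorem single_comp_inc_ne {i j k : ι} (hk : k ≠ i)
    (h : (P i).carrier →ₗ[Aᵐᵒᵖ] (P j).carrier) : single P h ∘ₗ inc P k = 0 := by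
  rw [single, LinearMap.comp_assoc, LinearMap.comp_assoc, proj_inc_ne P hk]; simp

/-- The comodule `Σ = ⨁ P`. -/
def sigmaComod : Comod C where
  carrier := Sig P
  coact := sigCoact P
  coassoc x := by
    induction x using sig_induction with
    | zero => simp
    | inc i p =>
      have h : sigCoact P ∘ₗ inc P i = rTensorLin C.carrier (inc P i) ∘ₗ (P i).coact :=
        LinearMap.ext (sigCoact_inc P i)
      rw [sigCoact_inc, ← rTensor_comp_apply, h, rTensor_comp_apply, assoc_rTensor_rTensorLin,
        (P i).coassoc, mapRight_rTensor]
    | add x y hx hy => simp [hx, hy]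
  counit x := by
    induction x using sig_induction with
    | zero => simp
    | inc i p => rw [sigCoact_inc, mapRight_rTensor, rightUnit_rTensor, (P i).counit]
    | add x y hx hy => simp [hx, hy]

/-- `R` acts on `Σ` by comodule endomorphisms. -/
theorem sigCoact_smul (r : ringR P) (x : Sig P) :
    sigCoact P (r • x) = rTensor C.carrier (smulLin (Sig P) r) (sigCoact P x) := by
  refine ringR_induction P
    (p := fun f => sigCoact P (f x) = rTensor C.carrier f (sigCoact P x)) r
    (fun i j h => ?_) ?_ ?_ ?_
  · induction x using sig_induction with
    | zero => simp
    | inc k p =>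
      rw [sigCoact_inc, ← rTensor_comp_apply]
      by_cases hk : k = i
      · subst hk
        rw [single_inc_self, single_comp_inc_self, sigCoact_inc, rTensor_comp_apply,
          h.coact_comm]
      · have h0 := single_comp_inc_ne P hk h.toLin
        rw [h0, show single P h.toLin (inc P k p) = 0 from LinearMap.congr_fun h0 p]
        simp [rTensor_zero]
    | add x y hx hy => simp [hx, hy]
  · simp [rTensor_zero]
  · intro f g hf hg; simp [rTensor_add, hf, hg]
  · intro f hf; simp [rTensor_neg, hf]

instance : NUModule (ringR P) (sigmaComod P).carrier := inferInstanceAs (NUModule _ (Sig P))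

instance : SMulCommClass (ringR P) Aᵐᵒᵖ (sigmaComod P).carrier :=
  inferInstanceAs (SMulCommClass _ _ (Sig P))

/-- The functor `- ⊗_R Σ` from unital right `R`-modules to right `C`-comodules. -/
def tensorSigma : UnitalRightMod (ringR P) ⥤ Comod C :=
  tensorFunctor (sigmaComod P) (sigCoact_smul P)

/-- The bimodule `Σ† ⊗_R Σ`. -/
def Comatrix : Type u := BalTensor (ringR P) (SigDag P) (Sig P)

namespace Comatrix

instance : AddCommGroup (Comatrix P) :=
  inferInstanceAs (AddCommGroup (BalTensor (ringR P) (SigDag P) (Sig P)))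

instance : Module A (Comatrix P) :=
  inferInstanceAs (Module A (BalTensor (ringR P) (SigDag P) (Sig P)))

instance : Module Aᵐᵒᵖ (Comatrix P) :=
  inferInstanceAs (Module Aᵐᵒᵖ (BalTensor (ringR P) (SigDag P) (Sig P)))

instance : SMulCommClass A Aᵐᵒᵖ (Comatrix P) :=
  inferInstanceAs (SMulCommClass A Aᵐᵒᵖ (BalTensor (ringR P) (SigDag P) (Sig P)))

/-- The right linear map `Σ → Σ† ⊗_R Σ`, `x ↦ φ ⊗ x`. -/
def mk (φ : SigDag P) : Sig P →ₗ[Aᵐᵒᵖ] Comatrix P := tmulLin (ringR P) (Sig P) φ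

variable {P}

theorem mk_apply (φ : SigDag P) (x : Sig P) : mk P φ x = tmul (ringR P) φ x := rfl

theorem mk_add (φ ψ : SigDag P) (x : Sig P) : mk P (φ + ψ) x = mk P φ x + mk P ψ x :=
  add_tmul φ ψ x

theorem mk_smul (a : A) (φ : SigDag P) (x : Sig P) : mk P (a • φ) x = a • mk P φ x := rfl

theorem mk_op_smul (r : ringR P) (φ : SigDag P) (x : Sig P) :
    mk P (op r • φ) x = mk P φ (r • x) := smul_tmul r φ x

theorem mk_sum {n : ℕ} (φ : Fin n → SigDag P) (x : Sig P) :
    mk P (∑ k, φ k) x = ∑ k, mk P (φ k) x := sum_tmul _ φ x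

theorem induction {p : Comatrix P → Prop} (x : Comatrix P) (zero : p 0)
    (mk : ∀ φ i y, p (mk P φ (inc P i y))) (add : ∀ x y, p x → p y → p (x + y)) :
    p x := by
  refine BalTensor.induction_on (p := p) x zero (fun φ x => ?_) add
  induction x using sig_induction with
  | zero => rw [tmul_zero]; exact zero
  | inc i y => exact mk φ i y
  | add x y hx hy => rw [tmul_add]; exact add _ _ hx hy

end Comatrix

/-- The canonical map `can : Σ† ⊗_R Σ → C`, `φ ⊗ x ↦ (φ ⊗ C)(ρ(x))`, where `A ⊗_A C` is
identified with `C`. -/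
def can : Comatrix P →+ C.carrier :=
  lift (AddMonoidHom.mk' (fun φ : SigDag P =>
      leftUnit.comp ((rTensor C.carrier φ.1).comp (sigCoact P).toAddMonoidHom))
    (fun φ ψ => by ext x; simp [rTensor_add]))
    (fun φ r x => by
      have h : rTensor C.carrier (op r • φ).1 =
          (rTensor C.carrier φ.1).comp (rTensor C.carrier (smulLin (Sig P) r)) := by
        rw [← rTensor_comp]; rfl
      simp [sigCoact_smul, h])

/-! ### The comatrix coring -/

/-- All members of the family are finitely generated projective right `A`-modules. -/
def FGProjective : Prop :=
  ∀ i, Module.Finite Aᵐᵒᵖ (P i).carrier ∧ Module.Projective Aᵐᵒᵖ (P i).carrier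

end Family

/-- A finitely generated projective right module has a finite dual basis. -/
theorem exists_dualBasis (M : Type u) [AddCommGroup M] [Module Aᵐᵒᵖ M] [Module.Finite Aᵐᵒᵖ M]
    [Module.Projective Aᵐᵒᵖ M] :
    ∃ (n : ℕ) (e : Fin n → M) (e' : Fin n → M →ₗ[Aᵐᵒᵖ] A),
      ∀ m, ∑ k, op (e' k m) • e k = m := by
  obtain ⟨n, f, g, -, -, hfg⟩ := Module.Finite.exists_comp_eq_id_of_projective Aᵐᵒᵖ M
  refine ⟨n, fun k => f (Pi.single k 1),
    fun k => ⟨⟨fun m => unop (g m k), fun x y => by simp⟩, fun a x => by simp⟩, fun m => ?_⟩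
  have h := LinearMap.congr_fun hfg m
  simp only [LinearMap.comp_apply, LinearMap.id_apply] at h
  conv_rhs => rw [← h, pi_eq_sum_univ' (g m), map_sum]
  refine Finset.sum_congr rfl fun k _ => ?_
  exact (map_smul f _ _).symm

section ComatrixCoring

variable {C : Coring A} {ι : Type u} {P : ι → Comod C}

/-- The number of elements of a finite dual basis `e`, `e*` of `P i`. -/
def dbCard (h : FGProjective P) (i : ι) : ℕ :=
  have := (h i).1
  have := (h i).2
  (exists_dualBasis (A := A) (P i).carrier).choose

/-- The elements `e` of a dual basis of `P i`. -/
def db (h : FGProjective P) (i : ι) : Fin (dbCard h i) → (P i).carrier :=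
  have := (h i).1
  have := (h i).2
  (exists_dualBasis (A := A) (P i).carrier).choose_spec.choose

/-- The functionals `e*` of a dual basis of `P i`. -/
def db' (h : FGProjective P) (i : ι) : Fin (dbCard h i) → (P i).carrier →ₗ[Aᵐᵒᵖ] A :=
  have := (h i).1
  have := (h i).2
  (exists_dualBasis (A := A) (P i).carrier).choose_spec.choose_spec.choose

theorem db_spec (h : FGProjective P) (i : ι) (p : (P i).carrier) :
    ∑ k, op (db' h i k p) • db h i k = p :=
  have := (h i).1
  have := (h i).2
  (exists_dualBasis (A := A) (P i).carrier).choose_spec.choose_spec.choose_spec p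

/-- A functional is determined by its values on a dual basis. -/
theorem db_functional (h : FGProjective P) (i : ι) (φ : (P i).carrier →ₗ[Aᵐᵒᵖ] A) :
    ∑ k, φ (db h i k) • db' h i k = φ := by
  ext p
  conv_rhs => rw [← db_spec h i p, map_sum]
  simp

theorem incDag_sum (h : FGProjective P) (i : ι) (φ : (P i).carrier →ₗ[Aᵐᵒᵖ] A) :
    ∑ k, φ (db h i k) • incDag P i (db' h i k) = incDag P i φ := by
  apply Subtype.ext
  ext x
  have := LinearMap.congr_fun (db_functional h i φ) (proj P i x)
  simpa [incDag] using this

variable [DecidableEq ι]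

/-- The element of `R` given by a morphism `P i → P j`. -/
def singleR {i j : ι} (g : P i ⟶ P j) : ringR P :=
  ⟨single P g.toLin, AddSubgroup.subset_closure ⟨i, j, g, rfl⟩⟩

theorem singleR_smul_inc {i j : ι} (g : P i ⟶ P j) (p : (P i).carrier) :
    singleR g • inc P i p = inc P j (g.toLin p) := single_inc_self P g.toLin p

theorem op_singleR_smul_incDag {i j : ι} (g : P i ⟶ P j) (φ : (P j).carrier →ₗ[Aᵐᵒᵖ] A) :
    op (singleR g) • incDag P j φ = incDag P i (φ ∘ₗ g.toLin) :=
  Subtype.ext (LinearMap.ext fun x =>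
    congrArg (fun f => φ (f (g.toLin (proj P i x)))) (proj_inc_self P j))

theorem op_singleR_id_smul (i : ι) (φ : SigDag P) :
    op (singleR (𝟙 (P i))) • φ = incDag P i (φ.1 ∘ₗ inc P i) := rfl

/-- The coaction `Σ → Σ ⊗_A (Σ† ⊗_R Σ)`, given on `P i` by `p ↦ ∑ e ⊗ (e* ⊗ p)`. -/
def comatrixCoact (h : FGProjective P) : Sig P →ₗ[Aᵐᵒᵖ] BalTensor A (Sig P) (Comatrix P) :=
  sigLift P fun i =>
    { toFun := fun p => ∑ k, tmul A (inc P i (db h i k))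
        (Comatrix.mk P (incDag P i (db' h i k)) (inc P i p))
      map_add' := fun p q => by simp [tmul_add, Finset.sum_add_distrib]
      map_smul' := fun a p => by simp [Finset.smul_sum] }

theorem comatrixCoact_inc (h : FGProjective P) (i : ι) (p : (P i).carrier) :
    comatrixCoact h (inc P i p) = ∑ k, tmul A (inc P i (db h i k))
      (Comatrix.mk P (incDag P i (db' h i k)) (inc P i p)) := by
  rw [comatrixCoact, sigLift_inc]; rfl

/-- `R` acts on `Σ` compatibly with the coaction of `Σ† ⊗_R Σ`. -/
theorem comatrixCoact_smul (h : FGProjective P) (r : ringR P) (x : Sig P) :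
    comatrixCoact h (r • x) = rTensor (Comatrix P) (smulLin (Sig P) r) (comatrixCoact h x) := by
  refine ringR_induction P
    (p := fun f => comatrixCoact h (f x) = rTensor (Comatrix P) f (comatrixCoact h x)) r
    (fun i j g => ?_) ?_ ?_ ?_
  · induction x using sig_induction with
    | zero => simp
    | inc l p =>
      by_cases hl : l = i
      · subst hl
        rw [single_inc_self, comatrixCoact_inc, comatrixCoact_inc, map_sum]
        simp only [rTensor_tmul, single_inc_self]
        have h1 : ∀ k, Comatrix.mk P (incDag P j (db' h j k)) (inc P j (g.toLin p)) =
            ∑ m, db' h j k (g.toLin (db h l m)) •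
              Comatrix.mk P (incDag P l (db' h l m)) (inc P l p) := by
          intro k
          rw [← singleR_smul_inc, ← Comatrix.mk_op_smul, op_singleR_smul_incDag,
            ← incDag_sum h, Comatrix.mk_sum]
          rfl
        have h2 : ∀ m, inc P j (g.toLin (db h l m)) =
            ∑ k, op (db' h j k (g.toLin (db h l m))) • inc P j (db h j k) := by
          intro m
          conv_lhs => rw [← db_spec h j (g.toLin (db h l m)), map_sum]
          simp only [map_smul]
        simp only [h1, h2, tmul_sum, sum_tmul, smul_tmul]
        exact Finset.sum_comm
      · have h0 := single_comp_inc_ne P hl g.toLin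
        rw [show single P g.toLin (inc P l p) = 0 from LinearMap.congr_fun h0 p,
          comatrixCoact_inc, map_sum, map_zero]
        refine (Finset.sum_eq_zero fun k _ => ?_).symm
        rw [rTensor_tmul, show single P g.toLin (inc P l _) = 0 from LinearMap.congr_fun h0 _,
          zero_tmul]
    | add x y hx hy => simp [hx, hy]
  · simp [rTensor_zero]
  · intro f g hf hg; simp [rTensor_add, hf, hg]
  · intro f hf; simp [rTensor_neg, hf]

/-- The comultiplication of `Σ† ⊗_R Σ`: for `p` in `P i` it sends `φ ⊗ p` to
`∑ (φ ⊗ e) ⊗ (e* ⊗ p)`. -/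
def comatrixComul (h : FGProjective P) :
    Comatrix P →ₗ[Aᵐᵒᵖ] BalTensor A (Comatrix P) (Comatrix P) :=
  tensorCoact (SigDag P) (comatrixCoact h) (comatrixCoact_smul h)

theorem comatrixComul_mk (h : FGProjective P) (φ : SigDag P) (i : ι) (p : (P i).carrier) :
    comatrixComul h (Comatrix.mk P φ (inc P i p)) =
      ∑ k, tmul A (Comatrix.mk P φ (inc P i (db h i k)))
        (Comatrix.mk P (incDag P i (db' h i k)) (inc P i p)) := by
  change rTensor (Comatrix P) (Comatrix.mk P φ) (comatrixCoact h (inc P i p)) = _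
  rw [comatrixCoact_inc, map_sum]
  simp only [rTensor_tmul]

/-- The counit of `Σ† ⊗_R Σ` is the evaluation `φ ⊗ x ↦ φ(x)`. -/
def comatrixCounit (P : ι → Comod C) : Comatrix P →+ A :=
  lift (AddMonoidHom.mk' (fun φ : SigDag P => φ.1.toAddMonoidHom) (fun _ _ => rfl))
    (fun _ _ _ => rfl)

theorem comatrixCounit_mk (φ : SigDag P) (x : Sig P) :
    comatrixCounit P (Comatrix.mk P φ x) = φ.1 x := rfl

theorem comatrixComul_smul (h : FGProjective P) (a : A) (x : Comatrix P) :
    (comatrixComul h).toAddMonoidHom (a • x) = a • (comatrixComul h).toAddMonoidHom x := by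
  change comatrixComul h (a • x) = a • comatrixComul h x
  induction x using Comatrix.induction with
  | zero => simp
  | mk φ i p =>
    rw [← Comatrix.mk_smul, comatrixComul_mk, comatrixComul_mk, Finset.smul_sum]
    simp only [smul_tmul_left, Comatrix.mk_smul]
  | add x y hx hy => rw [smul_add, map_add, hx, hy, map_add, smul_add]

theorem comatrixCounit_smul (a : A) (x : Comatrix P) :
    comatrixCounit P (a • x) = a • comatrixCounit P x := by
  induction x using Comatrix.induction with
  | zero => simp
  | mk φ i p => rfl
  | add x y hx hy => rw [smul_add, map_add, hx, hy, map_add, smul_add]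

theorem comatrixCounit_op_smul (a : Aᵐᵒᵖ) (x : Comatrix P) :
    comatrixCounit P (a • x) = a • comatrixCounit P x := by
  induction x using Comatrix.induction with
  | zero => simp
  | mk φ i p => rw [← map_smul, comatrixCounit_mk, comatrixCounit_mk, map_smul]
  | add x y hx hy => rw [smul_add, map_add, hx, hy, map_add, smul_add]

theorem comatrixCoact_coassoc (h : FGProjective P) (x : Sig P) :
    assoc (rTensor (Comatrix P) (comatrixCoact h) (comatrixCoact h x)) =
      mapRight (Sig P) (comatrixComul h).toAddMonoidHom (comatrixComul_smul h)
        (comatrixCoact h x) := by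
  induction x using sig_induction with
  | zero => simp
  | inc i p =>
    rw [comatrixCoact_inc, map_sum, map_sum, map_sum]
    simp only [map_sum, rTensor_tmul, comatrixCoact_inc, sum_tmul, assoc_tmul, mapRight_tmul,
      LinearMap.toAddMonoidHom_coe, comatrixComul_mk, tmul_sum]
    exact Finset.sum_comm
  | add x y hx hy => simp only [map_add, hx, hy]

theorem comatrixCoact_counit (h : FGProjective P) (x : Sig P) :
    rightUnit (mapRight (Sig P) (comatrixCounit P) comatrixCounit_smul
      (comatrixCoact h x)) = x := by
  induction x using sig_induction with
  | zero => simp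
  | inc i p =>
    rw [comatrixCoact_inc]
    simp only [map_sum, mapRight_tmul, rightUnit_tmul, comatrixCounit_mk]
    conv_rhs => rw [← db_spec h i p, map_sum]
    refine Finset.sum_congr rfl fun k _ => ?_
    rw [map_smul]
    exact congrArg (fun f => op (db' h i k (f p)) • inc P i (db h i k)) (proj_inc_self P i)
  | add x y hx hy => simp only [map_add, hx, hy]

theorem comatrix_coassoc (h : FGProjective P) (x : Comatrix P) :
    assoc (mapLeft (Comatrix P) (comatrixComul h).toAddMonoidHom
      (fun c a => (comatrixComul h).map_smul (op a) c) (comatrixComul h x)) =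
      mapRight (Comatrix P) (comatrixComul h).toAddMonoidHom (comatrixComul_smul h)
        (comatrixComul h x) := by
  exact tensorCoact_coassoc (Y := SigDag P) (comatrixCoact h) (comatrixCoact_smul h)
    (comatrixComul h).toAddMonoidHom (comatrixComul_smul h) (comatrixCoact_coassoc h) x

theorem comatrix_counit_comul (h : FGProjective P) (x : Comatrix P) :
    leftUnit (mapLeft (Comatrix P) (comatrixCounit P)
      (fun c a => comatrixCounit_op_smul (op a) c) (comatrixComul h x)) = x := by
  induction x using Comatrix.induction with
  | zero => simp
  | mk φ i p =>
    have h1 : Comatrix.mk P φ (inc P i p) =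
        Comatrix.mk P (incDag P i (φ.1 ∘ₗ inc P i)) (inc P i p) := by
      rw [← op_singleR_id_smul, Comatrix.mk_op_smul, singleR_smul_inc]; rfl
    rw [comatrixComul_mk]
    conv_rhs => rw [h1, ← incDag_sum h, Comatrix.mk_sum]
    simp only [map_sum, mapLeft_tmul, leftUnit_tmul, comatrixCounit_mk]
    rfl
  | add x y hx hy => simp only [map_add, hx, hy]

theorem comatrix_comul_counit (h : FGProjective P) (x : Comatrix P) :
    rightUnit (mapRight (Comatrix P) (comatrixCounit P) comatrixCounit_smul
      (comatrixComul h x)) = x :=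
  tensorCoact_counit (Y := SigDag P) (comatrixCoact h) (comatrixCoact_smul h)
    (comatrixCounit P) comatrixCounit_smul (comatrixCoact_counit h) x

/-- The coring `Σ† ⊗_R Σ`, for comodules that are finitely generated projective over `A`. -/
def comatrixCoring (h : FGProjective P) : Coring A where
  carrier := Comatrix P
  comul := (comatrixComul h).toAddMonoidHom
  comul_smul := comatrixComul_smul h
  comul_op_smul := (comatrixComul h).map_smul
  counit := comatrixCounit P
  counit_smul := comatrixCounit_smul
  counit_op_smul := comatrixCounit_op_smul
  coassoc := comatrix_coassoc h
  counit_comul := comatrix_counit_comul h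
  comul_counit := comatrix_comul_counit h

/-- `Σ` as a comodule over the coring `Σ† ⊗_R Σ`. -/
def sigmaComatrix (h : FGProjective P) : Comod (comatrixCoring h) where
  carrier := Sig P
  coact := comatrixCoact h
  coassoc := comatrixCoact_coassoc h
  counit := comatrixCoact_counit h

instance (h : FGProjective P) : NUModule (ringR P) (sigmaComatrix h).carrier :=
  inferInstanceAs (NUModule _ (Sig P))

instance (h : FGProjective P) : SMulCommClass (ringR P) Aᵐᵒᵖ (sigmaComatrix h).carrier :=
  inferInstanceAs (SMulCommClass _ _ (Sig P))

/-- The functor `- ⊗_R Σ` from unital right `R`-modules to right comodules over the coring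
`Σ† ⊗_R Σ`. -/
def tensorSigmaComatrix (h : FGProjective P) :
    UnitalRightMod (ringR P) ⥤ Comod (comatrixCoring h) :=
  tensorFunctor (sigmaComatrix h) (comatrixCoact_smul h)

/-- The canonical map is an isomorphism of corings from `Σ† ⊗_R Σ` to `C`. -/
def CanIsIso (h : FGProjective P) : Prop :=
  IsCoringIso (D := comatrixCoring h) (C := C) (can P)

end ComatrixCoring

/-! ## Generating sets of small projectives -/

/-- An object `X` is small if `Hom(X, -)` preserves coproducts. -/
def IsSmallObject {𝒞 : Type*} [Category.{u} 𝒞] [Preadditive 𝒞] (X : 𝒞) : Prop :=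
  ∀ J : Type u, Limits.PreservesColimitsOfShape (Discrete J) (preadditiveCoyoneda.obj (Opposite.op X))

/-- The family `P` of comodules is a generating set of small projectives: all `P i` are small
and `⨁ P` is a projective generator of the category of comodules. -/
structure IsGeneratingSetOfSmallProjectives {C : Coring A} {ι : Type u} [DecidableEq ι]
    (P : ι → Comod C) : Prop where
  small : ∀ i, IsSmallObject (P i)
  projective : Projective (sigmaComod P)
  generator : IsSeparator (sigmaComod P)

end Corings

end

/-!
Write `F = - ⊗_R Σ`, from unital right `R`-modules to `C`-comodules. Its right adjoint sends `M` to
`⨁ Hom_C(P, M)`, realized as the group of the comodule morphisms `Σ → M` that vanish on almost all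
`P i` (`tensorHomAdjunction`). The ring `R` has no unit, but it has local units, the projections
`idemR P s` of `Σ` to finitely many summands, and these replace the unit throughout. If all
evaluations `⨁ Hom_C(P, M) ⊗_R Σ → M` are bijective, then `F` turns the unit of the adjunction into
isomorphisms; a faithful functor reflects monomorphisms and epimorphisms, so that `F` is then an
equivalence if it is also faithful (`isEquivalence_of_faithful`).
The equivalence of `F` with target the `C`-comodules is the condition through which all the others
are linked.

* From small projective generators to the equivalence (`isEquivalence_of_isGeneratingSet`). A
  unital `R`-module `Y` gives the coproduct `⨁_{y ∈ Y} Σ`, which maps onto `Y ⊗_R Σ`; the kernel is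
  the image of a second coproduct, one copy of `Σ` for each defining relation of the tensor product.
  If `y ⊗ x = 0` for all `x`, the inclusion of `P i` at the index `y` lifts to this second
  coproduct, because `P i` is projective; it meets only finitely many relations, because `P i` is
  small; and these relations hold in `Y`, so `y` is killed by the idempotent of `P i`. Hence `F` is
  faithful. Bijectivity of the evaluations comes from the generator property, applied to `M` and to
  a kernel; flatness of `C` is what makes kernels of comodule morphisms comodules.
* Back (`isGeneratingSet_of_isEquivalence`). If the images of the morphisms in a
  submodule of `⨁ Hom_C(P, M)` generate `M`, this submodule is everything, since `F` reflects
  epimorphisms. Applied to an epimorphism this gives projectivity; applied to the inclusions of a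
  coproduct it gives smallness.
* Small projective comodules are finitely generated projective over `A`: the coaction `P → P ⊗ C`
  lifts to a coproduct of copies of `A ⊗ C`, and the counit turns this lift into a finite dual basis
  (`exists_dualBasis_of_projective`). Moreover `can` is, up to isomorphism, the evaluation at the
  comodule `A ⊗ C` (`can_bijective_of_isEquivalence`).
* Faithful flatness of `Σ` implies the equivalence by descent. If `can` is bijective and the `P i`
  are finitely generated projective, then `⨁ Hom_A(P, X) ⊗_R Σ ≅ X ⊗_A C` for every `A`-module `X`
  (`toCofree_bijective`). This shows that `C` is flat if `Σ` is, and that tensoring with `Σ` turns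
  the equalizer `⨁ Hom_C(P, M)` of `⨁ Hom_A(P, M) ⇉ ⨁ Hom_A(P, M ⊗ C)` into the equalizer `M` of
  `M ⊗ C ⇉ M ⊗ C ⊗ C` (`evalHom_bijective_of_flat`). Conversely an equivalence `F` preserves
  monomorphisms, which are injections in both categories when `C` is flat.
* The modules `Σ` and `S` are compared through the maps `s ↦ s(x)` and `x ↦ x φ(-)`, for `x ∈ Σ` and
  `φ ∈ P*` (`isFaithfullyFlat_ringS`, `isFaithfullyFlat_of_ringS`).
* The functor to comodules over `Σ† ⊗_R Σ` is `F` after the change of coring along `can`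
  (`tensorSigmaComatrix_isEquivalence_iff`).
-/

noncomputable section
namespace Corings
open CategoryTheory MulOpposite
open BalTensor

/-! ### Exactness and associativity of the tensor product -/

namespace BalTensor

section Exactness

variable {R M' M M'' N N' : Type*} [AddCommGroup M'] [AddCommGroup M] [AddCommGroup M'']
  [AddCommGroup N] [AddCommGroup N'] [SMul Rᵐᵒᵖ M'] [SMul Rᵐᵒᵖ M] [SMul Rᵐᵒᵖ M''] [SMul R N]
  [SMul R N']

/-- Right exactness of `- ⊗_R N`. -/
theorem exists_mapLeft_eq {f : M' →+ M} {hf : ∀ (m : M') (r : R), f (op r • m) = op r • f m}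
    {g : M →+ M''} {hg : ∀ (m : M) (r : R), g (op r • m) = op r • g m}
    (hsurj : Function.Surjective g) (hex : ∀ m, g m = 0 → ∃ m', f m' = m)
    (x : BalTensor R M N) (hx : mapLeft N g hg x = 0) : ∃ x', mapLeft N f hf x' = x := by
  let q := QuotientAddGroup.mk' (mapLeft N f hf).range
  have key : ∀ (m m₁ : M) (n : N), g m = g m₁ → q (tmul R m n) = q (tmul R m₁ n) := by
    intro m m₁ n h
    obtain ⟨m', hm'⟩ := hex (m - m₁) (by rw [map_sub, h, sub_self])
    rw [← sub_eq_zero, ← map_sub]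
    refine (QuotientAddGroup.eq_zero_iff _).2 ⟨tmul R m' n, ?_⟩
    rw [mapLeft_tmul, hm', ← tmulHom_apply, map_sub]
    rfl
  let s := Function.surjInv hsurj
  have hs : ∀ m, g (s m) = m := Function.surjInv_eq hsurj
  let L : BalTensor R M'' N →+ BalTensor R M N ⧸ (mapLeft N f hf).range :=
    lift (AddMonoidHom.mk' (fun m => q.comp (tmulHom R M N (s m)))
      (fun m m₁ => by
        ext n
        simp only [AddMonoidHom.comp_apply, tmulHom_apply, AddMonoidHom.add_apply]
        rw [key (s (m + m₁)) (s m + s m₁) n (by rw [map_add, hs, hs, hs]), add_tmul, map_add]))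
      (fun m r n => by
        simp only [AddMonoidHom.mk'_apply, AddMonoidHom.comp_apply, tmulHom_apply]
        rw [key (s (op r • m)) (op r • s m) n (by rw [hg, hs, hs]), smul_tmul])
  have hL : L.comp (mapLeft N g hg) = q := BalTensor.hom_ext fun m n => by
    change q (tmul R (s (g m)) n) = _
    exact key _ _ n (hs _)
  have h0 : q x = 0 := by rw [← hL, AddMonoidHom.comp_apply, hx, map_zero]
  exact (QuotientAddGroup.eq_zero_iff _).1 h0

theorem sub_tmul (m m' : M) (n : N) : tmul R (m - m') n = tmul R m n - tmul R m' n :=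
  map_sub ((tmulHom R M N).flip n) m m'

theorem mapLeft_surjective {g : M →+ M''} {hg : ∀ (m : M) (r : R), g (op r • m) = op r • g m}
    (hsurj : Function.Surjective g) : Function.Surjective (mapLeft N g hg) := by
  intro x
  induction x using induction_on with
  | zero => exact ⟨0, map_zero _⟩
  | tmul m n => obtain ⟨m, rfl⟩ := hsurj m; exact ⟨tmul R m n, rfl⟩
  | add x y hx hy =>
    obtain ⟨x, rfl⟩ := hx
    obtain ⟨y, rfl⟩ := hy
    exact ⟨x + y, map_add _ _ _⟩

theorem mapRight_bijective {g : N →+ N'} {hg : ∀ (r : R) (n : N), g (r • n) = r • g n}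
    (hbij : Function.Bijective g) : Function.Bijective (mapRight M g hg) := by
  let e := AddEquiv.ofBijective g hbij
  have he : ∀ (r : R) (n : N'), e.symm.toAddMonoidHom (r • n) = r • e.symm.toAddMonoidHom n := by
    intro r n
    apply e.injective
    change e (e.symm _) = g (r • e.symm n)
    rw [e.apply_symm_apply, hg]
    exact congrArg (r • ·) (e.apply_symm_apply n).symm
  refine Function.bijective_iff_has_inverse.2
    ⟨mapRight M e.symm.toAddMonoidHom he, fun x => ?_, fun x => ?_⟩
  · refine DFunLike.congr_fun (f := (mapRight M e.symm.toAddMonoidHom he).comp (mapRight M g hg))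
      (g := AddMonoidHom.id _) (BalTensor.hom_ext fun m n => ?_) x
    exact congrArg (tmul R m) (e.symm_apply_apply n)
  · refine DFunLike.congr_fun (f := (mapRight M g hg).comp (mapRight M e.symm.toAddMonoidHom he))
      (g := AddMonoidHom.id _) (BalTensor.hom_ext fun m n => ?_) x
    exact congrArg (tmul R m) (e.apply_symm_apply n)

theorem mapLeft_bijective {g : M →+ M''} {hg : ∀ (m : M) (r : R), g (op r • m) = op r • g m}
    (hbij : Function.Bijective g) : Function.Bijective (mapLeft N g hg) := by
  let e := AddEquiv.ofBijective g hbij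
  have he : ∀ (m : M'') (r : R),
      e.symm.toAddMonoidHom (op r • m) = op r • e.symm.toAddMonoidHom m := by
    intro m r
    apply e.injective
    change e (e.symm _) = g (op r • e.symm m)
    rw [e.apply_symm_apply, hg]
    exact congrArg (op r • ·) (e.apply_symm_apply m).symm
  refine ⟨Function.LeftInverse.injective (g := mapLeft N e.symm.toAddMonoidHom he) fun x => ?_,
    mapLeft_surjective hbij.2⟩
  refine DFunLike.congr_fun (f := (mapLeft N e.symm.toAddMonoidHom he).comp (mapLeft N g hg))
    (g := AddMonoidHom.id _) (BalTensor.hom_ext fun m n => ?_) x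
  exact congrArg (tmul R · n) (e.symm_apply_apply m)

end Exactness

section Assoc

variable {A : Type*} [Ring A] {M N L : Type*} [AddCommGroup M] [AddCommGroup N] [AddCommGroup L]
  [Module Aᵐᵒᵖ M] [Module A N] [Module Aᵐᵒᵖ N] [SMulCommClass A Aᵐᵒᵖ N] [Module A L]

/-- The canonical isomorphism `M ⊗_A (N ⊗_A L) → (M ⊗_A N) ⊗_A L`, inverse to `assoc`. -/
def assocSymm : BalTensor A M (BalTensor A N L) →+ BalTensor A (BalTensor A M N) L :=
  lift (AddMonoidHom.mk' (fun m => mapLeft L (tmulHom A M N m) (fun _ _ => rfl))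
      (fun m m' => BalTensor.hom_ext fun n l => by
        change tmul A (tmul A (m + m') n) l = tmul A (tmul A m n) l + tmul A (tmul A m' n) l
        rw [add_tmul, add_tmul]))
    (fun m a x => by
      induction x using induction_on with
      | zero => simp
      | tmul n l =>
        change tmul A (tmul A (op a • m) n) l = tmul A (tmul A m (a • n)) l
        rw [smul_tmul]
      | add x y hx hy => simp only [smul_add, map_add, hx, hy])

@[simp] theorem assocSymm_tmul (m : M) (n : N) (l : L) :
    assocSymm (tmul A m (tmul A n l)) = tmul A (tmul A m n) l := rfl

@[simp] theorem assocSymm_assoc (x : BalTensor A (BalTensor A M N) L) :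
    assocSymm (assoc x) = x := by
  induction x using induction_on with
  | zero => simp
  | tmul y l =>
    induction y using induction_on with
    | zero => simp
    | tmul m n => simp
    | add x y hx hy => rw [add_tmul, map_add, map_add, hx, hy]
  | add x y hx hy => simp [hx, hy]

@[simp] theorem assoc_assocSymm (x : BalTensor A M (BalTensor A N L)) :
    assoc (assocSymm x) = x := by
  induction x using induction_on with
  | zero => simp
  | tmul m y =>
    induction y using induction_on with
    | zero => simp
    | tmul n l => simp
    | add x y hx hy => rw [tmul_add, map_add, map_add, hx, hy]
  | add x y hx hy => simp [hx, hy]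

theorem assoc_injective : Function.Injective (assoc : BalTensor A (BalTensor A M N) L →+ _) :=
  Function.LeftInverse.injective assocSymm_assoc

end Assoc

section Units

variable {A : Type*} [Ring A] {N : Type*} [AddCommGroup N] [Module A N]

theorem leftUnit_bijective : Function.Bijective (leftUnit : BalTensor A A N →+ N) := by
  refine Function.bijective_iff_has_inverse.2 ⟨fun n => tmul A 1 n, fun x => ?_, fun n => by simp⟩
  induction x using induction_on with
  | zero => simp
  | tmul a n => change tmul A 1 (a • n) = _; rw [← smul_tmul]; simp
  | add x y hx hy => exact (congrArg _ (map_add _ _ _)).trans ((tmul_add _ _ _).trans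
      (congrArg₂ (· + ·) hx hy))

end Units

end BalTensor

variable {A : Type u} [Ring A] {C : Coring A}

/-! ### Kernels, quotients and cofree objects in the category of comodules -/

/-- A flat coefficient module detects the kernel of `f ⊗ N`: it comes from the kernel of `f`. -/
theorem IsFlat.exists_rTensor_subtype_eq {N : Type u} [AddCommGroup N] [Module A N]
    (hN : IsFlat A N) {X Y : Type u} [AddCommGroup X] [AddCommGroup Y] [Module Aᵐᵒᵖ X]
    [Module Aᵐᵒᵖ Y] (f : X →ₗ[Aᵐᵒᵖ] Y) (x : BalTensor A X N) (hx : rTensor N f x = 0) :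
    ∃ x', rTensor N (LinearMap.ker f).subtype x' = x := by
  have h0 : rTensor N (LinearMap.ker f).mkQ x = 0 := by
    apply hN _ _ ((LinearMap.ker f).liftQ f le_rfl)
      (LinearMap.ker_eq_bot.1 (Submodule.ker_liftQ_eq_bot _ _ _ le_rfl))
    rw [← rTensor_comp_apply, Submodule.liftQ_mkQ, hx, map_zero]
  exact exists_mapLeft_eq (f := (LinearMap.ker f).subtype.toAddMonoidHom)
    (g := (LinearMap.ker f).mkQ.toAddMonoidHom)
    (hf := fun m a => map_smul (LinearMap.ker f).subtype (op a) m)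
    (hg := fun m a => map_smul (LinearMap.ker f).mkQ (op a) m)
    (Submodule.mkQ_surjective _) (fun m hm => ⟨⟨m, by
      simpa using hm⟩, rfl⟩) x h0

namespace Comod

theorem coact_injective (M : Comod C) : Function.Injective M.coact := fun m m' h => by
  rw [← M.counit m, ← M.counit m', h]

/-- A subcomodule, given by a submodule `K` whose elements have their coaction in the image of
`K ⊗ C`. Flatness of `C` makes `K ⊗ C → M ⊗ C` injective, so that the coaction restricts. -/
def sub (hC : IsFlat A C.carrier) (M : Comod C) (K : Submodule Aᵐᵒᵖ M.carrier)
    (hK : ∀ k : K, ∃ z, rTensor C.carrier K.subtype z = M.coact k) : Comod C :=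
  have hi := hC _ _ K.subtype K.injective_subtype
  let ρ : K →ₗ[Aᵐᵒᵖ] BalTensor A K C.carrier :=
    { toFun := fun k => (hK k).choose
      map_add' := fun k l => hi (by
        rw [map_add, (hK k).choose_spec, (hK l).choose_spec, (hK (k + l)).choose_spec]
        exact map_add M.coact _ _)
      map_smul' := fun a k => hi (by
        rw [(hK (a • k)).choose_spec]
        exact (map_smul M.coact a k.1).trans ((congrArg (a • ·) (hK k).choose_spec.symm).trans
          ((rTensorLin C.carrier K.subtype).map_smul a _).symm)) }
  have hρ : ∀ k, rTensor C.carrier K.subtype (ρ k) = M.coact k := fun k => (hK k).choose_spec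
  have hρ' : rTensorLin C.carrier K.subtype ∘ₗ ρ = M.coact ∘ₗ K.subtype :=
    LinearMap.ext hρ
  { carrier := K
    coact := ρ
    coassoc := fun k => by
      have h2 : Function.Injective (rTensor (BalTensor A C.carrier C.carrier) K.subtype) := by
        intro x y h
        have h' := congrArg assocSymm h
        rw [← assoc_assocSymm x, ← assoc_assocSymm y, ← assoc_rTensor_rTensorLin,
          ← assoc_rTensor_rTensorLin, assocSymm_assoc, assocSymm_assoc] at h'
        have h3 := hC _ _ (rTensorLin C.carrier K.subtype) hi h'
        rw [← assoc_assocSymm x, h3, assoc_assocSymm]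
      apply h2
      rw [← assoc_rTensor_rTensorLin, ← rTensor_comp_apply, hρ', rTensor_comp_apply, hρ,
        ← mapRight_rTensor, hρ, M.coassoc]
    counit := fun k => Subtype.ext (by
      change K.subtype _ = _
      rw [← rightUnit_rTensor, ← mapRight_rTensor, hρ, M.counit]) }

/-- The inclusion of a subcomodule. -/
def subHom (hC : IsFlat A C.carrier) (M : Comod C) (K : Submodule Aᵐᵒᵖ M.carrier)
    (hK : ∀ k : K, ∃ z, rTensor C.carrier K.subtype z = M.coact k) : sub hC M K hK ⟶ M where
  toLin := K.subtype
  coact_comm k := (hK k).choose_spec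

/-- A morphism whose values lie in a subcomodule factors through it. -/
def subLift (hC : IsFlat A C.carrier) {M : Comod C} (K : Submodule Aᵐᵒᵖ M.carrier)
    (hK : ∀ k : K, ∃ z, rTensor C.carrier K.subtype z = M.coact k) {L : Comod C} (f : L ⟶ M)
    (hf : ∀ x, f.toLin x ∈ K) : L ⟶ sub hC M K hK where
  toLin := f.toLin.codRestrict K hf
  coact_comm x := by
    apply hC _ _ K.subtype K.injective_subtype
    exact (rTensor_comp_apply (f.toLin.codRestrict K hf) K.subtype _).symm.trans
      ((f.coact_comm x).trans ((subHom hC M K hK).coact_comm ⟨f.toLin x, hf x⟩).symm)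

theorem ker_coact (hC : IsFlat A C.carrier) {M N : Comod C} (f : M ⟶ N)
    (k : LinearMap.ker f.toLin) :
    ∃ z, rTensor C.carrier (LinearMap.ker f.toLin).subtype z = M.coact k := by
  apply hC.exists_rTensor_subtype_eq
  rw [f.coact_comm, k.2, map_zero]

/-- The kernel of a morphism of comodules, for a flat coring. -/
abbrev kerComod (hC : IsFlat A C.carrier) {M N : Comod C} (f : M ⟶ N) : Comod C :=
  sub hC M (LinearMap.ker f.toLin) (ker_coact hC f)

/-- The coaction on the quotient of a comodule by the image of a morphism. -/
def cokerCoact {M N : Comod C} (f : M ⟶ N) : (N.carrier ⧸ LinearMap.range f.toLin) →ₗ[Aᵐᵒᵖ]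
    BalTensor A (N.carrier ⧸ LinearMap.range f.toLin) C.carrier :=
  (LinearMap.range f.toLin).liftQ
    (rTensorLin C.carrier (LinearMap.range f.toLin).mkQ ∘ₗ N.coact) (by
      rintro _ ⟨m, rfl⟩
      have h : (LinearMap.range f.toLin).mkQ ∘ₗ f.toLin = 0 := LinearMap.range_mkQ_comp _
      rw [LinearMap.mem_ker, LinearMap.comp_apply, rTensorLin_apply, ← f.coact_comm,
        ← rTensor_comp_apply, h, rTensor_zero, AddMonoidHom.zero_apply])

theorem cokerCoact_comp_mkQ {M N : Comod C} (f : M ⟶ N) :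
    cokerCoact f ∘ₗ (LinearMap.range f.toLin).mkQ =
      rTensorLin C.carrier (LinearMap.range f.toLin).mkQ ∘ₗ N.coact :=
  Submodule.liftQ_mkQ _ _ _

theorem cokerCoact_mkQ {M N : Comod C} (f : M ⟶ N) (n : N.carrier) :
    cokerCoact f ((LinearMap.range f.toLin).mkQ n) =
      rTensor C.carrier (LinearMap.range f.toLin).mkQ (N.coact n) := rfl

/-- The quotient of a comodule by the image of a morphism. -/
def coker {M N : Comod C} (f : M ⟶ N) : Comod C where
  carrier := N.carrier ⧸ LinearMap.range f.toLin
  coact := cokerCoact f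
  coassoc x := by
    obtain ⟨n, rfl⟩ := Submodule.mkQ_surjective _ x
    rw [cokerCoact_mkQ, ← rTensor_comp_apply, cokerCoact_comp_mkQ, rTensor_comp_apply,
      assoc_rTensor_rTensorLin, N.coassoc, mapRight_rTensor]
  counit x := by
    obtain ⟨n, rfl⟩ := Submodule.mkQ_surjective _ x
    rw [cokerCoact_mkQ, mapRight_rTensor, rightUnit_rTensor, N.counit]

/-- The projection to the quotient by the image of a morphism. -/
def cokerHom {M N : Comod C} (f : M ⟶ N) : N ⟶ coker f where
  toLin := (LinearMap.range f.toLin).mkQ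
  coact_comm _ := rfl

theorem comp_cokerHom {M N : Comod C} (f : M ⟶ N) : f ≫ cokerHom f = 0 :=
  hom_ext (LinearMap.range_mkQ_comp _)

theorem surjective_of_epi {M N : Comod C} (f : M ⟶ N) [Epi f] :
    Function.Surjective f.toLin := by
  have h : cokerHom f = 0 := by
    rw [← cancel_epi f, comp_cokerHom, Limits.comp_zero]
  rw [← LinearMap.range_eq_top, ← Submodule.ker_mkQ (LinearMap.range f.toLin)]
  exact LinearMap.ker_eq_top.2 (congrArg Hom.toLin h)

theorem epi_of_surjective {M N : Comod C} (f : M ⟶ N) (hf : Function.Surjective f.toLin) :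
    Epi f where
  left_cancellation g h e := hom_ext (LinearMap.ext fun n => by
    obtain ⟨m, rfl⟩ := hf n
    exact LinearMap.congr_fun (congrArg Hom.toLin e) m)

theorem injective_of_mono (hC : IsFlat A C.carrier) {M N : Comod C} (f : M ⟶ N) [Mono f] :
    Function.Injective f.toLin := by
  have h : subHom hC M _ (ker_coact hC f) = 0 := by
    rw [← cancel_mono f, Limits.zero_comp]
    exact hom_ext (LinearMap.ext fun k => k.2)
  rw [← LinearMap.ker_eq_bot, eq_bot_iff]
  intro k hk
  exact LinearMap.congr_fun (congrArg Hom.toLin h) ⟨k, hk⟩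

theorem isIso_of_bijective {M N : Comod C} (f : M ⟶ N) (hf : Function.Bijective f.toLin) :
    IsIso f := by
  let e := LinearEquiv.ofBijective f.toLin hf
  have he : e.symm.toLinearMap ∘ₗ f.toLin = LinearMap.id := LinearMap.ext e.symm_apply_apply
  refine ⟨⟨e.symm.toLinearMap, fun n => ?_⟩, hom_ext he,
    hom_ext (LinearMap.ext e.apply_symm_apply)⟩
  obtain ⟨m, rfl⟩ := hf.2 n
  rw [← f.coact_comm, ← rTensor_comp_apply, he, rTensor_id]
  exact congrArg M.coact (e.symm_apply_apply m).symm

theorem bijective_of_isIso {M N : Comod C} (f : M ⟶ N) [IsIso f] :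
    Function.Bijective f.toLin :=
  Function.bijective_iff_has_inverse.2 ⟨(inv f).toLin,
    LinearMap.congr_fun (congrArg Hom.toLin (IsIso.hom_inv_id f)),
    LinearMap.congr_fun (congrArg Hom.toLin (IsIso.inv_hom_id f))⟩

/-- The comultiplication of a coring as a right linear map. -/
def comulLin (C : Coring A) : C.carrier →ₗ[Aᵐᵒᵖ] BalTensor A C.carrier C.carrier where
  toFun := C.comul
  map_add' := map_add _
  map_smul' := C.comul_op_smul

/-- The map `C → X ⊗ C`, `c ↦ x ⊗ c`. -/
def cofreeMk (C : Coring A) {X : Type u} [AddCommGroup X] [Module Aᵐᵒᵖ X] (x : X) :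
    C.carrier →ₗ[Aᵐᵒᵖ] BalTensor A X C.carrier where
  toFun c := tmul A x c
  map_add' := tmul_add x
  map_smul' _ _ := rfl

/-- The coaction `X ⊗ Δ` of the cofree comodule. -/
def cofreeCoact (C : Coring A) (X : Type u) [AddCommGroup X] [Module Aᵐᵒᵖ X] :
    BalTensor A X C.carrier →ₗ[Aᵐᵒᵖ] BalTensor A (BalTensor A X C.carrier) C.carrier where
  toFun x := assocSymm (mapRight X C.comul C.comul_smul x)
  map_add' x y := by simp
  map_smul' a x := by
    induction x using induction_on with
    | zero => simp
    | tmul x c =>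
      simp only [op_smul_tmul_right, mapRight_tmul, C.comul_op_smul, RingHom.id_apply]
      generalize C.comul c = d
      induction d using induction_on with
      | zero => simp
      | tmul c d => simp
      | add d d' h h' => simp only [smul_add, tmul_add, map_add, h, h']
    | add x y hx hy => simp only [smul_add, map_add, hx, hy]

theorem assoc_cofreeCoact (C : Coring A) {X : Type u} [AddCommGroup X] [Module Aᵐᵒᵖ X]
    (x : BalTensor A X C.carrier) :
    assoc (cofreeCoact C X x) = mapRight X C.comul C.comul_smul x :=
  assoc_assocSymm _

theorem cofreeCoact_tmul (C : Coring A) {X : Type u} [AddCommGroup X] [Module Aᵐᵒᵖ X] (x : X)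
    (c : C.carrier) :
    cofreeCoact C X (tmul A x c) = rTensor C.carrier (cofreeMk C x) (C.comul c) := by
  change assocSymm (tmul A x (C.comul c)) = _
  generalize C.comul c = d
  induction d using induction_on with
  | zero => simp
  | tmul c d => rfl
  | add d d' h h' => simp only [tmul_add, map_add, h, h']

theorem cofreeCoact_comp_mk (C : Coring A) {X : Type u} [AddCommGroup X] [Module Aᵐᵒᵖ X]
    (x : X) : cofreeCoact C X ∘ₗ cofreeMk C x = rTensorLin C.carrier (cofreeMk C x) ∘ₗ comulLin C :=
  LinearMap.ext (cofreeCoact_tmul C x)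

/-- The cofree comodule `X ⊗_A C` on a right `A`-module `X`. -/
def cofree (C : Coring A) (X : Type u) [AddCommGroup X] [Module Aᵐᵒᵖ X] : Comod C where
  carrier := BalTensor A X C.carrier
  coact := cofreeCoact C X
  coassoc x := by
    induction x using induction_on with
    | zero => simp
    | tmul x c =>
      rw [cofreeCoact_tmul, ← rTensor_comp_apply, cofreeCoact_comp_mk, rTensor_comp_apply,
        assoc_rTensor_rTensorLin, mapRight_rTensor]
      exact congrArg _ (C.coassoc c)
    | add x y hx hy => simp only [map_add, hx, hy]
  counit x := by
    induction x using induction_on with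
    | zero => simp
    | tmul x c =>
      rw [cofreeCoact_tmul, mapRight_rTensor, rightUnit_rTensor, C.comul_counit]
      rfl
    | add x y hx hy => simp only [map_add, hx, hy]

theorem cofreeCoact_rTensor (C : Coring A) {X Y : Type u} [AddCommGroup X] [Module Aᵐᵒᵖ X]
    [AddCommGroup Y] [Module Aᵐᵒᵖ Y] (f : X →ₗ[Aᵐᵒᵖ] Y) (x : BalTensor A X C.carrier) :
    cofreeCoact C Y (rTensor C.carrier f x) =
      rTensor C.carrier (rTensorLin C.carrier f) (cofreeCoact C X x) := by
  apply assoc_injective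
  rw [assoc_cofreeCoact, assoc_rTensor_rTensorLin, assoc_cofreeCoact, mapRight_rTensor]

/-- The morphism of cofree comodules induced by a linear map. -/
def cofreeMap (C : Coring A) {X Y : Type u} [AddCommGroup X] [Module Aᵐᵒᵖ X] [AddCommGroup Y]
    [Module Aᵐᵒᵖ Y] (f : X →ₗ[Aᵐᵒᵖ] Y) : cofree C X ⟶ cofree C Y where
  toLin := rTensorLin C.carrier f
  coact_comm x := (cofreeCoact_rTensor C f x).symm

/-- The morphism of comodules `M → X ⊗ C` that corresponds to a linear map `M → X`. -/
def cofreeLift {M : Comod C} {X : Type u} [AddCommGroup X] [Module Aᵐᵒᵖ X]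
    (f : M.carrier →ₗ[Aᵐᵒᵖ] X) : M ⟶ cofree C X where
  toLin := rTensorLin C.carrier f ∘ₗ M.coact
  coact_comm m := by
    refine Eq.trans ?_ (cofreeCoact_rTensor C f (M.coact m)).symm
    refine (rTensor_comp_apply M.coact (rTensorLin C.carrier f) (M.coact m)).trans ?_
    refine congrArg _ (assoc_injective ?_)
    rw [assoc_cofreeCoact, M.coassoc]

/-- The linear map `X ⊗ C → X` given by the counit. -/
def cofreeCounit (C : Coring A) (X : Type u) [AddCommGroup X] [Module Aᵐᵒᵖ X] :
    BalTensor A X C.carrier →ₗ[Aᵐᵒᵖ] X where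
  toFun x := rightUnit (mapRight X C.counit C.counit_smul x)
  map_add' x y := by simp
  map_smul' a x := by
    induction x using induction_on with
    | zero => simp
    | tmul x c => simp [C.counit_op_smul, mul_smul]
    | add x y hx hy => simp only [smul_add, map_add, hx, hy]

theorem cofreeCounit_rTensor (C : Coring A) {X Y : Type u} [AddCommGroup X] [Module Aᵐᵒᵖ X]
    [AddCommGroup Y] [Module Aᵐᵒᵖ Y] (f : X →ₗ[Aᵐᵒᵖ] Y) (x : BalTensor A X C.carrier) :
    cofreeCounit C Y (rTensor C.carrier f x) = f (cofreeCounit C X x) := by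
  change rightUnit (mapRight Y C.counit C.counit_smul _) = _
  rw [mapRight_rTensor, rightUnit_rTensor]
  rfl

theorem cofreeCounit_cofreeLift {M : Comod C} {X : Type u} [AddCommGroup X] [Module Aᵐᵒᵖ X]
    (f : M.carrier →ₗ[Aᵐᵒᵖ] X) (m : M.carrier) :
    cofreeCounit C X ((cofreeLift f).toLin m) = f m :=
  (cofreeCounit_rTensor C f (M.coact m)).trans (congrArg f (M.counit m))

/-- A morphism of comodules to `X ⊗ C` is determined by its composite with the counit. -/
theorem cofreeLift_counit {M : Comod C} {X : Type u} [AddCommGroup X] [Module Aᵐᵒᵖ X]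
    (f : M ⟶ cofree C X) : cofreeLift (cofreeCounit C X ∘ₗ f.toLin) = f := by
  apply hom_ext
  ext m
  refine (rTensor_comp_apply f.toLin (cofreeCounit C X) (M.coact m)).trans ?_
  refine (congrArg (rTensor C.carrier (cofreeCounit C X)) (f.coact_comm m)).trans ?_
  generalize f.toLin m = x
  change rTensor C.carrier (cofreeCounit C X) (cofreeCoact C X x) = x
  induction (x : BalTensor A X C.carrier) using induction_on with
  | zero => simp
  | tmul x c =>
    rw [cofreeCoact_tmul, ← rTensor_comp_apply]
    have h : ∀ d : BalTensor A C.carrier C.carrier,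
        rTensor C.carrier (cofreeCounit C X ∘ₗ cofreeMk C x) d = tmul A x (leftUnit (mapLeft
          C.carrier C.counit (fun c a => C.counit_op_smul (op a) c) d)) := by
      intro d
      induction d using induction_on with
      | zero => simp
      | tmul c d => exact smul_tmul (C.counit c) x d
      | add d d' h h' => simp only [map_add, tmul_add, h, h']
    rw [h, C.counit_comul]
  | add x y hx hy => simp only [map_add, hx, hy]

end Comod

/-! ### Modules over a ring that need not have a unit -/

namespace NUModule

variable {R : Type*} {M : Type*} [NonUnitalRing R] [AddCommGroup M]

theorem nu_smul_zero [NUModule R M] (r : R) : r • (0 : M) = 0 := map_zero (smulHom r)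

theorem nu_smul_neg [NUModule R M] (r : R) (m : M) : r • (-m) = -(r • m) := map_neg (smulHom r) m

theorem nu_smul_sum [NUModule R M] {κ : Type*} (s : Finset κ) (r : R) (m : κ → M) :
    r • ∑ k ∈ s, m k = ∑ k ∈ s, r • m k := map_sum (smulHom r) m s

/-- The additive map `r ↦ m r`. -/
def opSmulHom [NUModule Rᵐᵒᵖ M] (m : M) : R →+ M :=
  AddMonoidHom.mk' (fun r => op r • m) (fun r s => NUModule.add_smul (op r) (op s) m)

theorem opSmulHom_apply [NUModule Rᵐᵒᵖ M] (m : M) (r : R) : opSmulHom m r = op r • m := rfl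

theorem op_mul_smul [NUModule Rᵐᵒᵖ M] (m : M) (r s : R) : op (r * s) • m = op s • op r • m :=
  NUModule.mul_smul (op s) (op r) m

end NUModule

namespace UnitalRightMod

variable {R : Type u} [NonUnitalRing R]

/-- The quotient of a unital right module by a submodule. -/
def quot (Y : UnitalRightMod R) (K : AddSubgroup Y.carrier)
    (hK : ∀ (r : R), ∀ k ∈ K, op r • k ∈ K) : UnitalRightMod R :=
  letI : NUModule Rᵐᵒᵖ (Y.carrier ⧸ K) :=
    { smul := fun r => QuotientAddGroup.map K K (NUModule.smulHom r) (fun k hk => hK r.unop k hk)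
      smul_add := fun r => map_add (QuotientAddGroup.map K K (NUModule.smulHom r) _)
      add_smul := fun r s m => by
        obtain ⟨m, rfl⟩ := QuotientAddGroup.mk'_surjective K m
        exact congrArg (QuotientAddGroup.mk' K) (NUModule.add_smul r s m)
      mul_smul := fun r s m => by
        obtain ⟨m, rfl⟩ := QuotientAddGroup.mk'_surjective K m
        exact congrArg (QuotientAddGroup.mk' K) (NUModule.mul_smul r s m) }
  { carrier := Y.carrier ⧸ K
    unital := by
      rw [eq_top_iff]
      rintro x -
      obtain ⟨y, rfl⟩ := QuotientAddGroup.mk'_surjective K x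
      have hy : y ∈ AddSubgroup.closure {x : Y.carrier | ∃ (m : Y.carrier) (r : R), x = op r • m} :=
        Y.unital ▸ AddSubgroup.mem_top y
      induction hy using AddSubgroup.closure_induction with
      | mem x hx =>
        obtain ⟨m, r, rfl⟩ := hx
        exact AddSubgroup.subset_closure ⟨QuotientAddGroup.mk' K m, r, rfl⟩
      | zero => rw [map_zero]; exact zero_mem _
      | add x y _ _ hx hy => rw [map_add]; exact add_mem hx hy
      | neg x _ hx => rw [map_neg]; exact neg_mem hx }

/-- The projection to a quotient module. -/
def quotHom (Y : UnitalRightMod R) (K : AddSubgroup Y.carrier)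
    (hK : ∀ (r : R), ∀ k ∈ K, op r • k ∈ K) : Y ⟶ quot Y K hK where
  toAddHom := QuotientAddGroup.mk' K
  map_smul _ _ := rfl

instance {X Y : UnitalRightMod R} : Zero (X ⟶ Y) :=
  ⟨⟨0, fun _ r => (NUModule.nu_smul_zero (op r)).symm⟩⟩

theorem surjective_of_epi {X Y : UnitalRightMod R} (f : X ⟶ Y) [Epi f] :
    Function.Surjective f.toAddHom := by
  have hK : ∀ (r : R), ∀ k ∈ f.toAddHom.range, op r • k ∈ f.toAddHom.range := by
    rintro r _ ⟨x, rfl⟩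
    exact ⟨op r • x, f.map_smul x r⟩
  have h : quotHom Y f.toAddHom.range hK = 0 := by
    rw [← cancel_epi f]
    apply hom_ext
    ext x
    exact (QuotientAddGroup.eq_zero_iff _).2 ⟨x, rfl⟩
  intro y
  exact (QuotientAddGroup.eq_zero_iff _).1 (DFunLike.congr_fun (congrArg Hom.toAddHom h) y)

theorem mono_of_injective {X Y : UnitalRightMod R} (f : X ⟶ Y)
    (hf : Function.Injective f.toAddHom) : Mono f where
  right_cancellation _ _ e := hom_ext (AddMonoidHom.ext fun n =>
    hf (DFunLike.congr_fun (congrArg Hom.toAddHom e) n))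

theorem isIso_of_bijective {X Y : UnitalRightMod R} (f : X ⟶ Y)
    (hf : Function.Bijective f.toAddHom) : IsIso f := by
  let e := AddEquiv.ofBijective f.toAddHom hf
  refine ⟨⟨e.symm.toAddMonoidHom, fun m r => e.injective ?_⟩,
    hom_ext (AddMonoidHom.ext e.symm_apply_apply), hom_ext (AddMonoidHom.ext e.apply_symm_apply)⟩
  refine (e.apply_symm_apply _).trans ((congrArg (op r • ·) (e.apply_symm_apply m)).symm.trans ?_)
  exact (f.map_smul _ r).symm

/-- If every element is fixed by an element of the ring, the module is unital. -/
theorem unital_of_exists_smul_eq {M : Type*} [AddCommGroup M] [NUModule Rᵐᵒᵖ M]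
    (h : ∀ m : M, ∃ r : R, op r • m = m) :
    AddSubgroup.closure {x : M | ∃ (m : M) (r : R), x = op r • m} = ⊤ := by
  rw [eq_top_iff]
  rintro x -
  obtain ⟨r, hr⟩ := h x
  exact AddSubgroup.subset_closure ⟨x, r, hr.symm⟩

end UnitalRightMod

/-! ### Local units -/

section LocalUnits

variable {ι : Type u} [DecidableEq ι] (P : ι → Comod C)

theorem sig_hom_ext {N : Type*} [AddCommGroup N] [Module Aᵐᵒᵖ N] {f g : Sig P →ₗ[Aᵐᵒᵖ] N}
    (h : ∀ i p, f (inc P i p) = g (inc P i p)) : f = g :=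
  LinearMap.ext fun x => by
    induction x using sig_induction with
    | zero => simp
    | inc i y => exact h i y
    | add x y hx hy => rw [map_add, map_add, hx, hy]

/-- The idempotent of `R` that is the identity on the summands `P i`, `i ∈ s`, and zero on the
other summands. -/
def idemR (s : Finset ι) : ringR P := ∑ i ∈ s, singleR (𝟙 (P i))

theorem singleR_apply_inc {i j : ι} (g : P i ⟶ P j) (k : ι) (p : (P k).carrier) :
    (singleR g).1 (inc P k p) = if h : k = i then inc P j (g.toLin (h ▸ p)) else 0 := by
  split_ifs with h
  · subst h
    exact single_inc_self P g.toLin p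
  · exact LinearMap.congr_fun (single_comp_inc_ne P h g.toLin) p

theorem idemR_apply_inc (s : Finset ι) (i : ι) (p : (P i).carrier) :
    (idemR P s).1 (inc P i p) = if i ∈ s then inc P i p else 0 := by
  have h : (idemR P s).1 (inc P i p) = ∑ j ∈ s, if i = j then inc P i p else 0 := by
    rw [idemR, AddSubmonoidClass.coe_finsetSum, LinearMap.sum_apply]
    refine Finset.sum_congr rfl fun j _ => ?_
    rw [singleR_apply_inc]
    split_ifs with h
    · subst h; rfl
    · rfl
  rw [h, Finset.sum_ite_eq]

theorem exists_idemR_apply_eq (x : Sig P) :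
    ∃ s : Finset ι, ∀ t, s ⊆ t → (idemR P t).1 x = x := by
  induction x using sig_induction with
  | zero => exact ⟨∅, fun t _ => map_zero _⟩
  | inc i y =>
    exact ⟨{i}, fun t ht => by rw [idemR_apply_inc, if_pos (ht (Finset.mem_singleton_self i))]⟩
  | add x y hx hy =>
    obtain ⟨s, hs⟩ := hx
    obtain ⟨s', hs'⟩ := hy
    exact ⟨s ∪ s', fun t ht => by
      rw [map_add, hs t (Finset.union_subset_left ht), hs' t (Finset.union_subset_right ht)]⟩

/-- `R` has local units. -/
theorem exists_idemR_mul_eq (r : ringR P) :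
    ∃ s : Finset ι, ∀ t, s ⊆ t → idemR P t * r = r ∧ r * idemR P t = r := by
  suffices h : ∃ s : Finset ι, ∀ t, s ⊆ t →
      (idemR P t).1 * r.1 = r.1 ∧ r.1 * (idemR P t).1 = r.1 by
    obtain ⟨s, hs⟩ := h
    exact ⟨s, fun t ht => ⟨Subtype.ext (hs t ht).1, Subtype.ext (hs t ht).2⟩⟩
  refine ringR_induction P (p := fun r => ∃ s : Finset ι, ∀ t, s ⊆ t →
      (idemR P t).1 * r = r ∧ r * (idemR P t).1 = r) r (fun i j g => ?_) ?_ ?_ ?_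
  · refine ⟨{i, j}, fun t ht => ⟨sig_hom_ext P fun k p => ?_, sig_hom_ext P fun k p => ?_⟩⟩
    · change (idemR P t).1 ((singleR g).1 (inc P k p)) = (singleR g).1 (inc P k p)
      rw [singleR_apply_inc]
      split_ifs with h
      · rw [idemR_apply_inc, if_pos (ht (by simp))]
      · exact map_zero _
    · change (singleR g).1 ((idemR P t).1 (inc P k p)) = (singleR g).1 (inc P k p)
      rw [idemR_apply_inc]
      split_ifs with h
      · rfl
      · rw [singleR_apply_inc, dif_neg, map_zero]
        rintro rfl
        exact h (ht (by simp))
  · exact ⟨∅, fun t _ => ⟨mul_zero _, zero_mul _⟩⟩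
  · rintro x y ⟨s, hs⟩ ⟨s', hs'⟩
    refine ⟨s ∪ s', fun t ht => ?_⟩
    have h := hs t (Finset.union_subset_left ht)
    have h' := hs' t (Finset.union_subset_right ht)
    rw [mul_add, add_mul, h.1, h.2, h'.1, h'.2]
    exact ⟨rfl, rfl⟩
  · rintro x ⟨s, hs⟩
    refine ⟨s, fun t ht => ?_⟩
    rw [mul_neg, neg_mul, (hs t ht).1, (hs t ht).2]
    exact ⟨rfl, rfl⟩

variable {P} in
theorem UnitalRightMod.exists_idemR_smul_eq (Y : UnitalRightMod (ringR P)) (y : Y.carrier) :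
    ∃ s : Finset ι, ∀ t, s ⊆ t → op (idemR P t) • y = y := by
  have hy : y ∈ AddSubgroup.closure
      {x : Y.carrier | ∃ (m : Y.carrier) (r : ringR P), x = op r • m} :=
    Y.unital ▸ AddSubgroup.mem_top y
  induction hy using AddSubgroup.closure_induction with
  | mem x hx =>
    obtain ⟨m, r, rfl⟩ := hx
    obtain ⟨s, hs⟩ := exists_idemR_mul_eq P r
    exact ⟨s, fun t ht => by rw [← NUModule.op_mul_smul, (hs t ht).2]⟩
  | zero => exact ⟨∅, fun t _ => NUModule.nu_smul_zero _⟩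
  | add x y _ _ hx hy =>
    obtain ⟨s, hs⟩ := hx
    obtain ⟨s', hs'⟩ := hy
    exact ⟨s ∪ s', fun t ht => by
      rw [NUModule.smul_add, hs t (Finset.union_subset_left ht),
        hs' t (Finset.union_subset_right ht)]⟩
  | neg x _ hx =>
    obtain ⟨s, hs⟩ := hx
    exact ⟨s, fun t ht => by rw [NUModule.nu_smul_neg, hs t ht]⟩

variable {P} in
/-- An element of a unital module vanishes if all its products with the idempotents of the
`P i` do. -/
theorem UnitalRightMod.eq_zero_of_singleR_smul (Y : UnitalRightMod (ringR P)) (y : Y.carrier)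
    (h : ∀ i, op (singleR (𝟙 (P i))) • y = 0) : y = 0 := by
  obtain ⟨s, hs⟩ := Y.exists_idemR_smul_eq y
  rw [← hs s subset_rfl, ← NUModule.opSmulHom_apply, idemR, map_sum]
  exact Finset.sum_eq_zero fun i _ => h i

variable {P} in
/-- A submodule of a unital right `R`-module; it is unital because `R` has local units. -/
def UnitalRightMod.sub (Y : UnitalRightMod (ringR P)) (K : AddSubgroup Y.carrier)
    (hK : ∀ (r : ringR P), ∀ k ∈ K, op r • k ∈ K) : UnitalRightMod (ringR P) :=
  letI : NUModule (ringR P)ᵐᵒᵖ K :=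
    { smul := fun r k => ⟨r • k.1, hK r.unop k.1 k.2⟩
      smul_add := fun r k l => Subtype.ext (NUModule.smul_add r k.1 l.1)
      add_smul := fun r s k => Subtype.ext (NUModule.add_smul r s k.1)
      mul_smul := fun r s k => Subtype.ext (NUModule.mul_smul r s k.1) }
  { carrier := K
    unital := unital_of_exists_smul_eq fun k => by
      obtain ⟨s, hs⟩ := Y.exists_idemR_smul_eq k.1
      exact ⟨idemR P s, Subtype.ext (hs s subset_rfl)⟩ }

variable {P} in
/-- The inclusion of a submodule. -/
def UnitalRightMod.subHom (Y : UnitalRightMod (ringR P)) (K : AddSubgroup Y.carrier)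
    (hK : ∀ (r : ringR P), ∀ k ∈ K, op r • k ∈ K) : Y.sub K hK ⟶ Y where
  toAddHom := K.subtype
  map_smul _ _ := rfl

variable {P} in
theorem UnitalRightMod.injective_of_mono {X Y : UnitalRightMod (ringR P)} (f : X ⟶ Y)
    [Mono f] : Function.Injective f.toAddHom := by
  have hK : ∀ (r : ringR P), ∀ k ∈ f.toAddHom.ker, op r • k ∈ f.toAddHom.ker := by
    intro r k hk
    rw [AddMonoidHom.mem_ker] at hk ⊢
    rw [f.map_smul, hk, NUModule.nu_smul_zero]
  have h : X.subHom f.toAddHom.ker hK = 0 := by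
    rw [← cancel_mono f]
    apply hom_ext
    ext x
    exact x.2.trans (map_zero f.toAddHom).symm
  rw [injective_iff_map_eq_zero]
  intro k hk
  exact DFunLike.congr_fun (congrArg Hom.toAddHom h) ⟨k, hk⟩

end LocalUnits

/-! ### The right adjoint of `- ⊗_R Σ` -/

section Adjoint

variable {ι : Type u} [DecidableEq ι] (P : ι → Comod C)

/-- The right `R`-module `⨁ Hom_A(P, X)`, realized as the group of linear maps `Σ → X` that
vanish on almost all `P i`. -/
def sigHom (X : Type u) [AddCommGroup X] [Module Aᵐᵒᵖ X] : AddSubgroup (Sig P →ₗ[Aᵐᵒᵖ] X) where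
  carrier := {f | ∃ s : Finset ι, ∀ t, s ⊆ t → f ∘ₗ (idemR P t).1 = f}
  zero_mem' := ⟨∅, fun _ _ => LinearMap.zero_comp _⟩
  add_mem' := by
    rintro f g ⟨s, hs⟩ ⟨s', hs'⟩
    exact ⟨s ∪ s', fun t ht => by
      rw [LinearMap.add_comp, hs t (Finset.union_subset_left ht),
        hs' t (Finset.union_subset_right ht)]⟩
  neg_mem' := by
    rintro f ⟨s, hs⟩
    exact ⟨s, fun t ht => by rw [LinearMap.neg_comp, hs t ht]⟩

variable {P} in
theorem comp_mem_sigHom {X : Type u} [AddCommGroup X] [Module Aᵐᵒᵖ X] (f : Sig P →ₗ[Aᵐᵒᵖ] X)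
    (r : ringR P) : f ∘ₗ r.1 ∈ sigHom P X := by
  obtain ⟨s, hs⟩ := exists_idemR_mul_eq P r
  exact ⟨s, fun t ht => by
    rw [LinearMap.comp_assoc]
    exact congrArg (fun r : ringR P => f ∘ₗ r.1) (hs t ht).2⟩

instance (X : Type u) [AddCommGroup X] [Module Aᵐᵒᵖ X] : NUModule (ringR P)ᵐᵒᵖ (sigHom P X) where
  smul r f := ⟨f.1 ∘ₗ r.unop.1, comp_mem_sigHom f.1 r.unop⟩
  smul_add _ _ _ := Subtype.ext (LinearMap.add_comp _ _ _)
  add_smul _ _ _ := Subtype.ext (LinearMap.comp_add _ _ _)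
  mul_smul _ _ _ := rfl

/-- `⨁ Hom_A(P, X)` as an object of the category of unital right `R`-modules. -/
def sigHomMod (X : Type u) [AddCommGroup X] [Module Aᵐᵒᵖ X] : UnitalRightMod (ringR P) where
  carrier := sigHom P X
  unital := UnitalRightMod.unital_of_exists_smul_eq fun f => by
    obtain ⟨s, hs⟩ := f.2
    exact ⟨idemR P s, Subtype.ext (hs s subset_rfl)⟩

/-- Postcomposition with a linear map. -/
def sigHomMap {X Y : Type u} [AddCommGroup X] [Module Aᵐᵒᵖ X] [AddCommGroup Y] [Module Aᵐᵒᵖ Y]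
    (g : X →ₗ[Aᵐᵒᵖ] Y) : sigHomMod P X ⟶ sigHomMod P Y where
  toAddHom := AddMonoidHom.mk' (fun f : sigHom P X => (⟨g ∘ₗ f.1, by
      obtain ⟨s, hs⟩ := f.2
      exact ⟨s, fun t ht => by rw [LinearMap.comp_assoc, hs t ht]⟩⟩ : sigHom P Y))
    (fun _ _ => Subtype.ext (LinearMap.comp_add _ _ _))
  map_smul _ _ := rfl

/-- The right `R`-module `⨁ Hom_C(P, M)` of the comodule morphisms `Σ → M` that vanish on
almost all `P i`. -/
def homSigmaObj (M : Comod C) : UnitalRightMod (ringR P) :=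
  (sigHomMod P M.carrier).sub
    { carrier := {f : sigHom P M.carrier |
        ∀ x, rTensor C.carrier f.1 (sigCoact P x) = M.coact (f.1 x)}
      zero_mem' := fun x => by
        change rTensor C.carrier (0 : Sig P →ₗ[Aᵐᵒᵖ] M.carrier) _ = M.coact 0
        simp [rTensor_zero]
      add_mem' := fun {f g} hf hg x => by
        change rTensor C.carrier (f.1 + g.1) _ = M.coact (f.1 x + g.1 x)
        rw [rTensor_add, map_add, ← hf, ← hg]; rfl
      neg_mem' := fun {f} hf x => by
        change rTensor C.carrier (-f.1) _ = M.coact (-f.1 x)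
        rw [rTensor_neg, map_neg, ← hf]; rfl }
    (fun r f hf x => by
      change rTensor C.carrier (f.1 ∘ₗ smulLin (Sig P) r) (sigCoact P x) = M.coact (f.1 (r • x))
      rw [rTensor_comp_apply, ← sigCoact_smul]
      exact hf _)

variable {P}

namespace homSigmaObj

/-- An element of `⨁ Hom_C(P, M)` as a linear map. -/
def lin {M : Comod C} (f : (homSigmaObj P M).carrier) : Sig P →ₗ[Aᵐᵒᵖ] M.carrier := f.1.1

theorem lin_injective {M : Comod C} : Function.Injective (lin (P := P) (M := M)) :=
  fun _ _ h => Subtype.ext (Subtype.ext h)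

theorem coact_comm {M : Comod C} (f : (homSigmaObj P M).carrier) (x : Sig P) :
    rTensor C.carrier (lin f) (sigCoact P x) = M.coact (lin f x) := f.2 x

/-- An element of `⨁ Hom_C(P, M)` from its underlying linear map. -/
def mk {M : Comod C} (f : Sig P →ₗ[Aᵐᵒᵖ] M.carrier) (hf : f ∈ sigHom P M.carrier)
    (h : ∀ x, rTensor C.carrier f (sigCoact P x) = M.coact (f x)) : (homSigmaObj P M).carrier :=
  ⟨⟨f, hf⟩, h⟩

/-- An element of `⨁ Hom_C(P, M)` as a morphism of comodules. -/
def hom {M : Comod C} (f : (homSigmaObj P M).carrier) : sigmaComod P ⟶ M where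
  toLin := lin f
  coact_comm := coact_comm f

end homSigmaObj

variable (P)

open homSigmaObj

/-- The functor `M ↦ ⨁ Hom_C(P, M)`. -/
def homSigma : Comod C ⥤ UnitalRightMod (ringR P) where
  obj := homSigmaObj P
  map {M N} g :=
    { toAddHom := AddMonoidHom.mk' (fun f : (homSigmaObj P M).carrier => homSigmaObj.mk
          (g.toLin ∘ₗ lin f) ((sigHomMap P g.toLin).toAddHom f.1).2 (fun x => by
            rw [rTensor_comp_apply, coact_comm, g.coact_comm]; rfl))
        (fun _ _ => lin_injective (LinearMap.comp_add _ _ _))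
      map_smul := fun _ _ => rfl }
  map_id _ := rfl
  map_comp _ _ := rfl

/-- The unit `Y → ⨁ Hom_C(P, Y ⊗_R Σ)`, `y ↦ (x ↦ y ⊗ x)`. -/
def unitHom (Y : UnitalRightMod (ringR P)) : Y ⟶ (homSigma P).obj ((tensorSigma P).obj Y) where
  toAddHom := AddMonoidHom.mk' (fun y => homSigmaObj.mk (M := (tensorSigma P).obj Y)
      (tmulLin (ringR P) (Sig P) y) (by
        obtain ⟨s, hs⟩ := Y.exists_idemR_smul_eq y
        refine ⟨s, fun t ht => LinearMap.ext fun x => ?_⟩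
        change tmul (ringR P) y (idemR P t • x) = tmul (ringR P) y x
        rw [← smul_tmul, hs t ht]) (fun _ => rfl))
    (fun y y' => lin_injective (LinearMap.ext fun x => add_tmul y y' x))
  map_smul y r := lin_injective (LinearMap.ext fun x => smul_tmul r y x)

/-- The evaluation `(⨁ Hom_C(P, M)) ⊗_R Σ → M` as an additive map. -/
def evalHom (M : Comod C) : BalTensor (ringR P) (homSigmaObj P M).carrier (Sig P) →+ M.carrier :=
  lift (AddMonoidHom.mk' (fun f => (lin f).toAddMonoidHom) (fun _ _ => rfl)) (fun _ _ _ => rfl)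

/-- The evaluation `(⨁ Hom_C(P, M)) ⊗_R Σ → M` as a linear map. -/
def evalLin (M : Comod C) :
    BalTensor (ringR P) (homSigmaObj P M).carrier (Sig P) →ₗ[Aᵐᵒᵖ] M.carrier where
  toFun := evalHom P M
  map_add' := map_add _
  map_smul' a x := by
    induction x using induction_on with
    | zero => simp
    | tmul f x => exact (lin f).map_smul a x
    | add x y hx hy => rw [smul_add, map_add, hx, hy, map_add, smul_add]

theorem rTensor_evalLin (M : Comod C)
    (x : BalTensor (ringR P) (homSigmaObj P M).carrier (Sig P)) :
    rTensor C.carrier (evalLin P M)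
      (tensorCoact (homSigmaObj P M).carrier (sigCoact P) (sigCoact_smul P) x) =
      M.coact (evalLin P M x) := by
  induction x using induction_on with
  | zero => simp
  | tmul f x =>
    rw [tensorCoact_tmul, ← rTensor_comp_apply]
    exact coact_comm f x
  | add x y hx hy => simp only [map_add, hx, hy]

/-- The counit `(⨁ Hom_C(P, M)) ⊗_R Σ → M`. -/
def counitHom (M : Comod C) : (tensorSigma P).obj ((homSigma P).obj M) ⟶ M where
  toLin := evalLin P M
  coact_comm := rTensor_evalLin P M

/-- The functor `- ⊗_R Σ` is left adjoint to `M ↦ ⨁ Hom_C(P, M)`. -/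
def tensorHomAdjunction : tensorSigma P ⊣ homSigma P :=
  Adjunction.mkOfUnitCounit
    { unit := { app := unitHom P
                naturality := fun _ _ _ => rfl }
      counit := { app := counitHom P
                  naturality := fun M N g => Comod.hom_ext (LinearMap.ext fun x => by
                    exact DFunLike.congr_fun (BalTensor.hom_ext
                      (f := (evalHom P N).comp (mapLeft (Sig P) ((homSigma P).map g).toAddHom
                        ((homSigma P).map g).map_smul))
                      (g := g.toLin.toAddMonoidHom.comp (evalHom P M)) fun _ _ => rfl) x) }
      left_triangle := by
        apply NatTrans.ext
        funext Y
        refine Comod.hom_ext (LinearMap.ext fun x => ?_)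
        exact DFunLike.congr_fun (BalTensor.hom_ext
          (f := (evalHom P _).comp (mapLeft (Sig P) (unitHom P Y).toAddHom
            (unitHom P Y).map_smul)) (g := AddMonoidHom.id _) fun _ _ => rfl) x
      right_triangle := rfl }

/-- If `- ⊗_R Σ` is faithful and the evaluations `(⨁ Hom_C(P, M)) ⊗_R Σ → M` are bijective,
then `- ⊗_R Σ` is an equivalence: it turns the unit of the adjunction into isomorphisms, and
faithful functors reflect monomorphisms and epimorphisms. -/
theorem isEquivalence_of_faithful [(tensorSigma P).Faithful]
    (h : ∀ M : Comod C, Function.Bijective (evalHom P M)) : (tensorSigma P).IsEquivalence := by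
  have h1 : ∀ M, IsIso ((tensorHomAdjunction P).counit.app M) := fun M =>
    Comod.isIso_of_bijective (counitHom P M) (h M)
  have h2 : ∀ Y, IsIso ((tensorHomAdjunction P).unit.app Y) := fun Y => by
    have h3 : IsIso ((tensorSigma P).map ((tensorHomAdjunction P).unit.app Y)) := by
      have h4 := (tensorHomAdjunction P).left_triangle_components Y
      have := h1 ((tensorSigma P).obj Y)
      exact IsIso.of_isIso_fac_right h4
    have hm : Mono ((tensorHomAdjunction P).unit.app Y) :=
      (tensorSigma P).mono_of_mono_map inferInstance
    have he : Epi ((tensorHomAdjunction P).unit.app Y) :=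
      (tensorSigma P).epi_of_epi_map inferInstance
    exact UnitalRightMod.isIso_of_bijective _ ⟨UnitalRightMod.injective_of_mono _,
      UnitalRightMod.surjective_of_epi _⟩
  have : IsIso (tensorHomAdjunction P).counit := NatIso.isIso_of_isIso_app _
  have : IsIso (tensorHomAdjunction P).unit := NatIso.isIso_of_isIso_app _
  exact (tensorHomAdjunction P).toEquivalence.isEquivalence_functor

theorem evalHom_bijective [(tensorSigma P).IsEquivalence] (M : Comod C) :
    Function.Bijective (evalHom P M) := by
  have : IsIso ((tensorHomAdjunction P).counit.app M) := inferInstance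
  exact Comod.bijective_of_isIso ((tensorHomAdjunction P).counit.app M)

end Adjoint

/-! ### The canonical map and the modules `X ⊗_A C` -/

section Canonical

variable {ι : Type u} [DecidableEq ι] (P : ι → Comod C)

/-- The linear map `A → X`, `a ↦ x a`. -/
def mulLin {X : Type u} [AddCommGroup X] [Module Aᵐᵒᵖ X] (x : X) : A →ₗ[Aᵐᵒᵖ] X where
  toFun a := op a • x
  map_add' a b := by rw [MulOpposite.op_add, add_smul]
  map_smul' a b := by
    rw [RingHom.id_apply, ← mul_smul]
    rfl

theorem mulLin_apply {X : Type u} [AddCommGroup X] [Module Aᵐᵒᵖ X] (x : X) (a : A) :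
    mulLin x a = op a • x := rfl

theorem mulLin_add {X : Type u} [AddCommGroup X] [Module Aᵐᵒᵖ X] (x y : X) :
    mulLin (x + y) = (mulLin x + mulLin y : A →ₗ[Aᵐᵒᵖ] X) :=
  LinearMap.ext fun a => smul_add (op a) x y

theorem rTensor_mulLin {X N : Type u} [AddCommGroup X] [Module Aᵐᵒᵖ X] [AddCommGroup N]
    [Module A N] (x : X) (z : BalTensor A A N) :
    rTensor N (mulLin x) z = tmul A x (leftUnit z) := by
  induction z using induction_on with
  | zero => simp
  | tmul a n => rw [rTensor_tmul, leftUnit_tmul, mulLin_apply, smul_tmul]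
  | add z z' h h' => rw [map_add, map_add, tmul_add, h, h']

variable {P} in
theorem exists_comp_idemR_eq (φ : SigDag P) :
    ∃ s : Finset ι, ∀ t, s ⊆ t → φ.1 ∘ₗ (idemR P t).1 = φ.1 := by
  obtain ⟨φ, hφ⟩ := φ
  change ∃ s : Finset ι, ∀ t, s ⊆ t → φ ∘ₗ (idemR P t).1 = φ
  induction hφ using Submodule.span_induction with
  | mem f hf =>
    obtain ⟨i, φ, rfl⟩ := hf
    refine ⟨{i}, fun t ht => sig_hom_ext P fun k p => ?_⟩
    rw [LinearMap.comp_apply, idemR_apply_inc]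
    split_ifs with h
    · rfl
    · rw [map_zero, LinearMap.comp_apply]
      have : proj P i (inc P k p) = 0 := LinearMap.congr_fun (proj_inc_ne P (fun hk => h
        (ht (Finset.mem_singleton.2 hk)))) p
      rw [this, map_zero]
  | zero => exact ⟨∅, fun t _ => LinearMap.zero_comp _⟩
  | add f g _ _ hf hg =>
    obtain ⟨s, hs⟩ := hf
    obtain ⟨s', hs'⟩ := hg
    exact ⟨s ∪ s', fun t ht => by
      rw [LinearMap.add_comp, hs t (Finset.union_subset_left ht),
        hs' t (Finset.union_subset_right ht)]⟩
  | smul a f _ hf =>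
    obtain ⟨s, hs⟩ := hf
    exact ⟨s, fun t ht => by rw [LinearMap.smul_comp, hs t ht]⟩

/-- For `x : X`, the map `Σ† → ⨁ Hom_A(P, X)`, `φ ↦ x φ(-)`. -/
def dagMul {X : Type u} [AddCommGroup X] [Module Aᵐᵒᵖ X] (x : X) :
    SigDag P →+ (sigHomMod P X).carrier :=
  AddMonoidHom.mk' (fun φ => (⟨mulLin x ∘ₗ φ.1, by
      obtain ⟨s, hs⟩ := exists_comp_idemR_eq φ
      exact ⟨s, fun t ht => by rw [LinearMap.comp_assoc, hs t ht]⟩⟩ : sigHom P X))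
    (fun _ _ => Subtype.ext (LinearMap.comp_add _ _ _))

/-- The map `X ⊗_A (Σ† ⊗_R Σ) → (⨁ Hom_A(P, X)) ⊗_R Σ`. -/
def ofComatrix (X : Type u) [AddCommGroup X] [Module Aᵐᵒᵖ X] :
    BalTensor A X (Comatrix P) →+ BalTensor (ringR P) (sigHomMod P X).carrier (Sig P) :=
  lift (AddMonoidHom.mk' (fun x => mapLeft (Sig P) (dagMul P x) (fun _ _ => rfl))
      (fun x x' => BalTensor.hom_ext fun φ y => by
        change tmul (ringR P) (dagMul P (x + x') φ) y =
          tmul (ringR P) (dagMul P x φ) y + tmul (ringR P) (dagMul P x' φ) y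
        rw [← add_tmul]
        refine congrArg (tmul (ringR P) · y) (Subtype.ext ?_)
        exact (congrArg (· ∘ₗ φ.1) (mulLin_add x x')).trans (LinearMap.add_comp _ _ _)))
    (fun x a d => by
      refine DFunLike.congr_fun (BalTensor.hom_ext
        (f := mapLeft (Sig P) (dagMul P (op a • x)) (fun _ _ => rfl))
        (g := (mapLeft (Sig P) (dagMul P x) (fun _ _ => rfl)).comp
          (DistribSMul.toAddMonoidHom (Comatrix P) a)) fun φ y => ?_) d
      refine congrArg (tmul (ringR P) · y) (Subtype.ext (LinearMap.ext fun z => ?_))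
      change op (φ.1 z) • op a • x = op (a • φ.1 z) • x
      rw [smul_eq_mul, op_mul, mul_smul])

theorem ofComatrix_tmul {X : Type u} [AddCommGroup X] [Module Aᵐᵒᵖ X] (x : X) (φ : SigDag P)
    (y : Sig P) :
    ofComatrix P X (tmul A x (Comatrix.mk P φ y)) = tmul (ringR P) (dagMul P x φ) y := rfl

variable {P} in
/-- For comodules that are finitely generated projective over `A`, every element of
`Hom_A(P, X)` is a finite sum of maps `x φ(-)`. -/
theorem ofComatrix_surjective (h : FGProjective P) (X : Type u) [AddCommGroup X]
    [Module Aᵐᵒᵖ X] : Function.Surjective (ofComatrix P X) := by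
  intro w
  induction w using induction_on with
  | zero => exact ⟨0, map_zero _⟩
  | add x y hx hy =>
    obtain ⟨x, rfl⟩ := hx
    obtain ⟨y, rfl⟩ := hy
    exact ⟨x + y, map_add _ _ _⟩
  | tmul f y =>
    induction y using sig_induction with
    | zero => exact ⟨0, by rw [map_zero, tmul_zero]⟩
    | add x y hx hy =>
      obtain ⟨x, hx⟩ := hx
      obtain ⟨y, hy⟩ := hy
      exact ⟨x + y, by rw [map_add, hx, hy, tmul_add]⟩
    | inc i p =>
      refine ⟨∑ k, tmul A (f.1 (inc P i (db h i k)))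
        (Comatrix.mk P (incDag P i (db' h i k)) (inc P i p)), ?_⟩
      rw [map_sum]
      simp only [ofComatrix_tmul]
      have h1 : op (singleR (𝟙 (P i))) • f =
          ∑ k, dagMul P (f.1 (inc P i (db h i k))) (incDag P i (db' h i k)) := by
        apply Subtype.ext
        refine Eq.trans (b := f.1 ∘ₗ (singleR (𝟙 (P i))).1) rfl ?_
        refine Eq.trans ?_ (AddSubgroup.val_finsetSum (ι := Fin (dbCard h i))
          (G := Sig P →ₗ[Aᵐᵒᵖ] X) (H := sigHom P X) _ _).symm
        refine LinearMap.ext fun z => ?_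
        rw [LinearMap.sum_apply]
        change f.1 (inc P i (proj P i z)) =
          ∑ k, op (db' h i k (proj P i z)) • f.1 (inc P i (db h i k))
        conv_lhs => rw [← db_spec h i (proj P i z), map_sum, map_sum]
        simp only [map_smul]
      rw [← sum_tmul, ← h1, smul_tmul]
      exact congrArg _ (singleR_smul_inc (𝟙 (P i)) p)

/-- The map `(⨁ Hom_A(P, X)) ⊗_R Σ → X ⊗_A C`, `f ⊗ x ↦ (f ⊗ C)(ρ(x))`, which generalizes
`can`. -/
def toCofree (X : Type u) [AddCommGroup X] [Module Aᵐᵒᵖ X] :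
    BalTensor (ringR P) (sigHomMod P X).carrier (Sig P) →+ BalTensor A X C.carrier :=
  lift (AddMonoidHom.mk' (fun f : sigHom P X =>
      (rTensor C.carrier f.1).comp (sigCoact P).toAddMonoidHom)
    (fun f g => by
      ext x
      change rTensor C.carrier (f.1 + g.1) _ = _
      rw [rTensor_add]; rfl))
    (fun f r x => by
      change rTensor C.carrier (f.1 ∘ₗ smulLin (Sig P) r) (sigCoact P x) =
        rTensor C.carrier f.1 (sigCoact P (r • x))
      rw [rTensor_comp_apply, ← sigCoact_smul])

theorem toCofree_tmul {X : Type u} [AddCommGroup X] [Module Aᵐᵒᵖ X]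
    (f : (sigHomMod P X).carrier) (x : Sig P) :
    toCofree P X (tmul (ringR P) f x) = rTensor C.carrier f.1 (sigCoact P x) := rfl

theorem can_mk (φ : SigDag P) (x : Sig P) :
    can P (Comatrix.mk P φ x) = leftUnit (rTensor C.carrier φ.1 (sigCoact P x)) := rfl

theorem leftUnit_rTensor_smul {M : Type u} [AddCommGroup M] [Module Aᵐᵒᵖ M] (a : A)
    (φ : M →ₗ[Aᵐᵒᵖ] A) (z : BalTensor A M C.carrier) :
    leftUnit (rTensor C.carrier (a • φ) z) = a • leftUnit (rTensor C.carrier φ z) := by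
  induction z using induction_on with
  | zero => simp
  | tmul m c => simp [mul_smul]
  | add x y hx hy => simp only [map_add, hx, hy, smul_add]

theorem leftUnit_op_smul (a : Aᵐᵒᵖ) (z : BalTensor A A C.carrier) :
    leftUnit (a • z) = a • leftUnit z := by
  induction z using induction_on with
  | zero => simp
  | tmul b c => simp [smul_comm b a c]
  | add x y hx hy => simp only [map_add, hx, hy, smul_add]

theorem can_smul (a : A) (d : Comatrix P) : can P (a • d) = a • can P d := by
  induction d using Comatrix.induction with
  | zero => simp
  | mk φ i y =>
    rw [← Comatrix.mk_smul, can_mk, can_mk, ← leftUnit_rTensor_smul]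
    rfl
  | add x y hx hy => simp only [smul_add, map_add, hx, hy]

theorem can_op_smul (a : Aᵐᵒᵖ) (d : Comatrix P) : can P (a • d) = a • can P d := by
  induction d using Comatrix.induction with
  | zero => simp
  | mk φ i y =>
    rw [← map_smul, can_mk, can_mk, map_smul, ← leftUnit_op_smul]
    exact congrArg leftUnit ((rTensorLin C.carrier φ.1).map_smul a _)
  | add x y hx hy => simp only [smul_add, map_add, hx, hy]

theorem toCofree_ofComatrix {X : Type u} [AddCommGroup X] [Module Aᵐᵒᵖ X]
    (z : BalTensor A X (Comatrix P)) :
    toCofree P X (ofComatrix P X z) = mapRight X (can P) (can_smul P) z := by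
  induction z using induction_on with
  | zero => simp
  | tmul x d =>
    induction d using Comatrix.induction with
    | zero => simp
    | mk φ i y =>
      rw [ofComatrix_tmul, toCofree_tmul, mapRight_tmul, can_mk, ← rTensor_mulLin,
        ← rTensor_comp_apply]
      rfl
    | add d d' h h' => simp only [tmul_add, map_add, h, h']
  | add z z' h h' => simp only [map_add, h, h']

variable {P} in
/-- If `can` is bijective then `(⨁ Hom_A(P, X)) ⊗_R Σ ≅ X ⊗_A C` for all `X`. -/
theorem toCofree_bijective (h : FGProjective P) (hcan : Function.Bijective (can P))
    (X : Type u) [AddCommGroup X] [Module Aᵐᵒᵖ X] : Function.Bijective (toCofree P X) := by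
  have h1 : Function.Bijective (toCofree P X ∘ ofComatrix P X) := by
    have : ⇑(toCofree P X) ∘ ⇑(ofComatrix P X) = mapRight X (can P) (can_smul P) :=
      funext (toCofree_ofComatrix P)
    rw [this]
    exact mapRight_bijective hcan
  refine ⟨?_, h1.2.of_comp⟩
  intro u v huv
  obtain ⟨u, rfl⟩ := ofComatrix_surjective h X u
  obtain ⟨v, rfl⟩ := ofComatrix_surjective h X v
  exact congrArg _ (h1.1 huv)

theorem toCofree_sigHomMap {X Y : Type u} [AddCommGroup X] [Module Aᵐᵒᵖ X] [AddCommGroup Y]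
    [Module Aᵐᵒᵖ Y] (g : X →ₗ[Aᵐᵒᵖ] Y)
    (w : BalTensor (ringR P) (sigHomMod P X).carrier (Sig P)) :
    toCofree P Y (UnitalRightMod.Hom.tensor (sigHomMap P g) (Sig P) w) =
      rTensor C.carrier g (toCofree P X w) := by
  refine DFunLike.congr_fun (BalTensor.hom_ext
    (f := (toCofree P Y).comp (UnitalRightMod.Hom.tensor (sigHomMap P g) (Sig P)))
    (g := (rTensor C.carrier g).comp (toCofree P X)) fun f x => ?_) w
  exact rTensor_comp_apply f.1 g _

end Canonical

/-! ### Descent along a faithfully flat module -/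

section Descent

variable {ι : Type u} [DecidableEq ι] {P : ι → Comod C}

/-- Tensoring with a flat module preserves exact sequences `K → X → Y`. -/
theorem UnitalRightMod.exists_tensor_eq {R : Type u} [NonUnitalRing R] {N : Type u}
    [AddCommGroup N] [NUModule R N]
    (hN : ∀ (X Y : UnitalRightMod R) (f : X ⟶ Y), Function.Injective f.toAddHom →
      Function.Injective (UnitalRightMod.Hom.tensor f N))
    {K X Y : UnitalRightMod R} (f : K ⟶ X) (g : X ⟶ Y)
    (hex : ∀ x, g.toAddHom x = 0 → ∃ k, f.toAddHom k = x) (w : BalTensor R X.carrier N)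
    (hw : UnitalRightMod.Hom.tensor g N w = 0) : ∃ v, UnitalRightMod.Hom.tensor f N v = w := by
  have hK : ∀ (r : R), ∀ k ∈ g.toAddHom.ker, op r • k ∈ g.toAddHom.ker := by
    intro r k hk
    rw [AddMonoidHom.mem_ker] at hk ⊢
    rw [g.map_smul, hk, NUModule.nu_smul_zero]
  let Q := X.quot g.toAddHom.ker hK
  let j : Q ⟶ Y :=
    { toAddHom := (QuotientAddGroup.kerLift g.toAddHom : X.carrier ⧸ g.toAddHom.ker →+ Y.carrier)
      map_smul := fun m r => by
        obtain ⟨m, rfl⟩ := QuotientAddGroup.mk'_surjective _ m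
        exact g.map_smul m r }
  have h0 : UnitalRightMod.Hom.tensor (X.quotHom g.toAddHom.ker hK) N w = 0 := by
    apply hN Q Y j (QuotientAddGroup.kerLift_injective _)
    rw [map_zero, ← hw]
    exact DFunLike.congr_fun (BalTensor.hom_ext (f := (UnitalRightMod.Hom.tensor j N).comp
      (UnitalRightMod.Hom.tensor (X.quotHom g.toAddHom.ker hK) N))
      (g := UnitalRightMod.Hom.tensor g N) fun _ _ => rfl) w
  exact exists_mapLeft_eq (g := (X.quotHom g.toAddHom.ker hK).toAddHom)
    (hg := (X.quotHom g.toAddHom.ker hK).map_smul) (QuotientAddGroup.mk'_surjective _)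
    (fun m hm => hex m ((QuotientAddGroup.eq_zero_iff _).1 hm)) w h0

/-- The inclusion of `⨁ Hom_C(P, M)` into `⨁ Hom_A(P, M)`. -/
def homSigmaIncl (P : ι → Comod C) (M : Comod C) : homSigmaObj P M ⟶ sigHomMod P M.carrier :=
  UnitalRightMod.subHom _ _ _

theorem comp_sigCoact_mem_sigHom {X : Type u} [AddCommGroup X] [Module Aᵐᵒᵖ X]
    (f : sigHom P X) :
    rTensorLin C.carrier f.1 ∘ₗ sigCoact P ∈ sigHom P (BalTensor A X C.carrier) := by
  obtain ⟨s, hs⟩ := f.2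
  refine ⟨s, fun t ht => LinearMap.ext fun x => ?_⟩
  change rTensor C.carrier f.1 (sigCoact P (idemR P t • x)) = rTensor C.carrier f.1 (sigCoact P x)
  rw [sigCoact_smul, ← rTensor_comp_apply]
  exact congrArg (fun g => rTensor C.carrier g (sigCoact P x)) (hs t ht)

/-- The map `⨁ Hom_A(P, X) → ⨁ Hom_A(P, X ⊗ C)`, `f ↦ (f ⊗ C) ρ`. -/
def sigHomCoact (P : ι → Comod C) (X : Type u) [AddCommGroup X] [Module Aᵐᵒᵖ X] :
    sigHomMod P X ⟶ sigHomMod P (BalTensor A X C.carrier) where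
  toAddHom := AddMonoidHom.mk' (fun f : sigHom P X =>
      (⟨_, comp_sigCoact_mem_sigHom f⟩ : sigHom P (BalTensor A X C.carrier)))
    (fun f g => Subtype.ext (LinearMap.ext fun x => by
      change rTensor C.carrier (f.1 + g.1) _ = rTensor C.carrier f.1 _ + rTensor C.carrier g.1 _
      rw [rTensor_add]; rfl))
  map_smul f r := Subtype.ext (LinearMap.ext fun x => by
    change rTensor C.carrier (f.1 ∘ₗ smulLin (Sig P) r) (sigCoact P x) =
      rTensor C.carrier f.1 (sigCoact P (r • x))
    rw [rTensor_comp_apply, ← sigCoact_smul])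

/-- The difference of the two maps `⨁ Hom_A(P, M) → ⨁ Hom_A(P, M ⊗ C)` whose equalizer is
`⨁ Hom_C(P, M)`. -/
def coactDiff (P : ι → Comod C) (M : Comod C) :
    sigHomMod P M.carrier ⟶ sigHomMod P (BalTensor A M.carrier C.carrier) where
  toAddHom := (sigHomMap P M.coact).toAddHom - (sigHomCoact P M.carrier).toAddHom
  map_smul f r := by
    rw [AddMonoidHom.sub_apply, AddMonoidHom.sub_apply, (sigHomMap P M.coact).map_smul,
      (sigHomCoact P M.carrier).map_smul]
    exact (map_sub (NUModule.smulHom (M := (sigHomMod P (BalTensor A M.carrier C.carrier)).carrier)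
      (op r)) _ _).symm

theorem tensor_coactDiff (M : Comod C)
    (w : BalTensor (ringR P) (sigHomMod P M.carrier).carrier (Sig P)) :
    UnitalRightMod.Hom.tensor (coactDiff P M) (Sig P) w =
      UnitalRightMod.Hom.tensor (sigHomMap P M.coact) (Sig P) w -
        UnitalRightMod.Hom.tensor (sigHomCoact P M.carrier) (Sig P) w := by
  refine DFunLike.congr_fun (BalTensor.hom_ext (f := UnitalRightMod.Hom.tensor (coactDiff P M)
    (Sig P)) (g := UnitalRightMod.Hom.tensor (sigHomMap P M.coact) (Sig P) -
        UnitalRightMod.Hom.tensor (sigHomCoact P M.carrier) (Sig P)) fun f x => ?_) w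
  exact sub_tmul _ _ x

theorem assoc_toCofree_sigHomCoact (X : Type u) [AddCommGroup X] [Module Aᵐᵒᵖ X]
    (w : BalTensor (ringR P) (sigHomMod P X).carrier (Sig P)) :
    assoc (toCofree P _ (UnitalRightMod.Hom.tensor (sigHomCoact P X) (Sig P) w)) =
      mapRight X C.comul C.comul_smul (toCofree P X w) := by
  induction w using induction_on with
  | zero => simp
  | tmul f x =>
    rw [toCofree_tmul, mapRight_rTensor]
    refine Eq.trans ?_ (congrArg (rTensor _ f.1) ((sigmaComod P).coassoc x))
    refine Eq.trans ?_ (assoc_rTensor_rTensorLin f.1 _)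
    exact congrArg assoc (rTensor_comp_apply (sigCoact P) (rTensorLin C.carrier f.1) _)
  | add x y hx hy => simp only [map_add, hx, hy]

theorem toCofree_homSigmaIncl (M : Comod C)
    (w : BalTensor (ringR P) (homSigmaObj P M).carrier (Sig P)) :
    toCofree P M.carrier (UnitalRightMod.Hom.tensor (homSigmaIncl P M) (Sig P) w) =
      M.coact (evalHom P M w) := by
  induction w using induction_on with
  | zero => simp
  | tmul f x => exact homSigmaObj.coact_comm f x
  | add x y hx hy => simp only [map_add, hx, hy]

/-- Flat descent: `(⨁ Hom_C(P, M)) ⊗_R Σ → M` is bijective, because tensoring with `Σ` keeps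
the equalizer that defines `⨁ Hom_C(P, M)` and turns it into `M ⇉ M ⊗ C`. -/
theorem evalHom_bijective_of_flat (h : FGProjective P) (hcan : Function.Bijective (can P))
    (hflat : ∀ (X Y : UnitalRightMod (ringR P)) (f : X ⟶ Y), Function.Injective f.toAddHom →
      Function.Injective (UnitalRightMod.Hom.tensor f (Sig P))) (M : Comod C) :
    Function.Bijective (evalHom P M) := by
  have hi : Function.Injective (UnitalRightMod.Hom.tensor (homSigmaIncl P M) (Sig P)) :=
    hflat _ _ _ Subtype.val_injective
  constructor
  · rw [injective_iff_map_eq_zero]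
    intro w hw
    apply hi
    apply (toCofree_bijective h hcan _).1
    rw [toCofree_homSigmaIncl, hw, map_zero, map_zero, map_zero]
  · intro m
    obtain ⟨u, hu⟩ := (toCofree_bijective h hcan M.carrier).2 (M.coact m)
    have h0 : UnitalRightMod.Hom.tensor (coactDiff P M) (Sig P) u = 0 := by
      rw [tensor_coactDiff, sub_eq_zero]
      apply (toCofree_bijective h hcan _).1
      apply assoc_injective
      rw [assoc_toCofree_sigHomCoact, toCofree_sigHomMap, hu, M.coassoc]
    obtain ⟨w, rfl⟩ := UnitalRightMod.exists_tensor_eq hflat (homSigmaIncl P M) (coactDiff P M)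
      (fun f hf => ⟨⟨f, fun x => (LinearMap.congr_fun (congrArg Subtype.val
        (sub_eq_zero.1 hf)) x).symm⟩, rfl⟩) u h0
    exact ⟨w, M.coact_injective (by rw [← toCofree_homSigmaIncl, hu])⟩

/-- If `Σ` is flat over `R` and `can` is bijective, then `C` is flat over `A`. -/
theorem isFlat_of_flat (h : FGProjective P) (hcan : Function.Bijective (can P))
    (hflat : ∀ (X Y : UnitalRightMod (ringR P)) (f : X ⟶ Y), Function.Injective f.toAddHom →
      Function.Injective (UnitalRightMod.Hom.tensor f (Sig P))) : IsFlat A C.carrier := by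
  intro X Y _ _ _ _ f hf x y hxy
  obtain ⟨x, rfl⟩ := (toCofree_bijective h hcan X).2 x
  obtain ⟨y, rfl⟩ := (toCofree_bijective h hcan X).2 y
  rw [← toCofree_sigHomMap, ← toCofree_sigHomMap] at hxy
  refine congrArg _ (hflat _ _ (sigHomMap P f) (fun u v huv => ?_)
    ((toCofree_bijective h hcan Y).1 hxy))
  exact Subtype.ext (LinearMap.ext fun z =>
    hf (LinearMap.congr_fun (congrArg Subtype.val huv) z))

theorem tensorSigma_map_eq_iff {X Y : UnitalRightMod (ringR P)} (f g : X ⟶ Y) :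
    (tensorSigma P).map f = (tensorSigma P).map g ↔
      UnitalRightMod.Hom.tensor f (Sig P) = UnitalRightMod.Hom.tensor g (Sig P) :=
  ⟨fun h => AddMonoidHom.ext fun w => LinearMap.congr_fun (congrArg Comod.Hom.toLin h) w,
    fun h => Comod.hom_ext (LinearMap.ext fun w => DFunLike.congr_fun h w)⟩

theorem isEquivalence_of_isFaithfullyFlat (h : FGProjective P)
    (hcan : Function.Bijective (can P)) (hff : IsFaithfullyFlat (ringR P) (Sig P)) :
    (tensorSigma P).IsEquivalence := by
  have : (tensorSigma P).Faithful :=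
    ⟨fun {X Y f g} hfg => hff.faithful X Y f g ((tensorSigma_map_eq_iff f g).1 hfg)⟩
  exact isEquivalence_of_faithful P (evalHom_bijective_of_flat h hcan hff.flat)

/-- If `C` is flat and `- ⊗_R Σ` is an equivalence with the category of `C`-comodules, then `Σ`
is faithfully flat: monomorphisms are injections in both categories. -/
theorem isFaithfullyFlat_of_isEquivalence (hC : IsFlat A C.carrier)
    [(tensorSigma P).IsEquivalence] : IsFaithfullyFlat (ringR P) (Sig P) where
  flat X Y f hf := by
    have := UnitalRightMod.mono_of_injective f hf
    exact Comod.injective_of_mono hC ((tensorSigma P).map f)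
  faithful X Y f g hfg := (tensorSigma P).map_injective ((tensorSigma_map_eq_iff f g).2 hfg)

end Descent

/-! ### Comparison of `Σ` and `S` as left `R`-modules -/

section RingS

variable {ι : Type u} [DecidableEq ι] {P : ι → Comod C}

theorem single_mem_ringS {i j : ι} (g : (P i).carrier →ₗ[Aᵐᵒᵖ] (P j).carrier) :
    single P g ∈ ringS P := AddSubgroup.subset_closure ⟨i, j, g, rfl⟩

theorem mulLin_comp_mem_ringS (i : ι) (φ : (P i).carrier →ₗ[Aᵐᵒᵖ] A) (x : Sig P) :
    mulLin x ∘ₗ φ ∘ₗ proj P i ∈ ringS P := by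
  induction x using sig_induction with
  | zero =>
    have h : (mulLin (0 : Sig P) : A →ₗ[Aᵐᵒᵖ] Sig P) = 0 := LinearMap.ext fun a => smul_zero (op a)
    rw [h, LinearMap.zero_comp]
    exact zero_mem _
  | inc j p =>
    have h : mulLin (inc P j p) ∘ₗ φ ∘ₗ proj P i = single P (mulLin p ∘ₗ φ) :=
      LinearMap.ext fun z => ((inc P j).map_smul (op (φ (proj P i z))) p).symm
    rw [h]
    exact single_mem_ringS _
  | add x y hx hy =>
    rw [mulLin_add, LinearMap.add_comp]
    exact add_mem hx hy

theorem exists_mul_idemR_eq (s : ringS P) :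
    ∃ t₀ : Finset ι, ∀ t, t₀ ⊆ t → s.1 * (idemR P t).1 = s.1 := by
  obtain ⟨s, hs⟩ := s
  change s ∈ AddSubgroup.closure {f : Module.End Aᵐᵒᵖ (Sig P) |
    ∃ (i j : ι) (h : (P i).carrier →ₗ[Aᵐᵒᵖ] (P j).carrier), f = single P h} at hs
  change ∃ t₀ : Finset ι, ∀ t, t₀ ⊆ t → s * (idemR P t).1 = s
  induction hs using AddSubgroup.closure_induction with
  | mem s hs =>
    obtain ⟨i, j, g, rfl⟩ := hs
    refine ⟨{i}, fun t ht => sig_hom_ext P fun k p => ?_⟩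
    change single P g ((idemR P t).1 (inc P k p)) = single P g (inc P k p)
    rw [idemR_apply_inc]
    split_ifs with h
    · rfl
    · rw [map_zero]
      exact (LinearMap.congr_fun (single_comp_inc_ne P (fun hk => h
        (ht (Finset.mem_singleton.2 hk))) g) p).symm
  | zero => exact ⟨∅, fun t _ => zero_mul _⟩
  | add x y _ _ hx hy =>
    obtain ⟨s, hs⟩ := hx
    obtain ⟨s', hs'⟩ := hy
    exact ⟨s ∪ s', fun t ht => by
      rw [add_mul, hs t (Finset.union_subset_left ht), hs' t (Finset.union_subset_right ht)]⟩
  | neg x _ hx =>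
    obtain ⟨s, hs⟩ := hx
    exact ⟨s, fun t ht => by rw [neg_mul, hs t ht]⟩

/-- The map `Y ⊗_R S → Y ⊗_R Σ`, `y ⊗ s ↦ y ⊗ s(x)`. -/
def evalS (Y : UnitalRightMod (ringR P)) (x : Sig P) :
    BalTensor (ringR P) Y.carrier (ringS P) →+ BalTensor (ringR P) Y.carrier (Sig P) :=
  mapRight Y.carrier (AddMonoidHom.mk' (fun s : ringS P => s.1 x) (fun _ _ => rfl))
    (fun _ _ => rfl)

/-- The map `Y ⊗_R Σ → Y ⊗_R S`, `y ⊗ x ↦ y ⊗ x φ(-)`, for a functional `φ` on `P i`. -/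
def mulS (Y : UnitalRightMod (ringR P)) (i : ι) (φ : (P i).carrier →ₗ[Aᵐᵒᵖ] A) :
    BalTensor (ringR P) Y.carrier (Sig P) →+ BalTensor (ringR P) Y.carrier (ringS P) :=
  mapRight Y.carrier (AddMonoidHom.mk'
      (fun x : Sig P => (⟨_, mulLin_comp_mem_ringS i φ x⟩ : ringS P))
      (fun x y => Subtype.ext ((congrArg (· ∘ₗ φ ∘ₗ proj P i) (mulLin_add x y)).trans
        (LinearMap.add_comp _ _ _))))
    (fun r x => Subtype.ext (LinearMap.ext fun z => (r.1.map_smul (op (φ (proj P i z))) x).symm))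

theorem evalS_tensor {X Y : UnitalRightMod (ringR P)} (f : X ⟶ Y) (x : Sig P)
    (w : BalTensor (ringR P) X.carrier (ringS P)) :
    evalS Y x (UnitalRightMod.Hom.tensor f (ringS P) w) =
      UnitalRightMod.Hom.tensor f (Sig P) (evalS X x w) :=
  DFunLike.congr_fun (BalTensor.hom_ext
    (f := (evalS Y x).comp (UnitalRightMod.Hom.tensor f (ringS P)))
    (g := (UnitalRightMod.Hom.tensor f (Sig P)).comp (evalS X x)) fun _ _ => rfl) w

theorem mulS_tensor {X Y : UnitalRightMod (ringR P)} (f : X ⟶ Y) (i : ι)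
    (φ : (P i).carrier →ₗ[Aᵐᵒᵖ] A) (w : BalTensor (ringR P) X.carrier (Sig P)) :
    mulS Y i φ (UnitalRightMod.Hom.tensor f (Sig P) w) =
      UnitalRightMod.Hom.tensor f (ringS P) (mulS X i φ w) :=
  DFunLike.congr_fun (BalTensor.hom_ext
    (f := (mulS Y i φ).comp (UnitalRightMod.Hom.tensor f (Sig P)))
    (g := (UnitalRightMod.Hom.tensor f (ringS P)).comp (mulS X i φ)) fun _ _ => rfl) w

theorem evalS_mulS (Y : UnitalRightMod (ringR P)) (i : ι) (φ : (P i).carrier →ₗ[Aᵐᵒᵖ] A)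
    (p : (P i).carrier) (w : BalTensor (ringR P) Y.carrier (Sig P)) :
    evalS Y (inc P i p) (mulS Y i φ w) = op (φ p) • w := by
  refine DFunLike.congr_fun (BalTensor.hom_ext
    (f := (evalS Y (inc P i p)).comp (mulS Y i φ))
    (g := DistribSMul.toAddMonoidHom _ (op (φ p))) fun y x => ?_) w
  exact congrArg (fun f => tmul (ringR P) y (op (φ (f p)) • x)) (proj_inc_self P i)

/-- `S` is generated by `Σ`: an element `w` of `Y ⊗_R S` is the sum of the `w(e) e*`, where
`e, e*` runs through the dual bases of finitely many `P i`. -/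
theorem exists_sum_mulS_evalS (h : FGProjective P) (Y : UnitalRightMod (ringR P))
    (w : BalTensor (ringR P) Y.carrier (ringS P)) :
    ∃ t₀ : Finset ι, ∀ t, t₀ ⊆ t →
      ∑ i ∈ t, ∑ k, mulS Y i (db' h i k) (evalS Y (inc P i (db h i k)) w) = w := by
  induction w using induction_on with
  | zero => exact ⟨∅, fun t _ => by simp⟩
  | tmul y s =>
    obtain ⟨t₀, ht₀⟩ := exists_mul_idemR_eq s
    refine ⟨t₀, fun t ht => ?_⟩
    have h1 : ∑ i ∈ t, ∑ k, (⟨_, mulLin_comp_mem_ringS i (db' h i k)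
        (s.1 (inc P i (db h i k)))⟩ : ringS P) = s := by
      apply Subtype.ext
      rw [AddSubmonoidClass.coe_finsetSum]
      simp only [AddSubmonoidClass.coe_finsetSum]
      conv_rhs => rw [← ht₀ t ht, idemR, AddSubmonoidClass.coe_finsetSum, Finset.mul_sum]
      refine Finset.sum_congr rfl fun i _ => LinearMap.ext fun z => ?_
      rw [LinearMap.sum_apply]
      change ∑ k, op (db' h i k (proj P i z)) • s.1 (inc P i (db h i k)) =
        s.1 (inc P i (proj P i z))
      conv_rhs => rw [← db_spec h i (proj P i z), map_sum, map_sum]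
      simp only [map_smul]
    conv_rhs => rw [← h1, tmul_sum]
    refine Finset.sum_congr rfl fun i _ => ?_
    rw [tmul_sum]
    rfl
  | add x y hx hy =>
    obtain ⟨s, hs⟩ := hx
    obtain ⟨s', hs'⟩ := hy
    refine ⟨s ∪ s', fun t ht => ?_⟩
    simp only [map_add, Finset.sum_add_distrib]
    rw [hs t (Finset.union_subset_left ht), hs' t (Finset.union_subset_right ht)]

theorem isFaithfullyFlat_ringS (h : FGProjective P) (hff : IsFaithfullyFlat (ringR P) (Sig P)) :
    IsFaithfullyFlat (ringR P) (ringS P) where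
  flat X Y f hf := by
    rw [injective_iff_map_eq_zero]
    intro w hw
    obtain ⟨t, ht⟩ := exists_sum_mulS_evalS h X w
    have h0 : ∀ x, evalS X x w = 0 := fun x => hff.flat X Y f hf (by
      rw [← evalS_tensor, hw, map_zero, map_zero])
    rw [← ht t subset_rfl]
    simp [h0]
  faithful X Y f g hfg := hff.faithful X Y f g (BalTensor.hom_ext fun y x => by
    induction x using sig_induction with
    | zero => simp
    | inc i p =>
      have h1 : tmul (ringR P) y (inc P i p) = evalS X (inc P i p) (tmul (ringR P) y
          ⟨single P (𝟙 (P i) : P i ⟶ P i).toLin, single_mem_ringS _⟩) :=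
        congrArg (tmul (ringR P) y) (single_inc_self P LinearMap.id p).symm
      rw [h1, ← evalS_tensor, ← evalS_tensor, hfg]
    | add x x' h h' => simp only [tmul_add, map_add, h, h'])

/-- If `S` is faithfully flat over `R`, so is `Σ`. For an injection `X → Y`, the kernel of
`X ⊗_R Σ → Y ⊗_R Σ` is killed by all values `φ(p)`; as `C` is flat it is a comodule, hence
generated by multiples of values of the counit, which are sums of such values. -/
theorem isFaithfullyFlat_of_ringS (hC : IsFlat A C.carrier) (h : FGProjective P)
    (hcan : CanIsIso h) (hff : IsFaithfullyFlat (ringR P) (ringS P)) :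
    IsFaithfullyFlat (ringR P) (Sig P) where
  flat X Y f hf := by
    rw [injective_iff_map_eq_zero]
    intro w hw
    let K := Comod.kerComod hC ((tensorSigma P).map f)
    have h1 : ∀ (k : K.carrier) (i : ι) (φ : (P i).carrier →ₗ[Aᵐᵒᵖ] A) (p : (P i).carrier),
        op (φ p) • k = 0 := by
      intro k i φ p
      apply Subtype.ext
      have h2 : mulS X i φ k.1 = 0 := hff.flat X Y f hf (by
        rw [map_zero]
        exact (mulS_tensor f i φ k.1).symm.trans ((congrArg (mulS Y i φ) k.2).trans (map_zero _)))
      exact (evalS_mulS X i φ p k.1).symm.trans (by rw [h2, map_zero]; rfl)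
    have h2 : ∀ (k : K.carrier) (d : Comatrix P), op (comatrixCounit P d) • k = 0 := by
      intro k d
      induction d using Comatrix.induction with
      | zero => simp
      | mk φ i y => exact h1 k i (φ.1 ∘ₗ inc P i) y
      | add d d' hd hd' => rw [map_add, MulOpposite.op_add, add_smul, hd, hd', add_zero]
    have h3 : ∀ z : BalTensor A K.carrier C.carrier,
        rightUnit (mapRight K.carrier C.counit C.counit_smul z) = 0 := by
      intro z
      induction z using induction_on with
      | zero => simp
      | tmul k c =>
        obtain ⟨d, rfl⟩ := hcan.bijective.2 c
        rw [mapRight_tmul, rightUnit_tmul, hcan.map_counit]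
        exact h2 k d
      | add z z' hz hz' => simp only [map_add, hz, hz', add_zero]
    have h4 : ∀ k : K.carrier, k = 0 := fun k => by rw [← K.counit k, h3]
    exact congrArg Subtype.val (h4 ⟨w, hw⟩)
  faithful X Y f g hfg := hff.faithful X Y f g (AddMonoidHom.ext fun w => by
    obtain ⟨t, ht⟩ := exists_sum_mulS_evalS h X w
    rw [← ht t subset_rfl]
    simp only [map_sum, ← mulS_tensor, hfg])

end RingS

/-! ### Coproducts of comodules and small objects -/

namespace Comod

theorem sum_toLin {M N : Comod C} {κ : Type*} (s : Finset κ) (f : κ → (M ⟶ N)) :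
    (∑ k ∈ s, f k).toLin = ∑ k ∈ s, (f k).toLin :=
  map_sum (AddMonoidHom.mk' (fun f : M ⟶ N => f.toLin) (fun _ _ => rfl)) f s

theorem sub_toLin {M N : Comod C} (f g : M ⟶ N) : (f - g).toLin = f.toLin - g.toLin :=
  map_sub (AddMonoidHom.mk' (fun f : M ⟶ N => f.toLin) (fun _ _ => rfl)) f g

section Coproduct

variable {J : Type u} [DecidableEq J] (Q : J → Comod C)

/-- The inclusion of a summand into a coproduct of comodules. -/
def incHom (j : J) : Q j ⟶ sigmaComod Q where
  toLin := inc Q j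
  coact_comm p := (sigCoact_inc Q j p).symm

/-- The projection of a coproduct of comodules to a summand. -/
def projHom (j : J) : sigmaComod Q ⟶ Q j where
  toLin := proj Q j
  coact_comm x := by
    refine DFunLike.congr_fun (f := (rTensor C.carrier (proj Q j)).comp
      (sigCoact Q).toAddMonoidHom) (g := ((Q j).coact ∘ₗ proj Q j).toAddMonoidHom) ?_ x
    ext x
    induction x using sig_induction with
    | zero => simp
    | inc k p =>
      change rTensor C.carrier (proj Q j) (sigCoact Q (inc Q k p)) =
        (Q j).coact ((proj Q j ∘ₗ inc Q k) p)
      rw [sigCoact_inc, ← rTensor_comp_apply]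
      by_cases hk : k = j
      · subst hk
        rw [proj_inc_self, rTensor_id]
        rfl
      · rw [proj_inc_ne Q hk, rTensor_zero]
        exact (map_zero _).symm
    | add x y hx hy => rw [map_add, map_add, hx, hy]

variable {Q} in
/-- The morphism from a coproduct of comodules given by a family of morphisms. -/
def liftHom {N : Comod C} (f : ∀ j, Q j ⟶ N) : sigmaComod Q ⟶ N where
  toLin := sigLift Q fun j => (f j).toLin
  coact_comm x := by
    refine DFunLike.congr_fun (f := (rTensor C.carrier (sigLift Q fun j => (f j).toLin)).comp
      (sigCoact Q).toAddMonoidHom)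
      (g := (N.coact ∘ₗ (sigLift Q fun j => (f j).toLin)).toAddMonoidHom) ?_ x
    ext x
    induction x using sig_induction with
    | zero => simp
    | inc k p =>
      change rTensor C.carrier (sigLift Q fun j => (f j).toLin) (sigCoact Q (inc Q k p)) =
        N.coact (sigLift Q (fun j => (f j).toLin) (inc Q k p))
      rw [sigCoact_inc, ← rTensor_comp_apply, sigLift_inc, ← (f k).coact_comm]
      exact congrArg (fun g => rTensor C.carrier g ((Q k).coact p))
        (LinearMap.ext (sigLift_inc Q (fun j => (f j).toLin) k))
    | add x y hx hy => rw [map_add, map_add, hx, hy]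

theorem incHom_liftHom {N : Comod C} (f : ∀ j, Q j ⟶ N) (j : J) :
    incHom Q j ≫ liftHom f = f j :=
  hom_ext (LinearMap.ext (sigLift_inc Q (fun j => (f j).toLin) j))

theorem sigmaComod_hom_ext {N : Comod C} {f g : sigmaComod Q ⟶ N}
    (h : ∀ j, incHom Q j ≫ f = incHom Q j ≫ g) : f = g :=
  hom_ext (sig_hom_ext Q fun j => LinearMap.congr_fun (congrArg Hom.toLin (h j)))

theorem incHom_projHom (j : J) : incHom Q j ≫ projHom Q j = 𝟙 (Q j) :=
  hom_ext (proj_inc_self Q j)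

theorem incHom_projHom_ne {j k : J} (h : j ≠ k) : incHom Q j ≫ projHom Q k = 0 :=
  hom_ext (proj_inc_ne Q h)

/-- A coproduct of comodules as a cofan. -/
def sigmaCofan : Limits.Cofan Q := Limits.Cofan.mk (sigmaComod Q) (incHom Q)

/-- `sigmaComod Q` is the coproduct of the comodules `Q j`. -/
def sigmaCofanIsColimit : Limits.IsColimit (sigmaCofan Q) :=
  Limits.Cofan.IsColimit.mk _ (fun t => liftHom t.inj)
    (fun t j => incHom_liftHom Q t.inj j)
    (fun t m hm => sigmaComod_hom_ext Q fun j => by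
      rw [incHom_liftHom]
      exact hm j)

end Coproduct

/-- A comodule `X` is finitary if all morphisms from `X` to a coproduct factor through a finite
subcoproduct. -/
def IsFinitary (X : Comod C) : Prop :=
  ∀ (J : Type u) [DecidableEq J] (Q : J → Comod C) (h : X ⟶ sigmaComod Q),
    ∃ s : Finset J, ∀ t, s ⊆ t → ∑ j ∈ t, (h ≫ projHom Q j) ≫ incHom Q j = h

theorem sum_projHom_incHom_of_comp {X : Comod C} {J : Type u} [DecidableEq J] (Q : J → Comod C)
    {j : J} (h : X ⟶ Q j) (t : Finset J) (ht : j ∈ t) :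
    ∑ k ∈ t, ((h ≫ incHom Q j) ≫ projHom Q k) ≫ incHom Q k = h ≫ incHom Q j := by
  rw [Finset.sum_eq_single_of_mem j ht]
  · rw [Category.assoc h, incHom_projHom, Category.comp_id]
  · intro k _ hk
    rw [Category.assoc h, incHom_projHom_ne Q hk.symm, Limits.comp_zero, Limits.zero_comp]

theorem isFinitary_of_isSmallObject {X : Comod C} (hX : IsSmallObject X) : IsFinitary X := by
  intro J _ Q h
  have := hX J
  let F := preadditiveCoyoneda.obj (Opposite.op X)
  let hc := Limits.isColimitOfPreserves F (sigmaCofanIsColimit Q)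
  let U : AddSubgroup (X ⟶ sigmaComod Q) :=
    { carrier := {h | ∃ s : Finset J, ∀ t, s ⊆ t → ∑ j ∈ t, (h ≫ projHom Q j) ≫ incHom Q j = h}
      zero_mem' := ⟨∅, fun t _ => by simp⟩
      add_mem' := by
        rintro f g ⟨s, hs⟩ ⟨s', hs'⟩
        exact ⟨s ∪ s', fun t ht => by
          simp only [Preadditive.add_comp, Finset.sum_add_distrib]
          rw [hs t (Finset.union_subset_left ht), hs' t (Finset.union_subset_right ht)]⟩
      neg_mem' := by
        rintro f ⟨s, hs⟩
        exact ⟨s, fun t ht => by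
          simp only [Preadditive.neg_comp, Finset.sum_neg_distrib]
          rw [hs t ht]⟩ }
  have h0 : AddCommGrpCat.ofHom (QuotientAddGroup.mk' U) =
      AddCommGrpCat.ofHom (0 : (X ⟶ sigmaComod Q) →+ ((X ⟶ sigmaComod Q) ⧸ U)) := by
    refine hc.hom_ext fun j => ?_
    refine AddCommGrpCat.ext fun f => ?_
    exact (QuotientAddGroup.eq_zero_iff _).2
      ⟨{j.as}, fun t ht => sum_projHom_incHom_of_comp Q f t (ht (Finset.mem_singleton_self _))⟩
  exact (QuotientAddGroup.eq_zero_iff _).1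
    (DFunLike.congr_fun (congrArg AddCommGrpCat.Hom.hom h0) h)

/-- The map `⨁ Hom(X, Q j) → Hom(X, ⨁ Q j)`. -/
def ofDirectSum (X : Comod C) {J : Type u} [DecidableEq J] (Q : J → Comod C) :
    DirectSum J (fun j => X ⟶ Q j) →+ (X ⟶ sigmaComod Q) :=
  DirectSum.toAddMonoid fun j => Preadditive.rightComp X (incHom Q j)

theorem ofDirectSum_of (X : Comod C) {J : Type u} [DecidableEq J] (Q : J → Comod C) (j : J)
    (f : X ⟶ Q j) : ofDirectSum X Q (DirectSum.of (fun j => X ⟶ Q j) j f) = f ≫ incHom Q j := by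
  rw [ofDirectSum, DirectSum.toAddMonoid_of]
  rfl

theorem isSmallObject_of_isFinitary {X : Comod C} (hX : IsFinitary X) : IsSmallObject X := by
  classical
  intro J
  suffices h : ∀ Q : J → Comod C, Limits.PreservesColimit (Discrete.functor Q)
      (preadditiveCoyoneda.obj (Opposite.op X)) from
    Limits.preservesColimitsOfShape_of_discrete _
  intro Q
  refine Limits.preservesColimit_of_preserves_colimit_cocone (sigmaCofanIsColimit Q) ?_
  let e₀ := ofDirectSum X Q
  have he₀ := ofDirectSum_of X Q
  have hproj : ∀ (x : DirectSum J (fun j => X ⟶ Q j)) (j : J), e₀ x ≫ projHom Q j = x j := by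
    intro x j
    induction x using DirectSum.induction_on with
    | zero => rw [map_zero, Limits.zero_comp]; rfl
    | of k f =>
      rw [he₀, Category.assoc]
      by_cases hk : k = j
      · subst hk
        rw [incHom_projHom, Category.comp_id, DirectSum.of_eq_same]
      · rw [incHom_projHom_ne Q hk, Limits.comp_zero, DirectSum.of_eq_of_ne _ _ _ (Ne.symm hk)]
    | add x y hx hy => rw [map_add, Preadditive.add_comp, hx, hy]; rfl
  have hbij : Function.Bijective e₀ := by
    constructor
    · intro x y hxy
      exact DFinsupp.ext fun j => by rw [← hproj x j, ← hproj y j, hxy]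
    · intro h
      obtain ⟨s, hs⟩ := hX J Q h
      refine ⟨∑ j ∈ s, DirectSum.of (fun j => X ⟶ Q j) j (h ≫ projHom Q j), ?_⟩
      rw [map_sum]
      exact (Finset.sum_congr rfl fun j _ => he₀ j _).trans (hs s subset_rfl)
  let e := AddEquiv.ofBijective e₀ hbij
  have he : ∀ j (f : X ⟶ Q j), e.symm (f ≫ incHom Q j) = DirectSum.of (fun j => X ⟶ Q j) j f :=
    fun j f => e.injective (by rw [e.apply_symm_apply]; exact (he₀ j f).symm)
  let τ : ∀ (t : Limits.Cocone (Discrete.functor Q ⋙ preadditiveCoyoneda.obj (Opposite.op X)))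
      (j : J), (X ⟶ Q j) →+ t.pt := fun t j => (t.ι.app ⟨j⟩).hom
  exact
    { desc := fun t => AddCommGrpCat.ofHom
        ((DirectSum.toAddMonoid (τ t)).comp e.symm.toAddMonoidHom)
      fac := fun t j => AddCommGrpCat.ext fun f => by
        exact (congrArg (DirectSum.toAddMonoid (τ t)) (he j.as f)).trans
          (DirectSum.toAddMonoid_of (τ t) j.as f)
      uniq := fun t m hm => AddCommGrpCat.ext fun f => by
        obtain ⟨x, rfl⟩ := e.surjective f
        change m.hom (e x) = DirectSum.toAddMonoid (τ t) (e.symm (e x))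
        rw [e.symm_apply_apply]
        let m' : (X ⟶ sigmaComod Q) →+ t.pt := m.hom
        have hm' : m'.comp e₀ = DirectSum.toAddMonoid (τ t) := DirectSum.addHom_ext fun j f => by
          rw [DirectSum.toAddMonoid_of, AddMonoidHom.comp_apply, he₀]
          exact DFunLike.congr_fun (congrArg AddCommGrpCat.Hom.hom (hm ⟨j⟩)) f
        exact DFunLike.congr_fun hm' x }

/-- A finitary projective comodule is finitely generated projective as an `A`-module: lift
`P → P ⊗ C` along the epimorphism from `⨁_{p ∈ P} A ⊗ C` given by `a ⊗ c ↦ p a ⊗ c`, and apply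
the counit, to obtain a finite dual basis. -/
theorem exists_dualBasis_of_projective {X : Comod C} [Projective X] (hX : IsFinitary X) :
    ∃ (s : Finset X.carrier) (φ : X.carrier → X.carrier →ₗ[Aᵐᵒᵖ] A),
      ∀ x, ∑ p ∈ s, op (φ p x) • p = x := by
  classical
  let Q : X.carrier → Comod C := fun _ => cofree C A
  let Φ : sigmaComod Q ⟶ cofree C X.carrier := liftHom fun p => cofreeMap C (mulLin p)
  have hΦ : Function.Surjective Φ.toLin := by
    rw [← LinearMap.range_eq_top, eq_top_iff]
    rintro z -
    induction (z : BalTensor A X.carrier C.carrier) using induction_on with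
    | zero => exact zero_mem _
    | tmul p c =>
      refine ⟨inc Q p (tmul A (1 : A) c), ?_⟩
      refine (sigLift_inc Q (fun p => (cofreeMap C (mulLin p)).toLin) p _).trans ?_
      change tmul A (op (1 : A) • p) c = _
      rw [op_one, one_smul]
    | add x y hx hy => exact add_mem hx hy
  have : Epi Φ := epi_of_surjective Φ hΦ
  let t := Projective.factorThru (cofreeLift (LinearMap.id : X.carrier →ₗ[Aᵐᵒᵖ] X.carrier)) Φ
  have ht : t ≫ Φ = _ := Projective.factorThru_comp _ _
  obtain ⟨s, hs⟩ := hX X.carrier Q t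
  refine ⟨s, fun p => cofreeCounit C A ∘ₗ (t ≫ projHom Q p).toLin, fun x => ?_⟩
  have h1 : cofreeLift (LinearMap.id : X.carrier →ₗ[Aᵐᵒᵖ] X.carrier) =
      ∑ p ∈ s, (t ≫ projHom Q p) ≫ cofreeMap C (mulLin p) := by
    rw [← ht, ← hs s subset_rfl, Preadditive.sum_comp]
    refine Finset.sum_congr rfl fun p _ => ?_
    rw [hs s subset_rfl, Category.assoc, incHom_liftHom]
  conv_rhs => rw [← LinearMap.id_apply (R := Aᵐᵒᵖ) x, ← cofreeCounit_cofreeLift LinearMap.id x, h1,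
    sum_toLin, LinearMap.sum_apply]
  refine Eq.trans ?_ (map_sum (cofreeCounit C X.carrier) _ _).symm
  refine Finset.sum_congr rfl fun p _ => ?_
  exact (cofreeCounit_rTensor C (mulLin p) _).symm

theorem finite_and_projective {X : Comod C} [Projective X] (hX : IsFinitary X) :
    Module.Finite Aᵐᵒᵖ X.carrier ∧ Module.Projective Aᵐᵒᵖ X.carrier := by
  obtain ⟨s, φ, hs⟩ := exists_dualBasis_of_projective hX
  let i : X.carrier →ₗ[Aᵐᵒᵖ] (s → Aᵐᵒᵖ) := LinearMap.pi fun p =>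
    { toFun := fun x => op (φ p x)
      map_add' := fun x y => by rw [map_add, MulOpposite.op_add]
      map_smul' := fun a x => by rw [map_smul]; rfl }
  let r : (s → Aᵐᵒᵖ) →ₗ[Aᵐᵒᵖ] X.carrier :=
    ∑ p : s, (LinearMap.toSpanSingleton Aᵐᵒᵖ X.carrier p.1) ∘ₗ LinearMap.proj p
  have hri : r ∘ₗ i = LinearMap.id := by
    ext x
    rw [LinearMap.comp_apply, LinearMap.sum_apply]
    exact (Finset.sum_coe_sort s fun p => op (φ p x) • p).trans (hs x)
  exact ⟨Module.Finite.of_surjective r fun x => ⟨i x, LinearMap.congr_fun hri x⟩,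
    Module.Projective.of_split i r hri⟩

end Comod

/-! ### From small projective generators to an equivalence -/

section Generators

variable {ι : Type u} [DecidableEq ι] {P : ι → Comod C}

open Comod

/-- An element `r` of `R`, as an endomorphism of the comodule `Σ`. -/
def actHom (r : ringR P) : sigmaComod P ⟶ sigmaComod P where
  toLin := (smulLin (Sig P) r : Sig P →ₗ[Aᵐᵒᵖ] Sig P)
  coact_comm x := (sigCoact_smul P r x).symm

/-- The element of `⨁ Hom_C(P, M)` given by a morphism `Σ → M` and an element of `R`. -/
def homSigmaObj.ofHom {M : Comod C} (f : sigmaComod P ⟶ M) (r : ringR P) :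
    (homSigmaObj P M).carrier :=
  homSigmaObj.mk (actHom r ≫ f).toLin (comp_mem_sigHom f.toLin r) (actHom r ≫ f).coact_comm

theorem homSigmaObj.lin_ofHom {M : Comod C} (f : sigmaComod P ⟶ M) (r : ringR P) (x : Sig P) :
    homSigmaObj.lin (homSigmaObj.ofHom f r) x = f.toLin (r • x) := rfl

theorem op_singleR_smul_tmul (Y : UnitalRightMod (ringR P)) (y : Y.carrier) (i : ι)
    (p : (P i).carrier) :
    tmul (ringR P) (op (singleR (𝟙 (P i))) • y) (inc P i p) = tmul (ringR P) y (inc P i p) := by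
  rw [smul_tmul]
  exact congrArg _ (singleR_smul_inc (𝟙 (P i)) p)

theorem projective_of_sigmaComod [Projective (sigmaComod P)] (i : ι) : Projective (P i) :=
  Retract.projective ⟨incHom P i, projHom P i, incHom_projHom P i⟩

/-- If `Σ` is a generator, every comodule is generated by the images of the `P i`. -/
theorem evalHom_surjective_of_isSeparator (hP : IsSeparator (sigmaComod P)) (M : Comod C) :
    Function.Surjective (evalHom P M) := by
  have h : cokerHom (counitHom P M) = 0 := by
    refine hP.def _ _ fun f => Comod.hom_ext (LinearMap.ext fun x => ?_)
    rw [Limits.comp_zero]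
    obtain ⟨s, hs⟩ := exists_idemR_apply_eq P x
    refine (Submodule.Quotient.mk_eq_zero (LinearMap.range (counitHom P M).toLin)).2
      ⟨tmul (ringR P) (homSigmaObj.ofHom f (idemR P s)) x, ?_⟩
    exact congrArg f.toLin (hs s subset_rfl)
  intro m
  exact (Submodule.Quotient.mk_eq_zero (LinearMap.range (counitHom P M).toLin)).1
    (LinearMap.congr_fun (congrArg Hom.toLin h) m)

theorem comp_proj_mem_ringR {i : ι} (hi : (P i).IsFinitary) (u : P i ⟶ sigmaComod P) :
    u.toLin ∘ₗ proj P i ∈ ringR P := by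
  obtain ⟨s, hs⟩ := hi ι P u
  have h : u.toLin ∘ₗ proj P i = (∑ j ∈ s, singleR (u ≫ projHom P j)).1 := by
    rw [AddSubmonoidClass.coe_finsetSum]
    refine LinearMap.ext fun x => ?_
    refine (LinearMap.congr_fun (congrArg Hom.toLin (hs s subset_rfl)) (proj P i x)).symm.trans ?_
    rw [sum_toLin, LinearMap.sum_apply]
    exact (LinearMap.sum_apply s (fun j => (singleR (u ≫ projHom P j)).1) x).symm
  rw [h]
  exact SetLike.coe_mem _

/-- The element of `R` given by a morphism `P i → Σ`, for a finitary comodule `P i`. -/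
def toRingR {i : ι} (hi : (P i).IsFinitary) : (P i ⟶ sigmaComod P) →+ ringR P :=
  AddMonoidHom.mk' (fun u => ⟨_, comp_proj_mem_ringR hi u⟩)
    (fun _ _ => Subtype.ext (LinearMap.add_comp _ _ _))

theorem toRingR_smul_inc {i : ι} (hi : (P i).IsFinitary) (u : P i ⟶ sigmaComod P)
    (p : (P i).carrier) : toRingR hi u • inc P i p = u.toLin p :=
  congrArg u.toLin (LinearMap.congr_fun (proj_inc_self P i) p)

theorem toRingR_comp_actHom {i : ι} (hi : (P i).IsFinitary) (u : P i ⟶ sigmaComod P)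
    (r : ringR P) : toRingR hi (u ≫ actHom r) = r * toRingR hi u := rfl

section Free

variable (Y : UnitalRightMod (ringR P))

/-- The morphism `Σ → Y ⊗_R Σ`, `x ↦ y ⊗ x`. -/
def tmulComodHom (y : Y.carrier) : sigmaComod P ⟶ (tensorSigma P).obj Y :=
  homSigmaObj.hom ((unitHom P Y).toAddHom y)

open Classical in
/-- The comodule `⨁_{y ∈ Y} Σ`. -/
def freeCover : Comod C := sigmaComod fun _ : Y.carrier => sigmaComod P

open Classical in
/-- The inclusion of the copy of `Σ` with index `y`. -/
def freeInc (y : Y.carrier) : sigmaComod P ⟶ freeCover Y :=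
  incHom (fun _ : Y.carrier => sigmaComod P) y

open Classical in
/-- The projection to the copy of `Σ` with index `y`. -/
def freeProj (y : Y.carrier) : freeCover Y ⟶ sigmaComod P :=
  projHom (fun _ : Y.carrier => sigmaComod P) y

open Classical in
/-- The epimorphism `⨁_{y ∈ Y} Σ → Y ⊗_R Σ` given by `x ↦ y ⊗ x` on the copy with index `y`. -/
def freeHom : freeCover Y ⟶ (tensorSigma P).obj Y := liftHom (tmulComodHom Y)

theorem freeInc_freeHom (y : Y.carrier) : freeInc Y y ≫ freeHom Y = tmulComodHom Y y := by
  classical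
  exact incHom_liftHom _ _ y

theorem freeHom_freeInc_apply (y : Y.carrier) (x : Sig P) :
    (freeHom Y).toLin ((freeInc Y y).toLin x) = tmul (ringR P) y x :=
  LinearMap.congr_fun (congrArg Hom.toLin (freeInc_freeHom Y y)) x

theorem freeInc_freeProj (y : Y.carrier) : freeInc Y y ≫ freeProj Y y = 𝟙 _ := by
  classical
  exact incHom_projHom _ y

theorem freeInc_freeProj_ne {y z : Y.carrier} (h : y ≠ z) : freeInc Y y ≫ freeProj Y z = 0 := by
  classical
  exact incHom_projHom_ne _ h

theorem freeHom_surjective : Function.Surjective (freeHom Y).toLin := by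
  rw [← LinearMap.range_eq_top, eq_top_iff]
  rintro w -
  induction (w : BalTensor (ringR P) Y.carrier (Sig P)) using induction_on with
  | zero => exact zero_mem _
  | tmul y x => exact ⟨_, freeHom_freeInc_apply Y y x⟩
  | add v w hv hw => exact add_mem hv hw

/-- A morphism from a finitary `P i` to `Y ⊗_R Σ` that lifts to `⨁_{y ∈ Y} Σ` has the form
`p ↦ y ⊗ p`. -/
theorem exists_eq_tmul {i : ι} (hi : (P i).IsFinitary) (t : P i ⟶ freeCover Y) :
    ∃ y : Y.carrier, ∀ p, (freeHom Y).toLin (t.toLin p) = tmul (ringR P) y (inc P i p) := by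
  classical
  obtain ⟨s, hs⟩ := hi Y.carrier (fun _ => sigmaComod P) t
  refine ⟨∑ y ∈ s, op (toRingR hi (t ≫ freeProj Y y)) • y, fun p => ?_⟩
  have h1 : t = ∑ y ∈ s, (t ≫ freeProj Y y) ≫ freeInc Y y := (hs s subset_rfl).symm
  have h2 : t ≫ freeHom Y = ∑ y ∈ s, (t ≫ freeProj Y y) ≫ tmulComodHom Y y := by
    conv_lhs => rw [h1, Preadditive.sum_comp]
    exact Finset.sum_congr rfl fun y _ => by rw [Category.assoc, freeInc_freeHom]
  refine (LinearMap.congr_fun (congrArg Hom.toLin h2) p).trans ?_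
  rw [sum_toLin, LinearMap.sum_apply]
  refine Eq.trans ?_ (sum_tmul s _ _).symm
  refine Finset.sum_congr rfl fun y _ => ?_
  exact ((smul_tmul _ y (inc P i p)).trans
    (congrArg (tmul (ringR P) y) (toRingR_smul_inc hi (t ≫ freeProj Y y) p))).symm

/-- The defining relations of `Y ⊗_R Σ`, as morphisms `Σ → ⨁_{y ∈ Y} Σ`. -/
def tensorRel : (Y.carrier × Y.carrier) ⊕ (Y.carrier × ringR P) → (sigmaComod P ⟶ freeCover Y)
  | Sum.inl (y, z) => freeInc Y (y + z) - freeInc Y y - freeInc Y z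
  | Sum.inr (y, r) => freeInc Y (op r • y) - actHom r ≫ freeInc Y y

theorem tensorRel_freeHom (l : (Y.carrier × Y.carrier) ⊕ (Y.carrier × ringR P)) :
    tensorRel Y l ≫ freeHom Y = 0 := by
  apply Comod.hom_ext
  obtain ⟨y, z⟩ | ⟨y, r⟩ := l
  · rw [tensorRel, Preadditive.sub_comp, Preadditive.sub_comp, freeInc_freeHom, freeInc_freeHom,
      freeInc_freeHom, sub_toLin, sub_toLin]
    refine LinearMap.ext fun x => ?_
    change tmul (ringR P) (y + z) x - tmul (ringR P) y x - tmul (ringR P) z x = 0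
    rw [add_tmul]
    abel
  · rw [tensorRel, Preadditive.sub_comp, Category.assoc, freeInc_freeHom, freeInc_freeHom,
      sub_toLin]
    refine LinearMap.ext fun x => ?_
    change tmul (ringR P) (op r • y) x - tmul (ringR P) y (r • x) = 0
    rw [smul_tmul, sub_self]

open Classical in
/-- The coproduct of copies of `Σ` indexed by the defining relations of `Y ⊗_R Σ`. -/
abbrev relCover : Comod C :=
  sigmaComod fun _ : (Y.carrier × Y.carrier) ⊕ (Y.carrier × ringR P) => sigmaComod P

open Classical in
/-- The map in the presentation `⨁ Σ → ⨁_{y ∈ Y} Σ → Y ⊗_R Σ → 0` by the defining relations. -/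
def relHom : relCover Y ⟶ freeCover Y := liftHom (tensorRel Y)

theorem relHom_freeHom : relHom Y ≫ freeHom Y = 0 := by
  classical
  refine sigmaComod_hom_ext _ fun l => ?_
  rw [relHom, ← Category.assoc, incHom_liftHom, tensorRel_freeHom, Limits.comp_zero]

theorem tensorRel_mem_range (l : (Y.carrier × Y.carrier) ⊕ (Y.carrier × ringR P)) (x : Sig P) :
    (tensorRel Y l).toLin x ∈ LinearMap.range (relHom Y).toLin := by
  classical
  exact ⟨(incHom _ l).toLin x,
    LinearMap.congr_fun (congrArg Hom.toLin (incHom_liftHom _ (tensorRel Y) l)) x⟩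

theorem exists_comp_relHom_eq_sum {X : Comod C} (hX : X.IsFinitary) (t : X ⟶ relCover Y) :
    ∃ (s : Finset ((Y.carrier × Y.carrier) ⊕ (Y.carrier × ringR P)))
      (u : (Y.carrier × Y.carrier) ⊕ (Y.carrier × ringR P) → (X ⟶ sigmaComod P)),
      t ≫ relHom Y = ∑ l ∈ s, u l ≫ tensorRel Y l := by
  classical
  obtain ⟨s, hs⟩ := hX _ _ t
  refine ⟨s, fun l => t ≫ projHom _ l, ?_⟩
  conv_lhs => rw [← hs s subset_rfl, Preadditive.sum_comp]
  exact Finset.sum_congr rfl fun l _ => by rw [Category.assoc, relHom, incHom_liftHom]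

theorem exists_relHom_eq (n : (freeCover Y).carrier) (hn : (freeHom Y).toLin n = 0) :
    ∃ m, (relHom Y).toLin m = n := by
  classical
  let q := (LinearMap.range (relHom Y).toLin).mkQ
  have hq : ∀ l x, q ((tensorRel Y l).toLin x) = 0 := fun l x =>
    (Submodule.Quotient.mk_eq_zero _).2 (tensorRel_mem_range Y l x)
  let L : BalTensor (ringR P) Y.carrier (Sig P) →+
      (freeCover Y).carrier ⧸ LinearMap.range (relHom Y).toLin :=
    lift (AddMonoidHom.mk' (fun y => (q ∘ₗ (freeInc Y y).toLin).toAddMonoidHom)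
        (fun y z => AddMonoidHom.ext fun x => by
          have h := hq (Sum.inl (y, z)) x
          rw [tensorRel, sub_toLin, sub_toLin, LinearMap.sub_apply, LinearMap.sub_apply, map_sub,
            map_sub, sub_sub, sub_eq_zero] at h
          exact h))
      (fun y r (x : (sigmaComod P).carrier) => by
        have h := hq (Sum.inr (y, r)) x
        rw [tensorRel, sub_toLin, LinearMap.sub_apply, map_sub, sub_eq_zero] at h
        exact h)
  have hL : L.comp (freeHom Y).toLin.toAddMonoidHom = q.toAddMonoidHom := by
    have h : ∀ y x, L ((freeHom Y).toLin ((freeInc Y y).toLin x)) = q ((freeInc Y y).toLin x) :=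
      fun y x => congrArg L (freeHom_freeInc_apply Y y x)
    refine AddMonoidHom.ext fun n => ?_
    induction (n : Sig fun _ : Y.carrier => sigmaComod P) using sig_induction with
    | zero => exact (map_zero _).trans (map_zero _).symm
    | inc y x => exact h y x
    | add v w hv hw =>
      exact (map_add _ v w).trans ((congrArg₂ (· + ·) hv hw).trans (map_add _ v w).symm)
  have h0 : q n = 0 := (DFunLike.congr_fun hL n).symm.trans ((congrArg L hn).trans (map_zero L))
  exact (Submodule.Quotient.mk_eq_zero _).1 h0

/-- For projective finitary `P i` and flat `C`, the unit `Y → ⨁ Hom_C(P, Y ⊗_R Σ)` is injective: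
if `y ⊗ p = 0` on `P i`, then `p ↦ p` into the copy of `Σ` with index `y` lifts to a finite
combination of the defining relations of `Y ⊗_R Σ`, and these relations hold in `Y`. -/
theorem op_singleR_smul_eq_zero (hC : IsFlat A C.carrier) {i : ι} (hi : (P i).IsFinitary)
    [Projective (P i)] (y₀ : Y.carrier) (h0 : ∀ x : Sig P, tmul (ringR P) y₀ x = 0) :
    op (singleR (𝟙 (P i))) • y₀ = 0 := by
  classical
  let K := kerComod hC (freeHom Y)
  let D : relCover Y ⟶ K := subLift hC _ (ker_coact hC (freeHom Y)) (relHom Y)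
    (fun x => LinearMap.congr_fun (congrArg Hom.toLin (relHom_freeHom Y)) x)
  have hD : Function.Surjective D.toLin := by
    intro k
    obtain ⟨m, hm⟩ := exists_relHom_eq Y k.1 k.2
    exact ⟨m, Subtype.ext hm⟩
  have : Epi D := epi_of_surjective D hD
  let h : P i ⟶ K := subLift hC _ (ker_coact hC (freeHom Y)) (incHom P i ≫ freeInc Y y₀)
    (fun p => (freeHom_freeInc_apply Y y₀ (inc P i p)).trans (h0 _))
  have ht : Projective.factorThru h D ≫ relHom Y = incHom P i ≫ freeInc Y y₀ :=
    congrArg (· ≫ subHom hC _ _ (ker_coact hC (freeHom Y))) (Projective.factorThru_comp h D)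
  obtain ⟨s, u, hu⟩ := exists_comp_relHom_eq_sum Y hi (Projective.factorThru h D)
  -- `T` contains all indices that occur in the finitely many relations used.
  let supp : (Y.carrier × Y.carrier) ⊕ (Y.carrier × ringR P) → Finset Y.carrier := fun l =>
    match l with
    | Sum.inl (y, z) => {y + z, y, z}
    | Sum.inr (y, r) => {op r • y, y}
  let T : Finset Y.carrier := insert y₀ (s.biUnion supp)
  let θ : (P i ⟶ freeCover Y) →+ Y.carrier :=
    ∑ y ∈ T, (NUModule.opSmulHom y).comp ((toRingR hi).comp (Preadditive.rightComp _ (freeProj Y y)))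
  have hθ : ∀ (y : Y.carrier) (u : P i ⟶ sigmaComod P), y ∈ T →
      θ (u ≫ freeInc Y y) = op (toRingR hi u) • y := by
    intro y u hy
    rw [AddMonoidHom.finsetSum_apply, Finset.sum_eq_single_of_mem y hy]
    · change op (toRingR hi ((u ≫ freeInc Y y) ≫ freeProj Y y)) • y = _
      rw [Category.assoc, freeInc_freeProj, Category.comp_id]
    · intro z _ hz
      change NUModule.opSmulHom z (toRingR hi ((u ≫ freeInc Y y) ≫ freeProj Y z)) = _
      rw [Category.assoc, freeInc_freeProj_ne Y (Ne.symm hz), Limits.comp_zero, map_zero, map_zero]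
  have hrel : ∀ l ∈ s, ∀ u : P i ⟶ sigmaComod P, θ (u ≫ tensorRel Y l) = 0 := by
    intro l hl u
    have hT : ∀ y ∈ supp l, y ∈ T := fun y hy =>
      Finset.mem_insert_of_mem (Finset.mem_biUnion.2 ⟨l, hl, hy⟩)
    obtain ⟨y, z⟩ | ⟨y, r⟩ := l
    · rw [tensorRel, Preadditive.comp_sub, Preadditive.comp_sub, map_sub, map_sub,
        hθ _ _ (hT _ (by simp [supp])), hθ _ _ (hT _ (by simp [supp])),
        hθ _ _ (hT _ (by simp [supp])), NUModule.smul_add]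
      abel
    · rw [tensorRel, Preadditive.comp_sub, map_sub, ← Category.assoc,
        hθ _ _ (hT _ (by simp [supp])), hθ _ _ (hT _ (by simp [supp])), toRingR_comp_actHom,
        NUModule.op_mul_smul, sub_self]
  have h1 := hθ y₀ (incHom P i) (Finset.mem_insert_self _ _)
  rw [← ht, hu, map_sum, Finset.sum_eq_zero fun l hl => hrel l hl _] at h1
  exact h1.symm

end Free

/-- If the `P i` generate and are finitary and `C` is flat, the evaluations are injective: an
element of the kernel lifts to `⨁_{f} Σ`, and the kernel of `⨁_{f} Σ → M` is generated by
morphisms from the `P i`. -/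
theorem evalHom_injective_of_isSeparator (hC : IsFlat A C.carrier)
    (hP : IsSeparator (sigmaComod P)) (hfin : ∀ i, (P i).IsFinitary) (M : Comod C) :
    Function.Injective (evalHom P M) := by
  rw [injective_iff_map_eq_zero]
  intro w hw
  obtain ⟨n, rfl⟩ := freeHom_surjective (homSigmaObj P M) w
  let g := freeHom (homSigmaObj P M) ≫ counitHom P M
  let K := kerComod hC g
  have key : ∀ v : BalTensor (ringR P) (homSigmaObj P K).carrier (Sig P),
      (freeHom (homSigmaObj P M)).toLin ((subHom hC _ _ (ker_coact hC g)).toLin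
        (evalHom P K v)) = 0 := by
    intro v
    induction v using induction_on with
    | zero => rw [map_zero, map_zero, map_zero]
    | add v w hv hw => rw [map_add, map_add, map_add, hv, hw, add_zero]
    | tmul f x =>
      induction x using sig_induction with
      | zero => rw [tmul_zero, map_zero, map_zero, map_zero]
      | add x y hx hy => rw [tmul_add, map_add, map_add, map_add, hx, hy, add_zero]
      | inc i p =>
        obtain ⟨y, hy⟩ := exists_eq_tmul (homSigmaObj P M) (hfin i)
          (incHom P i ≫ homSigmaObj.hom f ≫ subHom hC _ _ (ker_coact hC g))
        refine (hy p).trans ?_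
        have h0 : op (singleR (𝟙 (P i))) • y = 0 := by
          refine homSigmaObj.lin_injective (LinearMap.ext fun z => ?_)
          change evalHom P M (tmul (ringR P) y (inc P i (proj P i z))) = 0
          rw [← hy]
          exact (homSigmaObj.lin f (inc P i (proj P i z))).2
        rw [← op_singleR_smul_tmul, h0, zero_tmul]
        rfl
  obtain ⟨v, hv⟩ := evalHom_surjective_of_isSeparator hP K ⟨n, hw⟩
  refine Eq.trans ?_ (key v)
  rw [hv]
  rfl

theorem fgProjective_of_isGeneratingSet (hP : IsGeneratingSetOfSmallProjectives P) :
    FGProjective P := fun i => by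
  have := hP.projective
  have := projective_of_sigmaComod (P := P) i
  exact finite_and_projective (isFinitary_of_isSmallObject (hP.small i))

theorem isEquivalence_of_isGeneratingSet (hC : IsFlat A C.carrier)
    (hP : IsGeneratingSetOfSmallProjectives P) : (tensorSigma P).IsEquivalence := by
  have hfin := fun i => isFinitary_of_isSmallObject (hP.small i)
  have := hP.projective
  have hproj := fun i => projective_of_sigmaComod (P := P) i
  have : (tensorSigma P).Faithful := ⟨fun {X Y f g} hfg => by
    apply UnitalRightMod.hom_ext
    ext x
    rw [← sub_eq_zero]
    refine Y.eq_zero_of_singleR_smul _ fun i => ?_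
    refine op_singleR_smul_eq_zero Y hC (hfin i) _ fun z => ?_
    rw [sub_tmul, sub_eq_zero]
    exact DFunLike.congr_fun ((tensorSigma_map_eq_iff f g).1 hfg) (tmul (ringR P) x z)⟩
  exact isEquivalence_of_faithful P fun M => ⟨evalHom_injective_of_isSeparator hC hP.generator
    hfin M, evalHom_surjective_of_isSeparator hP.generator M⟩

end Generators

/-! ### From an equivalence to small projective generators -/

section Equivalence

variable {ι : Type u} [DecidableEq ι] {P : ι → Comod C}

open Comod

theorem evalHom_tensor_surjective {K : UnitalRightMod (ringR P)} {M : Comod C}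
    [(tensorSigma P).IsEquivalence] (f : K ⟶ homSigmaObj P M)
    (hf : Function.Surjective fun w => evalHom P M (UnitalRightMod.Hom.tensor f (Sig P) w)) :
    Function.Surjective f.toAddHom := by
  have h1 : Function.Surjective ((tensorSigma P).map f).toLin := fun w => by
    obtain ⟨v, hv⟩ := hf (evalHom P M w)
    exact ⟨v, (evalHom_bijective P M).1 hv⟩
  have : Epi ((tensorSigma P).map f) := epi_of_surjective _ h1
  have : Epi f := (tensorSigma P).epi_of_epi_map inferInstance
  exact UnitalRightMod.surjective_of_epi f

theorem homSigma_map_surjective [(tensorSigma P).IsEquivalence] {M N : Comod C} (e : M ⟶ N)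
    (he : Function.Surjective e.toLin) :
    Function.Surjective ((homSigma P).map e).toAddHom := by
  refine evalHom_tensor_surjective (M := N) ((homSigma P).map e) fun n => ?_
  obtain ⟨m, rfl⟩ := he n
  obtain ⟨w, rfl⟩ := (evalHom_bijective P M).2 m
  exact ⟨w, LinearMap.congr_fun (congrArg Hom.toLin ((tensorHomAdjunction P).counit.naturality e)) w⟩

/-- The members of `P` are finitary if `- ⊗_R Σ` is an equivalence: in `⨁ Hom_C(P, ⨁ Q j)` the
submodule of the morphisms that factor through finite subcoproducts generates `⨁ Q j`, so it is
everything. -/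
theorem isFinitary_of_isEquivalence [(tensorSigma P).IsEquivalence] (i : ι) :
    (P i).IsFinitary := by
  intro J _ Q h
  let G := homSigmaObj P (sigmaComod Q)
  let e : J → (G ⟶ G) := fun j => (homSigma P).map (projHom Q j ≫ incHom Q j)
  let U : AddSubgroup G.carrier :=
    { carrier := {f | ∃ s : Finset J, ∀ t, s ⊆ t → ∑ j ∈ t, (e j).toAddHom f = f}
      zero_mem' := ⟨∅, fun t _ => by simp⟩
      add_mem' := by
        rintro f g ⟨s, hs⟩ ⟨s', hs'⟩
        exact ⟨s ∪ s', fun t ht => by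
          simp only [map_add, Finset.sum_add_distrib]
          rw [hs t (Finset.union_subset_left ht), hs' t (Finset.union_subset_right ht)]⟩
      neg_mem' := by
        rintro f ⟨s, hs⟩
        exact ⟨s, fun t ht => by
          simp only [map_neg, Finset.sum_neg_distrib]
          rw [hs t ht]⟩ }
  have hU : ∀ (r : ringR P), ∀ f ∈ U, op r • f ∈ U := by
    rintro r f ⟨s, hs⟩
    refine ⟨s, fun t ht => ?_⟩
    conv_rhs => rw [← hs t ht, NUModule.nu_smul_sum]
    exact Finset.sum_congr rfl fun j _ => (e j).map_smul f r
  have hinc : ∀ (j : J) (f : (homSigmaObj P (Q j)).carrier),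
      ((homSigma P).map (incHom Q j)).toAddHom f ∈ U := by
    intro j f
    refine ⟨{j}, fun t ht => ?_⟩
    have h1 : ∀ k {g : Q j ⟶ sigmaComod Q}, incHom Q j ≫ projHom Q k ≫ incHom Q k = g →
        (e k).toAddHom (((homSigma P).map (incHom Q j)).toAddHom f) =
          ((homSigma P).map g).toAddHom f := fun k g hg =>
      congrArg (fun g => ((homSigma P).map g).toAddHom f) hg
    refine (Finset.sum_eq_single_of_mem j (ht (Finset.mem_singleton_self j)) ?_).trans (h1 j ?_)
    · intro k _ hk
      refine (h1 k (g := 0) ?_).trans rfl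
      rw [← Category.assoc, incHom_projHom_ne Q hk.symm, Limits.zero_comp]
    · rw [← Category.assoc, incHom_projHom, Category.id_comp]
  have hsurj : Function.Surjective (G.subHom U hU).toAddHom := by
    refine evalHom_tensor_surjective (M := sigmaComod Q) (G.subHom U hU) fun m => ?_
    induction (m : Sig Q) using sig_induction with
    | zero => exact ⟨0, (congrArg _ (map_zero _)).trans (map_zero _)⟩
    | inc j q =>
      obtain ⟨w, rfl⟩ := (evalHom_bijective P (Q j)).2 q
      induction w using induction_on with
      | zero => exact ⟨0, by rw [map_zero (evalHom P (Q j)), map_zero (inc Q j)]; rfl⟩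
      | tmul f x =>
        exact ⟨tmul (ringR P) (⟨_, hinc j f⟩ : U) x, rfl⟩
      | add v w hv hw =>
        obtain ⟨v', hv'⟩ := hv
        obtain ⟨w', hw'⟩ := hw
        refine ⟨v' + w', ?_⟩
        rw [map_add (evalHom P (Q j)), map_add (inc Q j), ← hv', ← hw']
        exact (congrArg _ (map_add _ _ _)).trans (map_add _ _ _)
    | add x y hx hy =>
      obtain ⟨v, hv⟩ := hx
      obtain ⟨w, hw⟩ := hy
      exact ⟨v + w, (congrArg _ (map_add _ v w)).trans ((map_add _ _ _).trans
        (congrArg₂ (· + ·) hv hw))⟩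
  obtain ⟨f, hf⟩ := hsurj (homSigmaObj.ofHom (projHom P i ≫ h) (singleR (𝟙 (P i))))
  obtain ⟨s, hs⟩ := f.2
  refine ⟨s, fun t ht => ?_⟩
  have h1 := hs t ht
  rw [show f.1 = homSigmaObj.ofHom (projHom P i ≫ h) (singleR (𝟙 (P i))) from hf] at h1
  apply Comod.hom_ext
  ext p
  have h2 : ∀ p : (P i).carrier, homSigmaObj.lin (homSigmaObj.ofHom (projHom P i ≫ h)
      (singleR (𝟙 (P i)))) (inc P i p) = h.toLin p := by
    intro p
    rw [homSigmaObj.lin_ofHom, singleR_smul_inc]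
    exact congrArg h.toLin (LinearMap.congr_fun (proj_inc_self P i) p)
  rw [sum_toLin, LinearMap.sum_apply, ← h2 p]
  let ev : G.carrier →+ Sig Q :=
    AddMonoidHom.mk' (fun f => homSigmaObj.lin f (inc P i p)) (fun _ _ => rfl)
  refine Eq.trans ?_ (congrArg ev h1)
  rw [map_sum]
  exact Finset.sum_congr rfl fun j _ =>
    congrArg (fun x => inc Q j (proj Q j x)) (h2 p).symm

theorem isGeneratingSet_of_isEquivalence [(tensorSigma P).IsEquivalence] :
    IsGeneratingSetOfSmallProjectives P where
  small i := isSmallObject_of_isFinitary (isFinitary_of_isEquivalence i)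
  projective :=
    { factors := fun {E X} f e _ => by
        have h1 := homSigma_map_surjective (P := P) e (surjective_of_epi e)
        choose g hg using fun i => h1 (homSigmaObj.ofHom f (singleR (𝟙 (P i))))
        refine ⟨liftHom fun i => incHom P i ≫ homSigmaObj.hom (g i),
          sigmaComod_hom_ext _ fun i => ?_⟩
        rw [← Category.assoc, incHom_liftHom]
        apply Comod.hom_ext
        ext p
        refine (LinearMap.congr_fun (congrArg homSigmaObj.lin (hg i)) (inc P i p)).trans ?_
        exact congrArg f.toLin (singleR_smul_inc (𝟙 (P i)) p) }
  generator := by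
    rw [isSeparator_def]
    intro X Y f g hfg
    refine Comod.hom_ext (LinearMap.ext fun x => ?_)
    obtain ⟨w, rfl⟩ := (evalHom_bijective P X).2 x
    induction w using induction_on with
    | zero => rw [map_zero, map_zero, map_zero]
    | tmul h z => exact LinearMap.congr_fun (congrArg Hom.toLin (hfg (homSigmaObj.hom h))) z
    | add v w hv hw => rw [map_add, map_add, map_add, hv, hw]

/-- The map `Σ† → ⨁ Hom_C(P, A ⊗ C)`, `φ ↦ (φ ⊗ C) ρ`. -/
def dagToHomSigma (P : ι → Comod C) : SigDag P →+ (homSigmaObj P (cofree C A)).carrier :=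
  AddMonoidHom.mk' (fun φ => homSigmaObj.mk (cofreeLift (M := sigmaComod P) φ.1).toLin
      (comp_sigCoact_mem_sigHom ⟨φ.1, exists_comp_idemR_eq φ⟩)
      (cofreeLift (M := sigmaComod P) φ.1).coact_comm)
    (fun φ ψ => homSigmaObj.lin_injective (LinearMap.ext fun x => by
      change rTensor C.carrier (φ.1 + ψ.1) (sigCoact P x) = _
      rw [rTensor_add]
      rfl))

theorem dagToHomSigma_op_smul (φ : SigDag P) (r : ringR P) :
    dagToHomSigma P (op r • φ) = op r • dagToHomSigma P φ :=
  homSigmaObj.lin_injective (LinearMap.ext fun x => by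
    change rTensor C.carrier (φ.1 ∘ₗ smulLin (Sig P) r) (sigCoact P x) =
      rTensor C.carrier φ.1 (sigCoact P (r • x))
    rw [rTensor_comp_apply, ← sigCoact_smul])

theorem mem_sigDag_of_comp_idemR_eq (f : Sig P →ₗ[Aᵐᵒᵖ] A) (s : Finset ι)
    (hs : f ∘ₗ (idemR P s).1 = f) : f ∈ SigDag P := by
  have h : f = ∑ i ∈ s, (f ∘ₗ inc P i) ∘ₗ proj P i := by
    conv_lhs => rw [← hs, idemR, AddSubmonoidClass.coe_finsetSum]
    refine LinearMap.ext fun x => ?_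
    rw [LinearMap.comp_apply, LinearMap.sum_apply, LinearMap.sum_apply, map_sum]
    rfl
  rw [h]
  exact sum_mem fun i _ => comp_proj_mem P i _

theorem dagToHomSigma_bijective : Function.Bijective (dagToHomSigma P) := by
  constructor
  · intro φ ψ h
    refine Subtype.ext (LinearMap.ext fun x => ?_)
    have h1 := cofreeCounit_cofreeLift (M := sigmaComod P) φ.1 x
    have h2 := cofreeCounit_cofreeLift (M := sigmaComod P) ψ.1 x
    exact h1.symm.trans ((congrArg (fun g => cofreeCounit C A (homSigmaObj.lin g x)) h).trans h2)
  · intro g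
    obtain ⟨s, hs⟩ := g.1.2
    refine ⟨⟨cofreeCounit C A ∘ₗ homSigmaObj.lin g, mem_sigDag_of_comp_idemR_eq _ s ?_⟩, ?_⟩
    · exact congrArg (fun k : Sig P →ₗ[Aᵐᵒᵖ] BalTensor A A C.carrier => cofreeCounit C A ∘ₗ k)
        (hs s subset_rfl)
    · exact homSigmaObj.lin_injective
        (congrArg Hom.toLin (cofreeLift_counit (homSigmaObj.hom g)))

/-- If `- ⊗_R Σ` is an equivalence then `can` is bijective: up to isomorphisms it is the counit
of the adjunction at the comodule `A ⊗ C`. -/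
theorem can_bijective_of_isEquivalence [(tensorSigma P).IsEquivalence] :
    Function.Bijective (can P) := by
  have h : ⇑(can P) = leftUnit ∘ evalHom P (cofree C A) ∘ mapLeft (Sig P) (dagToHomSigma P)
      dagToHomSigma_op_smul := by
    funext d
    exact DFunLike.congr_fun (BalTensor.hom_ext (f := can P) (g := leftUnit.comp
      ((evalHom P (cofree C A)).comp (mapLeft (Sig P) (dagToHomSigma P)
        dagToHomSigma_op_smul))) fun _ _ => rfl) d
  rw [h]
  exact leftUnit_bijective.comp ((evalHom_bijective P _).comp
    (mapLeft_bijective dagToHomSigma_bijective))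

end Equivalence

/-! ### The canonical map as a morphism of corings -/

section CoringHom

variable {ι : Type u} [DecidableEq ι] {P : ι → Comod C}

/-- The coaction of `Σ` over `Σ† ⊗_R Σ` induces that over `C` along `can`. -/
theorem mapRight_can_comatrixCoact (h : FGProjective P) (x : Sig P) :
    mapRight (Sig P) (can P) (can_smul P) (comatrixCoact h x) = sigCoact P x := by
  induction x using sig_induction with
  | zero => simp
  | add x y hx hy => simp only [map_add, hx, hy]
  | inc i p =>
    rw [comatrixCoact_inc, map_sum, sigCoact_inc]
    simp only [mapRight_tmul, can_mk, sigCoact_inc]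
    generalize (P i).coact p = z
    induction z using induction_on with
    | zero => simp
    | add x y hx hy => simp only [map_add, tmul_add, Finset.sum_add_distrib, hx, hy]
    | tmul m c =>
      have h1 : ∀ k, (incDag P i (db' h i k)).1 (inc P i m) = db' h i k m := fun k =>
        congrArg (fun f => db' h i k (f m)) (proj_inc_self P i)
      simp only [rTensor_tmul, leftUnit_tmul, h1]
      conv_rhs => rw [← db_spec h i m, map_sum, sum_tmul]
      refine Finset.sum_congr rfl fun k _ => ?_
      rw [map_smul, smul_tmul]

theorem counit_can (d : Comatrix P) : C.counit (can P d) = comatrixCounit P d := by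
  induction d using Comatrix.induction with
  | zero => simp
  | add x y hx hy => simp only [map_add, hx, hy]
  | mk φ i p =>
    rw [can_mk, comatrixCounit_mk]
    have h : ∀ z : BalTensor A (Sig P) C.carrier, C.counit (leftUnit (rTensor C.carrier φ.1 z)) =
        φ.1 (rightUnit (mapRight (Sig P) C.counit C.counit_smul z)) := by
      intro z
      induction z using induction_on with
      | zero => simp
      | tmul m c =>
        rw [rTensor_tmul, leftUnit_tmul, C.counit_smul, mapRight_tmul, rightUnit_tmul, map_smul]
        rfl
      | add x y hx hy => simp only [map_add, hx, hy]
    rw [h]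
    exact congrArg φ.1 ((sigmaComod P).counit (inc P i p))

theorem comul_can (h : FGProjective P) (d : Comatrix P) :
    C.comul (can P d) = map (can P) (can P) (fun d a => can_op_smul P (op a) d) (can_smul P)
      (comatrixComul h d) := by
  induction d using Comatrix.induction with
  | zero => simp
  | add x y hx hy => simp only [map_add, hx, hy]
  | mk φ i p =>
    generalize inc P i p = x
    let ψ : Sig P →ₗ[Aᵐᵒᵖ] C.carrier :=
      { toFun := fun x => can P (Comatrix.mk P φ x)
        map_add' := fun x y => by rw [map_add, map_add]
        map_smul' := fun a x => by rw [map_smul, can_op_smul]; rfl }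
    have h1 : ∀ z : BalTensor A (Sig P) (Comatrix P),
        map (can P) (can P) (fun d a => can_op_smul P (op a) d) (can_smul P)
          (rTensor (Comatrix P) (Comatrix.mk P φ) z) =
        rTensor C.carrier ψ (mapRight (Sig P) (can P) (can_smul P) z) := fun z =>
      DFunLike.congr_fun (BalTensor.hom_ext
        (f := (map (can P) (can P) (fun d a => can_op_smul P (op a) d) (can_smul P)).comp
          (rTensor (Comatrix P) (Comatrix.mk P φ)))
        (g := (rTensor C.carrier ψ).comp (mapRight (Sig P) (can P) (can_smul P)))
        fun _ _ => rfl) z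
    have h2 : ∀ z : BalTensor A (Sig P) C.carrier, rTensor C.carrier ψ z =
        leftUnit (rTensor (BalTensor A C.carrier C.carrier) φ.1
          (assoc (rTensor C.carrier (sigCoact P) z))) := by
      intro z
      induction z using induction_on with
      | zero => simp
      | add x y hx hy => simp only [map_add, hx, hy]
      | tmul x c =>
        rw [rTensor_tmul, rTensor_tmul]
        change tmul A (leftUnit (rTensor C.carrier φ.1 (sigCoact P x))) c = _
        generalize sigCoact P x = y
        induction y using induction_on with
        | zero => simp
        | add x y hx hy => simp only [map_add, add_tmul, hx, hy]
        | tmul m c' => rfl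
    have h3 : ∀ z : BalTensor A (Sig P) C.carrier,
        leftUnit (rTensor (BalTensor A C.carrier C.carrier) φ.1
          (mapRight (Sig P) C.comul C.comul_smul z)) =
        C.comul (leftUnit (rTensor C.carrier φ.1 z)) := by
      intro z
      induction z using induction_on with
      | zero => simp
      | add x y hx hy => simp only [map_add, hx, hy]
      | tmul x c => exact (C.comul_smul (φ.1 x) c).symm
    rw [can_mk, ← h3]
    refine Eq.trans ?_ (h1 (comatrixCoact h x)).symm
    rw [mapRight_can_comatrixCoact, h2]
    exact congrArg _ (congrArg _ ((sigmaComod P).coassoc x)).symm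

/-- If `can` is bijective, it is an isomorphism of corings. -/
theorem canIsIso_of_bijective (h : FGProjective P) (hcan : Function.Bijective (can P)) :
    CanIsIso h where
  bijective := hcan
  map_smul := can_smul P
  map_op_smul d a := can_op_smul P (op a) d
  map_comul := comul_can h
  map_counit := counit_can

end CoringHom

/-! ### Change of coring -/

section ChangeOfCoring

variable {D : Coring A} {f : D.carrier →+ C.carrier}

theorem IsCoringIso.symm (hf : IsCoringIso (D := D) (C := C) f) :
    IsCoringIso (D := C) (C := D) (AddEquiv.ofBijective f hf.bijective).symm.toAddMonoidHom := by
  let e := AddEquiv.ofBijective f hf.bijective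
  have he : ∀ d, e.symm (f d) = d := e.symm_apply_apply
  have h1 : ∀ (a : A) (c : C.carrier), e.symm (a • c) = a • e.symm c := fun a c => by
    obtain ⟨d, rfl⟩ := hf.bijective.2 c
    rw [← hf.map_smul, he, he]
  have h2 : ∀ (c : C.carrier) (a : A), e.symm (op a • c) = op a • e.symm c := fun c a => by
    obtain ⟨d, rfl⟩ := hf.bijective.2 c
    rw [← hf.map_op_smul, he, he]
  refine ⟨e.symm.bijective, h1, h2, fun c => ?_, fun c => ?_⟩
  · obtain ⟨d, rfl⟩ := hf.bijective.2 c
    have h3 : ∀ z : BalTensor A D.carrier D.carrier, map e.symm.toAddMonoidHom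
        e.symm.toAddMonoidHom h2 h1 (map f f hf.map_op_smul hf.map_smul z) = z := by
      intro z
      refine DFunLike.congr_fun (f := (map e.symm.toAddMonoidHom
        e.symm.toAddMonoidHom h2 h1).comp (map f f hf.map_op_smul hf.map_smul))
        (g := AddMonoidHom.id _) (BalTensor.hom_ext fun x y => ?_) z
      exact congrArg₂ (tmul A) (he x) (he y)
    rw [hf.map_comul]
    exact (congrArg D.comul (he d)).trans (h3 _).symm
  · obtain ⟨d, rfl⟩ := hf.bijective.2 c
    rw [hf.map_counit]
    exact congrArg D.counit (he d)

variable (hf : IsCoringIso (D := D) (C := C) f)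

/-- The coaction `(M ⊗ f) ρ` over `C` on a `D`-comodule `M`. -/
def changeCoact (M : Comod D) : M.carrier →ₗ[Aᵐᵒᵖ] BalTensor A M.carrier C.carrier where
  toFun m := mapRight M.carrier f hf.map_smul (M.coact m)
  map_add' := by simp
  map_smul' a m := by
    rw [map_smul]
    generalize M.coact m = z
    induction z using induction_on with
    | zero => simp
    | tmul m d => exact congrArg (tmul A m) (hf.map_op_smul d a.unop)
    | add x y hx hy => simp only [smul_add, map_add, hx, hy]

theorem changeCoact_apply (M : Comod D) (m : M.carrier) :
    changeCoact hf M m = mapRight M.carrier f hf.map_smul (M.coact m) := rfl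

/-- The functor from `D`-comodules to `C`-comodules given by an isomorphism of corings. -/
def changeCoring : Comod D ⥤ Comod C where
  obj M :=
    { carrier := M.carrier
      coact := changeCoact hf M
      coassoc := fun m => by
        have hff : ∀ (a : A) (z : BalTensor A D.carrier D.carrier),
            map f f hf.map_op_smul hf.map_smul (a • z) =
              a • map f f hf.map_op_smul hf.map_smul z := by
          intro a z
          induction z using induction_on with
          | zero => simp
          | tmul x y => simp [hf.map_smul]
          | add x y hx hy => simp only [smul_add, map_add, hx, hy]
        have h1 : ∀ z : BalTensor A M.carrier D.carrier,
            assoc (rTensor C.carrier (changeCoact hf M)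
              (mapRight M.carrier f hf.map_smul z)) =
            mapRight M.carrier (map f f hf.map_op_smul hf.map_smul) hff
              (assoc (rTensor D.carrier M.coact z)) := by
          intro z
          induction z using induction_on with
          | zero => simp
          | add x y hx hy => simp only [map_add, hx, hy]
          | tmul m d =>
            rw [mapRight_tmul, rTensor_tmul, rTensor_tmul, changeCoact_apply]
            generalize M.coact m = y
            induction y using induction_on with
            | zero => simp
            | add x y hx hy => simp only [map_add, add_tmul, hx, hy]
            | tmul m d' => rfl
        have h2 : ∀ z : BalTensor A M.carrier D.carrier,
            mapRight M.carrier (map f f hf.map_op_smul hf.map_smul) hff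
              (mapRight M.carrier D.comul D.comul_smul z) =
            mapRight M.carrier C.comul C.comul_smul
              (mapRight M.carrier f hf.map_smul z) := by
          intro z
          induction z using induction_on with
          | zero => simp
          | add x y hx hy => simp only [map_add, hx, hy]
          | tmul m d => exact congrArg (tmul A m) (hf.map_comul d).symm
        rw [changeCoact_apply, h1, M.coassoc, h2]
      counit := fun m => by
        refine Eq.trans (congrArg rightUnit ?_) (M.counit m)
        rw [changeCoact_apply]
        refine DFunLike.congr_fun (f := (mapRight M.carrier C.counit C.counit_smul).comp
          (mapRight M.carrier f hf.map_smul)) (g := mapRight M.carrier D.counit D.counit_smul)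
          (BalTensor.hom_ext fun m d => ?_) (M.coact m)
        exact congrArg (tmul A m) (hf.map_counit d) }
  map {M N} g :=
    { toLin := g.toLin
      coact_comm := fun m => by
        change rTensor C.carrier g.toLin (mapRight M.carrier f hf.map_smul (M.coact m)) =
          mapRight N.carrier f hf.map_smul (N.coact (g.toLin m))
        rw [← mapRight_rTensor, g.coact_comm] }
  map_id _ := rfl
  map_comp _ _ := rfl

theorem changeCoring_isEquivalence : (changeCoring hf).IsEquivalence where
  faithful := ⟨fun {M N g g'} h => Comod.hom_ext
    (congrArg Comod.Hom.toLin h : ((changeCoring hf).map g).toLin = _)⟩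
  full := ⟨fun {M N} g => by
    let g' : M.carrier →ₗ[Aᵐᵒᵖ] N.carrier := g.toLin
    refine ⟨⟨g', fun m => ?_⟩, rfl⟩
    apply (mapRight_bijective (M := N.carrier) (hg := hf.map_smul) hf.bijective).1
    exact (mapRight_rTensor g' f hf.map_smul (M.coact m)).trans (g.coact_comm m)⟩
  essSurj := ⟨fun N => by
    have h1 : ∀ n : N.carrier, changeCoact hf ((changeCoring hf.symm).obj N) n = N.coact n := by
      intro n
      refine DFunLike.congr_fun (f := (mapRight N.carrier f hf.map_smul).comp
        (mapRight N.carrier _ hf.symm.map_smul)) (g := AddMonoidHom.id _)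
        (BalTensor.hom_ext fun m c => ?_) (N.coact n)
      exact congrArg (tmul A m) ((AddEquiv.ofBijective f hf.bijective).apply_symm_apply c)
    refine ⟨(changeCoring hf.symm).obj N, ⟨⟨⟨LinearMap.id, fun n => ?_⟩,
      ⟨LinearMap.id, fun n => ?_⟩, rfl, rfl⟩⟩⟩
    · exact (DFunLike.congr_fun rTensor_id _).trans (h1 n)
    · exact (DFunLike.congr_fun rTensor_id _).trans (h1 n).symm⟩

variable {ι : Type u} [DecidableEq ι] {P : ι → Comod C}

/-- Along `can`, the functor `- ⊗_R Σ` to comodules over `Σ† ⊗_R Σ` becomes that to comodules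
over `C`. -/
def tensorSigmaComatrixIso (h : FGProjective P) (hcan : CanIsIso h) :
    tensorSigmaComatrix h ⋙ changeCoring hcan ≅ tensorSigma P :=
  have h1 : ∀ (Y : UnitalRightMod (ringR P)) (w : BalTensor (ringR P) Y.carrier (Sig P)),
      mapRight (BalTensor (ringR P) Y.carrier (Sig P)) (can P) (can_smul P)
        (tensorCoact Y.carrier (comatrixCoact h) (comatrixCoact_smul h) w) =
      tensorCoact Y.carrier (sigCoact P) (sigCoact_smul P) w := by
    intro Y w
    induction w using induction_on with
    | zero => simp
    | add x y hx hy => simp only [map_add, hx, hy]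
    | tmul y x =>
      rw [tensorCoact_tmul, tensorCoact_tmul, mapRight_rTensor, mapRight_can_comatrixCoact]
  NatIso.ofComponents (fun Y => ⟨⟨LinearMap.id, fun w => (DFunLike.congr_fun rTensor_id _).trans
      (h1 Y w)⟩, ⟨LinearMap.id, fun w => (DFunLike.congr_fun rTensor_id _).trans (h1 Y w).symm⟩,
      rfl, rfl⟩) (fun _ => rfl)

theorem tensorSigmaComatrix_isEquivalence_iff (h : FGProjective P) (hcan : CanIsIso h) :
    (tensorSigmaComatrix h).IsEquivalence ↔ (tensorSigma P).IsEquivalence := by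
  have := changeCoring_isEquivalence hcan
  constructor
  · intro _
    exact Functor.isEquivalence_of_iso (tensorSigmaComatrixIso h hcan)
  · intro _
    have : (tensorSigmaComatrix h ⋙ changeCoring hcan).IsEquivalence :=
      Functor.isEquivalence_of_iso (tensorSigmaComatrixIso h hcan).symm
    exact Functor.isEquivalence_of_comp_right _ (changeCoring hcan)

end ChangeOfCoring

end Corings
end

theorem theorem3 {A : Type u} [Ring A] (C : Corings.Coring A) {ι : Type u} [DecidableEq ι]
    (P : ι → Corings.Comod C) :
    List.TFAE
      [ Corings.IsFlat A C.carrier ∧ Corings.IsGeneratingSetOfSmallProjectives P,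
        Corings.IsFlat A C.carrier ∧ ∃ h : Corings.FGProjective P,
          Corings.CanIsIso h ∧ (Corings.tensorSigmaComatrix h).IsEquivalence,
        ∃ h : Corings.FGProjective P, Corings.CanIsIso h ∧
          Corings.IsFaithfullyFlat (Corings.ringR P) (Corings.Sig P),
        Corings.IsFlat A C.carrier ∧ ∃ h : Corings.FGProjective P, Corings.CanIsIso h ∧
          Corings.IsFaithfullyFlat (Corings.ringR P) (Corings.ringS P),
        Corings.IsFlat A C.carrier ∧ (Corings.tensorSigma P).IsEquivalence ] := by
  open Corings in
  have key : ∀ [(tensorSigma P).IsEquivalence], ∃ h : FGProjective P, CanIsIso h := by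
    intro _
    have h := fgProjective_of_isGeneratingSet (isGeneratingSet_of_isEquivalence (P := P))
    exact ⟨h, canIsIso_of_bijective h can_bijective_of_isEquivalence⟩
  tfae_have 1 → 5 := fun ⟨hC, hP⟩ => ⟨hC, isEquivalence_of_isGeneratingSet hC hP⟩
  tfae_have 5 → 1 := fun ⟨hC, _⟩ => ⟨hC, isGeneratingSet_of_isEquivalence⟩
  tfae_have 5 → 2 := fun ⟨hC, hF⟩ => by
    obtain ⟨h, hcan⟩ := key
    exact ⟨hC, h, hcan, (tensorSigmaComatrix_isEquivalence_iff h hcan).2 hF⟩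
  tfae_have 2 → 5 := fun ⟨hC, h, hcan, hF⟩ =>
    ⟨hC, (tensorSigmaComatrix_isEquivalence_iff h hcan).1 hF⟩
  tfae_have 5 → 3 := fun ⟨hC, hF⟩ => by
    obtain ⟨h, hcan⟩ := key
    exact ⟨h, hcan, isFaithfullyFlat_of_isEquivalence hC⟩
  tfae_have 3 → 5 := fun ⟨h, hcan, hff⟩ => ⟨isFlat_of_flat h hcan.bijective hff.flat,
    isEquivalence_of_isFaithfullyFlat h hcan.bijective hff⟩
  tfae_have 3 → 4 := fun ⟨h, hcan, hff⟩ => ⟨isFlat_of_flat h hcan.bijective hff.flat, h, hcan,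
    isFaithfullyFlat_ringS h hff⟩
  tfae_have 4 → 3 := fun ⟨hC, h, hcan, hff⟩ => ⟨h, hcan, isFaithfullyFlat_of_ringS hC h hcan hff⟩
  tfae_finish
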